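/- Let $\Omega\subset\mathbb R^2=\mathbb C$ be a bounded convex open domain whose boundary is a $C^\infty$ closed curve of length $\ell$ with strictly positive curvature, and let $\gamma:\mathbb T_\ell=\mathbb R/\ell\mathbb Z\to\partial\Omega$ be its positively oriented arc-length parametrization. Let $f:\mathbb T_\ell\times[0,\pi]\to\mathbb T_\ell\times[0,\pi]$, $(s,\varphi)\mapsto(s',\varphi')$, be the billiard map in Birkhoff coordinates ($s$ is the arc-length parameter of the collision point, $\varphi$ the angle between the outgoing trajectory and the positive tangent; $f$ is the identity on $\{\varphi=0\}\cup\{\varphi=\pi\}$). Put $\mathbb T=\mathbb R/\mathbb Z$ and $\mathbb A_\varepsilon=\mathbb T\times(-\varepsilon,\varepsilon)$, and let $k\ge 1$ be an integer. A \emph{Lazutkin change of coordinates of order $k$} is a map $\Psi=(X,Y)$ of the form $$X(s,\varphi)=\sum_{j=0}^{k-1}X_j(s)\varphi^{2j},\qquad Y(s,\varphi)=\sum_{j=0}^{k}Y_j(s)\varphi^{2j+1},$$ with smooth $X_0:\mathbb T_\ell\to\mathbb T$ and smooth $X_j:\mathbb T_\ell\to\mathbb R$ ($1\le j\le k-1$),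 $Y_j:\mathbb T_\ell\to\mathbb R$ ($0\le j\le k$), which restricts to a diffeomorphism from an open neighbourhood $U$ of $\{\varphi=0\}$ in $\mathbb T_\ell\times[0,\pi]$ onto an open neighbourhood $V$ of $\mathbb T\times\{0\}$ in $\mathbb T\times[0,\varepsilon)$, for some $\varepsilon>0$, and conjugates $f$ to a map of the form $(x,y)\mapsto(x+y,y)+O(y^{2k+2})$ as $y\to0$, uniformly in $x$ (wherever $\Psi\circ f\circ\Psi^{-1}$ is defined). For points $z_-,z_0,z_+\in\partial\Omega$ with $z_\pm\neq z_0$, let $\varphi^+$ (resp. $\varphi^-$) be the angle between the vector $z_+-z_0$ (resp. $z_--z_0$) and the positively (resp. negatively) oriented tangent at $z_0$; the triple $(z_-,z_0,z_+)$ is a \emph{billiard $\varepsilon$-pseudocollision} if $|\varphi^+-\varphi^-|<\varepsilon$. An \emph{angular function of order $k$} on $\mathbb A_\varepsilon$ is a smooth map $Z:\mathbb A_\varepsilon\to\partial\Omega$ such that 1. $Z(\xi,-\eta)=Z(\xi,\eta)$ for all $(\xi,\eta)\in\mathbb A_\varepsilon$; 2. for every $\eta\in(-\varepsilon,\varepsilon)$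 the map $Z(\cdot,\eta):\mathbb T\to\partial\Omega$ is an orientation-preserving diffeomorphism, and $Z(0,\eta)=Z(0,0)$; 3. there are $C,\delta>0$ such that for all $\xi\in\mathbb T$ and all $\eta\in(-\varepsilon,\varepsilon)$ with $0<|\eta|<\delta$ the triple $(Z(\xi-\eta,\eta),Z(\xi,\eta),Z(\xi+\eta,\eta))$ is a billiard $C\eta^{2k+2}$-pseudocollision. Then the following are equivalent: (i) there exists a Lazutkin change of coordinates of order $k$; (ii) there exists an angular function of order $k$ on $\mathbb A_\varepsilon$ for some $\varepsilon>0$. -/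

import Mathlib

open Set
open scoped ContDiff

noncomputable section

/-- Derivative of a function on the circle `ℝ / aℤ` with respect to the coordinate of `ℝ`. -/
def circleDeriv {a : ℝ} (g : AddCircle a → ℂ) (p : AddCircle a) : ℂ :=
  deriv (fun t : ℝ => g (p + (t : AddCircle a))) 0

/-- A bounded open convex planar domain `Ω` (the plane being identified with `ℂ`) whose boundary
has length `ℓ`, is smooth and has strictly positive curvature. The boundary is described by its
positively oriented arc-length parametrization `γ`, defined on `ℝ / ℓℤ`. -/
structure BilliardTable where
  /-- the domain -/
  Ω : Set ℂ
  /-- the length of the boundary -/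
  ℓ : ℝ
  /-- the arc-length parametrization of the boundary -/
  γ : AddCircle ℓ → ℂ
  isOpen : IsOpen Ω
  isBounded : Bornology.IsBounded Ω
  convex : Convex ℝ Ω
  length_pos : 0 < ℓ
  smooth : ContDiff ℝ ∞ (fun t : ℝ => γ (t : AddCircle ℓ))
  injective : Function.Injective γ
  range_eq : range γ = frontier Ω
  unit_speed : ∀ s, ‖circleDeriv γ s‖ = 1
  /-- The signed curvature `Im (conj γ' * γ'')` is positive: the boundary turns left, so `γ` runs
  counterclockwise around `Ω`. -/
  curvature_pos : ∀ s,
    0 < ((starRingEnd ℂ) (circleDeriv γ s) * circleDeriv (circleDeriv γ) s).im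

/-- The covering `ℝ × ℝ → (ℝ / aℤ) × ℝ` of the cylinder. -/
def cylinderCover (a : ℝ) (q : ℝ × ℝ) : AddCircle a × ℝ := ((q.1 : AddCircle a), q.2)

/-- Smoothness of a circle-valued map on `S`, the circle being embedded in `ℂ` by
`x ↦ exp (2πix/b)`. -/
def SmoothToCircleOn {E : Type*} [NormedAddCommGroup E] [NormedSpace ℝ E] {b : ℝ}
    (F : E → AddCircle b) (S : Set E) : Prop :=
  ContDiffOn ℝ ∞ (fun x => (AddCircle.toCircle (F x) : ℂ)) S

/-- Smoothness of a map between cylinders on a set `U` (up to the boundary points of the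
cylinder that belong to `U`). -/
def SmoothOnCylinder {a b : ℝ} (F : AddCircle a × ℝ → AddCircle b × ℝ)
    (U : Set (AddCircle a × ℝ)) : Prop :=
  SmoothToCircleOn (fun q => (F (cylinderCover a q)).1) (cylinderCover a ⁻¹' U) ∧
  ContDiffOn ℝ ∞ (fun q => (F (cylinderCover a q)).2) (cylinderCover a ⁻¹' U)

/-- `F` restricts to a diffeomorphism of `U` onto `V`. -/
def IsCylinderDiffeo {a b : ℝ} (F : AddCircle a × ℝ → AddCircle b × ℝ)
    (U : Set (AddCircle a × ℝ)) (V : Set (AddCircle b × ℝ)) : Prop :=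
  BijOn F U V ∧ SmoothOnCylinder F U ∧
  ∃ G : AddCircle b × ℝ → AddCircle a × ℝ, InvOn G F U V ∧ SmoothOnCylinder G V

/-- `U` is an open neighbourhood of `(ℝ / aℤ) × {0}` in the cylinder `(ℝ / aℤ) × I`. -/
def IsBoundaryNhd {a : ℝ} (I : Set ℝ) (U : Set (AddCircle a × ℝ)) : Prop :=
  (∃ W : Set (AddCircle a × ℝ), IsOpen W ∧ U = W ∩ (univ ×ˢ I)) ∧
  ∀ s : AddCircle a, (s, (0 : ℝ)) ∈ U

namespace BilliardTable

variable (B : BilliardTable)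

/-- The positively oriented unit tangent vector of the boundary. -/
def tangent (s : AddCircle B.ℓ) : ℂ := circleDeriv B.γ s

/-- In Birkhoff coordinates (arc-length and angle with the positive tangent), the collision `q`
follows the collision `p`. For `0 < φ < π` the ray from `γ s` that makes the angle `φ` with the
tangent meets the boundary again at `γ s'`; the outgoing angle `φ'` there equals the angle
between the incoming direction and the tangent at `γ s'`. Collisions with `φ = 0` or `φ = π`
are fixed. -/
def IsNextCollision (p q : AddCircle B.ℓ × ℝ) : Prop :=
  ((p.2 = 0 ∨ p.2 = Real.pi) ∧ q = p) ∨
  (p.2 ∈ Ioo 0 Real.pi ∧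
    (∃ r : ℝ, 0 < r ∧
      B.γ q.1 = B.γ p.1 + (r : ℂ) * Complex.exp ((p.2 : ℂ) * Complex.I) * B.tangent p.1) ∧
    q.2 = InnerProductGeometry.angle (B.tangent q.1) (B.γ q.1 - B.γ p.1))

/-- The billiard map on the phase space `(ℝ / ℓℤ) × [0, π]` (its values elsewhere are
irrelevant). -/
def billiardMap (p : AddCircle B.ℓ × ℝ) : AddCircle B.ℓ × ℝ :=
  Classical.epsilon (B.IsNextCollision p)

/-- The map `(s, φ) ↦ (∑_{j<k} X_j(s) φ^{2j}, ∑_{j≤k} Y_j(s) φ^{2j+1})` for `k ≥ 1`. Its first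
component is circle-valued, as is `X₀`; the other coefficients are real-valued. -/
def lazutkinForm (k : ℕ) (X₀ : AddCircle B.ℓ → UnitAddCircle) (X Y : ℕ → AddCircle B.ℓ → ℝ)
    (p : AddCircle B.ℓ × ℝ) : UnitAddCircle × ℝ :=
  (X₀ p.1 + ((∑ j ∈ Finset.Ico 1 k, X j p.1 * p.2 ^ (2 * j) : ℝ) : UnitAddCircle),
    ∑ j ∈ Finset.range (k + 1), Y j p.1 * p.2 ^ (2 * j + 1))

/-- On `U`, the map `Ψ` conjugates the billiard map to `(x, y) ↦ (x + y, y) + O(y^{2k+2})`,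
where `O` is meant as `y → 0`, uniformly in `x`. -/
def ConjugatesToNormalForm (k : ℕ) (Ψ : AddCircle B.ℓ × ℝ → UnitAddCircle × ℝ)
    (U : Set (AddCircle B.ℓ × ℝ)) : Prop :=
  ∃ C > (0 : ℝ), ∃ δ > (0 : ℝ), ∀ p ∈ U, B.billiardMap p ∈ U → (Ψ p).2 < δ →
    ‖(Ψ (B.billiardMap p)).1 - ((Ψ p).1 + (((Ψ p).2 : ℝ) : UnitAddCircle))‖
        ≤ C * (Ψ p).2 ^ (2 * k + 2) ∧
    |(Ψ (B.billiardMap p)).2 - (Ψ p).2| ≤ C * (Ψ p).2 ^ (2 * k + 2)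

/-- `Ψ` is a Lazutkin change of coordinates of order `k ≥ 1`. -/
def IsLazutkinChange (k : ℕ) (Ψ : AddCircle B.ℓ × ℝ → UnitAddCircle × ℝ) : Prop :=
  (∃ (X₀ : AddCircle B.ℓ → UnitAddCircle) (X Y : ℕ → AddCircle B.ℓ → ℝ),
    SmoothToCircleOn (fun t : ℝ => X₀ (t : AddCircle B.ℓ)) univ ∧
    (∀ j, ContDiff ℝ ∞ (fun t : ℝ => X j (t : AddCircle B.ℓ))) ∧
    (∀ j, ContDiff ℝ ∞ (fun t : ℝ => Y j (t : AddCircle B.ℓ))) ∧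
    Ψ = B.lazutkinForm k X₀ X Y) ∧
  ∃ (U : Set (AddCircle B.ℓ × ℝ)) (ε : ℝ) (V : Set (UnitAddCircle × ℝ)),
    0 < ε ∧ IsBoundaryNhd (Icc 0 Real.pi) U ∧ IsBoundaryNhd (Ico 0 ε) V ∧
    IsCylinderDiffeo Ψ U V ∧ B.ConjugatesToNormalForm k Ψ U

/-- The triple `(z₋, z₀, z₊)` of boundary points is a billiard `ε`-pseudocollision: the angle
between `z₀z₊` and the positive tangent at `z₀` and the angle between `z₀z₋` and the negative
tangent differ by less than `ε`. -/
def IsPseudocollision (ε : ℝ) (zm z₀ zp : ℂ) : Prop :=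
  zm ∈ frontier B.Ω ∧ zp ∈ frontier B.Ω ∧ zm ≠ z₀ ∧ zp ≠ z₀ ∧
  ∃ s, B.γ s = z₀ ∧
    |InnerProductGeometry.angle (B.tangent s) (zp - z₀) -
      InnerProductGeometry.angle (-B.tangent s) (zm - z₀)| < ε

/-- `Z` is an angular function of order `k` on the annulus `(ℝ / ℤ) × (-ε, ε)`. -/
structure IsAngularFunction (k : ℕ) (ε : ℝ) (Z : UnitAddCircle → ℝ → ℂ) : Prop where
  smooth : ContDiffOn ℝ ∞ (fun q : ℝ × ℝ => Z (q.1 : UnitAddCircle) q.2) (univ ×ˢ Ioo (-ε) ε)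
  even : ∀ ξ, ∀ η ∈ Ioo (-ε) ε, Z ξ (-η) = Z ξ η
  bijOn : ∀ η ∈ Ioo (-ε) ε, BijOn (fun ξ => Z ξ η) univ (frontier B.Ω)
  /-- The derivative along the circle is a positive multiple of the positive tangent; together
  with `bijOn`, each `Z(·, η)` is an orientation-preserving diffeomorphism onto the boundary. -/
  orientation : ∀ η ∈ Ioo (-ε) ε, ∀ ξ s, B.γ s = Z ξ η →
    ∃ c : ℝ, 0 < c ∧ circleDeriv (fun ξ => Z ξ η) ξ = c * B.tangent s
  base_point : ∀ η ∈ Ioo (-ε) ε, Z 0 η = Z 0 0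
  pseudocollision : ∃ C > (0 : ℝ), ∃ δ > (0 : ℝ), ∀ ξ, ∀ η ∈ Ioo (-ε) ε, η ≠ 0 → |η| < δ →
    B.IsPseudocollision (C * η ^ (2 * k + 2))
      (Z (ξ - (η : UnitAddCircle)) η) (Z ξ η) (Z (ξ + (η : UnitAddCircle)) η)

end BilliardTable

end

/-!
Work on the universal cover of the cylinder. There the billiard map sends `(s, A (s, y))` to
`(s + y, …)`, where `A (s, y)` is the angle between the tangent at `γ s` and the chord from `γ s` to
`γ (s + y)`: by the positive curvature, `A` is smooth, vanishes at `y = 0` and has a positive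
`y`-derivative there.

The lift `S (ξ, η)` of an angular function is the position of the point with coordinates
`X = ξ`, `Y = η` for some coordinates `(X, Y)` in which the billiard map is the shear
`(x, y) ↦ (x + y, y)` up to `O(y ^ (2 * k + 2))`: the orbit of such a point is
`S (ξ, η), S (ξ + η, η), …`, and the law of reflection along it is the pseudocollision condition.
Reversing time turns `φ` into `-φ`, which makes `X` even and `Y` odd, and `S` even in `η`.

Given Lazutkin coordinates, `S` is therefore the position component of the inverse of `(X, Y)`.
Conversely, an angular function gives the shear coordinates as the inverse of
`(ξ, η) ↦ (S (ξ, η), forward angle from S (ξ, η) to S (ξ + η, η))`. The law of reflection makes the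
forward angle odd up to a small error, so Taylor expansion at `φ = 0` yields polynomials in `φ` of
the right parity. The even one may have the extra coefficient `X k`, which can be cancelled at the
expense of the top coefficient `Y k` of the odd one.
-/

noncomputable section

open Filter Topology Asymptotics MeasureTheory

section Calculus

variable {E : Type*} [NormedAddCommGroup E] [NormedSpace ℝ E]

theorem contDiff_setIntegral_of_isBounded {P T : Type*} [NormedAddCommGroup P] [NormedSpace ℝ P]
    [NormedAddCommGroup T] [NormedSpace ℝ T] [FiniteDimensional ℝ T] [MeasurableSpace T]
    [BorelSpace T] {μ : Measure T} [IsLocallyFiniteMeasure μ] {s : Set T} (hs : MeasurableSet s)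
    (hsb : Bornology.IsBounded s) {F : P × T → E} (hF : ContDiff ℝ ∞ F) :
    ContDiff ℝ ∞ (fun x => ∫ t in s, F (x, t) ∂μ) := by
  -- A cutoff makes the integrand compactly supported in `t`: the integral is then a convolution
  -- with the indicator of `s`, evaluated at `0`.
  obtain ⟨R, hR, hsR⟩ := hsb.subset_closedBall_lt 0 (0 : T)
  let χ : ContDiffBump (0 : T) := ⟨R, R + 1, hR, lt_add_one R⟩
  have hconv := contDiffOn_convolution_right_with_param_comp (𝕜 := ℝ) (μ := μ) (n := ⊤)
    (ContinuousLinearMap.lsmul ℝ ℝ : ℝ →L[ℝ] E →L[ℝ] E) (s := (univ : Set P))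
    (v := fun _ => (0 : T)) contDiffOn_const (f := s.indicator fun _ => (1 : ℝ))
    (g := fun x t => χ t • F (x, -t)) (k := Metric.closedBall 0 (R + 1)) isOpen_univ
    (isCompact_closedBall _ _) ?_ ?_ ?_
  · rw [contDiffOn_univ] at hconv
    convert hconv using 1
    funext x
    rw [convolution_def, ← integral_indicator hs]
    refine integral_congr_ae (Eventually.of_forall fun t => ?_)
    by_cases ht : t ∈ s
    · have hχ : χ (-t) = 1 := χ.one_of_mem_closedBall (by simpa using hsR ht)
      simp [ht, hχ]
    · simp [ht]
  · intro p x _ hx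
    have hχ : χ x = 0 := χ.zero_of_le_dist (not_le.1 hx).le
    simp [hχ]
  · exact (locallyIntegrable_const 1).indicator hs
  · have hχ : ContDiff ℝ ∞ (fun q : P × T => χ q.2) := χ.contDiff.comp contDiff_snd
    have hF' : ContDiff ℝ ∞ (fun q : P × T => F (q.1, -q.2)) := by fun_prop
    exact (hχ.smul hF').contDiffOn

/-- The partial derivative with respect to the first variable of a function of two real
variables. -/
def derivFst (f : ℝ × ℝ → E) (p : ℝ × ℝ) : E := fderiv ℝ f p (1, 0)

/-- The partial derivative with respect to the second variable of a function of two real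
variables. -/
def derivSnd (f : ℝ × ℝ → E) (p : ℝ × ℝ) : E := fderiv ℝ f p (0, 1)

/-- The Hadamard quotient `(f(s, y) - f(s, 0)) / y`, written as an integral so that it is smooth
up to `y = 0`. -/
def hadamardQuotient (f : ℝ × ℝ → E) (p : ℝ × ℝ) : E :=
  ∫ t in (0 : ℝ)..1, derivSnd f (p.1, t * p.2)

variable {f : ℝ × ℝ → E}

theorem contDiff_derivFst (hf : ContDiff ℝ ∞ f) : ContDiff ℝ ∞ (derivFst f) :=
  (hf.fderiv_right (m := ∞) (by simp)).clm_apply contDiff_const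

theorem contDiff_derivSnd (hf : ContDiff ℝ ∞ f) : ContDiff ℝ ∞ (derivSnd f) :=
  (hf.fderiv_right (m := ∞) (by simp)).clm_apply contDiff_const

theorem contDiff_hadamardQuotient (hf : ContDiff ℝ ∞ f) : ContDiff ℝ ∞ (hadamardQuotient f) := by
  have h : ContDiff ℝ ∞ (fun q : (ℝ × ℝ) × ℝ => derivSnd f (q.1.1, q.2 * q.1.2)) := by
    have := contDiff_derivSnd hf
    fun_prop
  unfold hadamardQuotient
  simp only [intervalIntegral.integral_of_le zero_le_one]
  exact contDiff_setIntegral_of_isBounded measurableSet_Ioc (Metric.isBounded_Ioc 0 1) h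

theorem fderiv_apply_eq_smul_derivFst_add_smul_derivSnd (f : ℝ × ℝ → E) (p v : ℝ × ℝ) :
    fderiv ℝ f p v = v.1 • derivFst f p + v.2 • derivSnd f p := by
  have hv : v = v.1 • ((1 : ℝ), (0 : ℝ)) + v.2 • ((0 : ℝ), (1 : ℝ)) := by ext <;> simp
  conv_lhs => rw [hv, map_add, map_smul, map_smul]
  rfl

theorem hasDerivAt_comp_prodMk {u v : ℝ → ℝ} {u' v' t : ℝ}
    (hf : DifferentiableAt ℝ f (u t, v t)) (hu : HasDerivAt u u' t) (hv : HasDerivAt v v' t) :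
    HasDerivAt (fun t => f (u t, v t))
      (u' • derivFst f (u t, v t) + v' • derivSnd f (u t, v t)) t := by
  rw [← fderiv_apply_eq_smul_derivFst_add_smul_derivSnd f _ (u', v')]
  exact hf.hasFDerivAt.comp_hasDerivAt t (hu.prodMk hv)

theorem hasDerivAt_derivFst {s y : ℝ} (hf : DifferentiableAt ℝ f (s, y)) :
    HasDerivAt (fun t => f (t, y)) (derivFst f (s, y)) s := by
  simpa using hasDerivAt_comp_prodMk hf (hasDerivAt_id s) (hasDerivAt_const s y)

theorem hasDerivAt_derivSnd {s y : ℝ} (hf : DifferentiableAt ℝ f (s, y)) :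
    HasDerivAt (fun t => f (s, t)) (derivSnd f (s, y)) y := by
  simpa using hasDerivAt_comp_prodMk hf (hasDerivAt_const y s) (hasDerivAt_id y)

theorem derivFst_eq_zero_of_map_zero (hf : Differentiable ℝ f) (h : ∀ s, f (s, 0) = 0) (s : ℝ) :
    derivFst f (s, 0) = 0 := by
  have hd := hasDerivAt_derivFst (hf (s, 0))
  simp only [h] at hd
  exact hd.unique (hasDerivAt_const s 0)

theorem derivFst_fst (p : ℝ × ℝ) : derivFst (Prod.fst : ℝ × ℝ → ℝ) p = 1 := by
  simp [derivFst, fderiv_fst]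

theorem derivSnd_snd (p : ℝ × ℝ) : derivSnd (Prod.snd : ℝ × ℝ → ℝ) p = 1 := by
  simp [derivSnd, fderiv_snd]

variable [CompleteSpace E]

theorem eq_add_smul_hadamardQuotient (hf : ContDiff ℝ 1 f) (p : ℝ × ℝ) :
    f p = f (p.1, 0) + p.2 • hadamardQuotient f p := by
  have hderiv : ∀ t ∈ uIcc (0 : ℝ) 1,
      HasDerivAt (fun t => f (p.1, t * p.2)) (p.2 • derivSnd f (p.1, t * p.2)) t := fun t _ => by
    simpa using hasDerivAt_comp_prodMk (hf.differentiable one_ne_zero _) (hasDerivAt_const t p.1)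
      ((hasDerivAt_id t).mul_const p.2)
  have hcont : Continuous (derivSnd f) :=
    (hf.continuous_fderiv one_ne_zero).clm_apply continuous_const
  have hint := intervalIntegral.integral_eq_sub_of_hasDerivAt hderiv
    (Continuous.intervalIntegrable (by fun_prop) _ _)
  rw [intervalIntegral.integral_smul] at hint
  simp only [one_mul, zero_mul] at hint
  rw [hadamardQuotient, hint, add_sub_cancel]

theorem hadamardQuotient_zero (f : ℝ × ℝ → E) (s : ℝ) :
    hadamardQuotient f (s, 0) = derivSnd f (s, 0) := by
  simp [hadamardQuotient]

theorem derivSnd_eq_hadamardQuotient_add (hf : ContDiff ℝ ∞ f) (p : ℝ × ℝ) :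
    derivSnd f p = hadamardQuotient f p + p.2 • derivSnd (hadamardQuotient f) p := by
  have hquot := (contDiff_hadamardQuotient hf).differentiable (by simp) p
  have hprod : HasDerivAt (fun t => f (p.1, 0) + t • hadamardQuotient f (p.1, t))
      (p.2 • derivSnd (hadamardQuotient f) p + (1 : ℝ) • hadamardQuotient f p) p.2 :=
    ((hasDerivAt_id p.2).smul (hasDerivAt_derivSnd hquot)).const_add _
  have hfactor : (fun t => f (p.1, t)) = fun t => f (p.1, 0) + t • hadamardQuotient f (p.1, t) :=
    funext fun t => eq_add_smul_hadamardQuotient (hf.of_le (by simp)) (p.1, t)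
  rw [← hfactor] at hprod
  rw [(hasDerivAt_derivSnd (hf.differentiable (by simp) p)).unique hprod, one_smul, add_comm]

theorem derivSnd_derivSnd_zero (hf : ContDiff ℝ ∞ f) (s : ℝ) :
    derivSnd (derivSnd f) (s, 0) = (2 : ℝ) • derivSnd (hadamardQuotient f) (s, 0) := by
  have hquot := contDiff_hadamardQuotient hf
  have hprod := (hasDerivAt_derivSnd (hquot.differentiable (by simp) (s, 0))).add
    ((hasDerivAt_id (0 : ℝ)).smul
      (hasDerivAt_derivSnd ((contDiff_derivSnd hquot).differentiable (by simp) (s, 0))))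
  have hderiv := hasDerivAt_derivSnd ((contDiff_derivSnd hf).differentiable (by simp) (s, 0))
  rw [funext fun t => derivSnd_eq_hadamardQuotient_add hf (s, t)] at hderiv
  rw [hderiv.unique hprod]
  simp [two_smul]

end Calculus

section Planar

variable {F G : ℝ × ℝ → ℝ}

theorem eq_zero_of_det_ne_zero {α β γ δ u v : ℝ} (hdet : α * δ - β * γ ≠ 0)
    (h₁ : u * α + v * β = 0) (h₂ : u * γ + v * δ = 0) : u = 0 ∧ v = 0 := by
  have hu : u * (α * δ - β * γ) = 0 := by linear_combination δ * h₁ - β * h₂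
  have hv : v * (α * δ - β * γ) = 0 := by linear_combination α * h₂ - γ * h₁
  exact ⟨(mul_eq_zero.1 hu).resolve_right hdet, (mul_eq_zero.1 hv).resolve_right hdet⟩

/-- The Jacobian determinant of `(F, G)` with its two rows taken at different points, as they
appear when the mean value theorem is applied to each component. -/
def mixedJacobian (F G : ℝ × ℝ → ℝ) (p q : ℝ × ℝ) : ℝ :=
  derivFst F p * derivSnd G q - derivSnd F p * derivFst G q

theorem injOn_of_mixedJacobian_ne_zero {C : Set (ℝ × ℝ)} (hC : Convex ℝ C)
    (hF : Differentiable ℝ F) (hG : Differentiable ℝ G)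
    (hJ : ∀ p ∈ C, ∀ q ∈ C, mixedJacobian F G p q ≠ 0) : InjOn (fun p => (F p, G p)) C := by
  intro p hp q hq hpq
  obtain ⟨hFpq, hGpq⟩ := Prod.mk.inj hpq
  obtain ⟨z, hz, hFz⟩ := domain_mvt (fun x _ => (hF x).hasFDerivAt.hasFDerivWithinAt) hC hp hq
  obtain ⟨w, hw, hGw⟩ := domain_mvt (fun x _ => (hG x).hasFDerivAt.hasFDerivWithinAt) hC hp hq
  rw [hFpq, sub_self, fderiv_apply_eq_smul_derivFst_add_smul_derivSnd] at hFz
  rw [hGpq, sub_self, fderiv_apply_eq_smul_derivFst_add_smul_derivSnd] at hGw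
  obtain ⟨h₁, h₂⟩ := eq_zero_of_det_ne_zero
    (hJ z (hC.segment_subset hp hq hz) w (hC.segment_subset hp hq hw)) hFz.symm hGw.symm
  exact (sub_eq_zero.1 (Prod.ext h₁ h₂)).symm

theorem exists_equiv_hasFDerivAt_of_mixedJacobian_ne_zero {p : ℝ × ℝ}
    (hF : DifferentiableAt ℝ F p) (hG : DifferentiableAt ℝ G p) (hJ : mixedJacobian F G p p ≠ 0) :
    ∃ e : (ℝ × ℝ) ≃L[ℝ] ℝ × ℝ,
      HasFDerivAt (fun p => (F p, G p)) (e : (ℝ × ℝ) →L[ℝ] ℝ × ℝ) p := by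
  let D : (ℝ × ℝ) →L[ℝ] ℝ × ℝ := (fderiv ℝ F p).prod (fderiv ℝ G p)
  have hD : Function.Injective D := by
    refine (injective_iff_map_eq_zero D).2 fun v hv => ?_
    have hFv : fderiv ℝ F p v = 0 := congrArg Prod.fst hv
    have hGv : fderiv ℝ G p v = 0 := congrArg Prod.snd hv
    rw [fderiv_apply_eq_smul_derivFst_add_smul_derivSnd] at hFv hGv
    exact Prod.ext_iff.2 (eq_zero_of_det_ne_zero hJ hFv hGv)
  refine ⟨(LinearEquiv.ofInjectiveEndo D.toLinearMap hD).toContinuousLinearEquiv, ?_⟩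
  exact hF.hasFDerivAt.prodMk hG.hasFDerivAt

end Planar

section InverseFunction

variable {E : Type*} [NormedAddCommGroup E] [NormedSpace ℝ E] [CompleteSpace E]

theorem exists_openPartialHomeomorph_of_injOn {H : E → E} {s : Set E} (hs : IsOpen s)
    (hH : ContDiff ℝ ∞ H) (hinj : InjOn H s)
    (hderiv : ∀ p ∈ s, ∃ e : E ≃L[ℝ] E, HasFDerivAt H (e : E →L[ℝ] E) p) :
    ∃ Φ : OpenPartialHomeomorph E E, Φ.source = s ∧ ⇑Φ = H ∧ ∀ q ∈ Φ.target,
      ContDiffAt ℝ ∞ Φ.symm q := by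
  have hopen : IsOpenMap (s.domRestrict H) := by
    refine IsOpenMap.of_nhds_le fun p => ?_
    obtain ⟨e, he⟩ := hderiv p p.2
    rw [domRestrict_eq, ← Filter.map_map, map_nhds_subtype_coe_eq_nhds p.2 (hs.mem_nhds p.2),
      (hH.contDiffAt.hasStrictFDerivAt' he (by simp)).map_nhds_eq_of_equiv]
    rfl
  let Φ := OpenPartialHomeomorph.ofContinuousOpenRestrict (hinj.toPartialEquiv H s)
    hH.continuous.continuousOn hopen hs
  refine ⟨Φ, rfl, rfl, fun q hq => ?_⟩
  obtain ⟨e, he⟩ := hderiv (Φ.symm q) (Φ.map_target hq)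
  exact Φ.contDiffAt_symm hq he hH.contDiffAt

end InverseFunction

/-- The filter of uniform neighbourhoods of the line `ℝ × {0}` in the plane. -/
def stripNhds : Filter (ℝ × ℝ) := comap Prod.snd (𝓝 0)

/-- The filter of uniform one-sided neighbourhoods of the line `ℝ × {0}` in the plane. -/
def stripNhdsPos : Filter (ℝ × ℝ) := comap Prod.snd (𝓝[>] 0)

section StripNhds

theorem stripNhdsPos_le : stripNhdsPos ≤ stripNhds := comap_mono nhdsWithin_le_nhds

theorem hasBasis_stripNhds : stripNhds.HasBasis (0 < ·) fun r => {p | |p.2| < r} := by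
  simpa [stripNhds, Metric.ball, preimage] using
    (Metric.nhds_basis_ball (x := (0 : ℝ))).comap (Prod.snd : ℝ × ℝ → ℝ)

theorem eventually_stripNhds_iff {P : ℝ × ℝ → Prop} :
    (∀ᶠ p in stripNhds, P p) ↔ ∃ r > 0, ∀ s y, |y| < r → P (s, y) := by
  simp only [hasBasis_stripNhds.eventually_iff, mem_ofPred_eq, Prod.forall]

theorem eventually_stripNhdsPos_iff {P : ℝ × ℝ → Prop} :
    (∀ᶠ p in stripNhdsPos, P p) ↔ ∃ r > 0, ∀ s y, 0 < y → y < r → P (s, y) := by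
  rw [stripNhdsPos, ((nhdsGT_basis (0 : ℝ)).comap Prod.snd).eventually_iff]
  simp only [mem_preimage, mem_Ioo, Prod.forall, and_imp]

theorem tendsto_snd_stripNhds : Tendsto Prod.snd stripNhds (𝓝 (0 : ℝ)) := tendsto_comap

theorem tendsto_stripNhds_iff {α : Type*} {l : Filter α} {u : α → ℝ × ℝ} :
    Tendsto u l stripNhds ↔ Tendsto (fun x => (u x).2) l (𝓝 0) := tendsto_comap_iff

theorem tendsto_stripNhdsPos_iff {α : Type*} {l : Filter α} {u : α → ℝ × ℝ} :
    Tendsto u l stripNhdsPos ↔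
      Tendsto (fun x => (u x).2) l (𝓝 0) ∧ ∀ᶠ x in l, 0 < (u x).2 := by
  rw [stripNhdsPos, tendsto_comap_iff, tendsto_nhdsWithin_iff]
  rfl

theorem eventually_stripNhdsPos_pos : ∀ᶠ p in stripNhdsPos, 0 < p.2 :=
  (tendsto_stripNhdsPos_iff.1 tendsto_id).2

theorem nhds_le_stripNhds (s : ℝ) : 𝓝 (s, 0) ≤ stripNhds :=
  (continuous_snd.tendsto (s, (0 : ℝ))).le_comap

theorem tendsto_prodMk_nhds_zero_stripNhds (s : ℝ) :
    Tendsto (fun t : ℝ => (s, t)) (𝓝 0) stripNhds :=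
  tendsto_stripNhds_iff.2 tendsto_id

theorem tendsto_prodMk_snd_stripNhds (f : ℝ × ℝ → ℝ) :
    Tendsto (fun p => (f p, p.2)) stripNhds stripNhds :=
  tendsto_stripNhds_iff.2 tendsto_snd_stripNhds

theorem tendsto_prodMk_snd_stripNhdsPos (f : ℝ × ℝ → ℝ) :
    Tendsto (fun p => (f p, p.2)) stripNhdsPos stripNhdsPos :=
  tendsto_stripNhdsPos_iff.2
    ⟨tendsto_snd_stripNhds.mono_left stripNhdsPos_le, eventually_stripNhdsPos_pos⟩

theorem tendsto_prodMk_neg_stripNhds (f : ℝ × ℝ → ℝ) :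
    Tendsto (fun p => (f p, -p.2)) stripNhds stripNhds :=
  tendsto_stripNhds_iff.2 (by simpa using tendsto_snd_stripNhds.neg)

theorem eventually_stripNhds_of_periodic {a : ℝ} (ha : 0 < a) {P : ℝ × ℝ → Prop}
    (hP : ∀ s y, P (s + a, y) ↔ P (s, y)) (h : ∀ s, ∀ᶠ p in 𝓝 (s, (0 : ℝ)), P p) :
    ∀ᶠ p in stripNhds, P p := by
  have hseg : ∀ᶠ p in 𝓝ˢ (Icc 0 a ×ˢ {(0 : ℝ)}), P p := by
    rw [eventually_nhdsSet_iff_forall]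
    rintro ⟨s, y⟩ ⟨_, rfl⟩
    exact h s
  rw [isCompact_Icc.nhdsSet_prod_eq isCompact_singleton, nhdsSet_singleton] at hseg
  obtain ⟨p₁, hp₁, p₂, hp₂, hp⟩ := eventually_prod_iff.1 hseg
  filter_upwards [tendsto_snd_stripNhds.eventually hp₂] with ⟨s, y⟩ hy
  have hper : Function.Periodic (fun s => P (s, y)) a := fun s => propext (hP s y)
  obtain ⟨t, ht, hst⟩ := hper.exists_mem_Ico₀ ha s
  exact hst.mpr (hp (hp₁.self_of_nhdsSet t (Ico_subset_Icc_self ht)) hy)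

section Periodic

variable {a : ℝ} (ha : 0 < a)
include ha

theorem isBigO_one_of_periodic {E : Type*} [NormedAddCommGroup E] {g : ℝ × ℝ → E}
    (hg : Continuous g) (hper : ∀ s y, g (s + a, y) = g (s, y)) :
    g =O[stripNhds] (fun _ => (1 : ℝ)) := by
  obtain ⟨M, hM⟩ := (isCompact_Icc (a := (0 : ℝ)) (b := a)).exists_bound_of_continuousOn
    (f := fun s => g (s, 0)) (by fun_prop)
  refine IsBigO.of_bound (M + 1) (eventually_stripNhds_of_periodic ha (by simp [hper]) fun s => ?_)
  obtain ⟨t, ht, hst⟩ := Function.Periodic.exists_mem_Ico₀ (f := fun s => g (s, 0))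
    (hper · 0) ha s
  have hlt : ‖g (s, 0)‖ < M + 1 :=
    calc ‖g (s, 0)‖ = ‖g (t, 0)‖ := congrArg _ hst
      _ ≤ M := hM t (Ico_subset_Icc_self ht)
      _ < M + 1 := lt_add_one M
  filter_upwards [(hg.norm.tendsto (s, 0)).eventually_lt_const hlt] with p hp
  simpa using hp.le

theorem exists_pos_le_of_periodic {g : ℝ × ℝ → ℝ} (hg : Continuous g)
    (hper : ∀ s y, g (s + a, y) = g (s, y)) (hpos : ∀ s, 0 < g (s, 0)) :
    ∃ m > 0, ∀ᶠ p in stripNhds, m ≤ g p := by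
  obtain ⟨t, -, hmin⟩ := (isCompact_Icc (a := (0 : ℝ)) (b := a)).exists_isMinOn
    (f := fun s => g (s, 0)) (nonempty_Icc.2 ha.le) (by fun_prop)
  refine ⟨g (t, 0) / 2, half_pos (hpos t),
    eventually_stripNhds_of_periodic ha (by simp [hper]) fun s => ?_⟩
  obtain ⟨t', ht', hst⟩ := Function.Periodic.exists_mem_Ico₀ (f := fun s => g (s, 0))
    (hper · 0) ha s
  have hlt : g (t, 0) / 2 < g (s, 0) :=
    calc g (t, 0) / 2 < g (t, 0) := half_lt_self (hpos t)
      _ ≤ g (t', 0) := hmin (Ico_subset_Icc_self ht')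
      _ = g (s, 0) := hst.symm
  filter_upwards [(hg.tendsto (s, 0)).eventually_const_lt hlt] with p hp
  exact hp.le

end Periodic

end StripNhds

/-- `f` is smooth on the plane and is the lift of a map defined on a cylinder: it gains `b` whenever
the first variable is translated by `a`. For `b = 0` this says that `f` itself descends to the
cylinder. -/
structure IsLift {E : Type*} [NormedAddCommGroup E] [NormedSpace ℝ E] (a : ℝ) (b : E)
    (f : ℝ × ℝ → E) : Prop where
  smooth : ContDiff ℝ ∞ f
  map_add : ∀ s y, f (s + a, y) = f (s, y) + b

theorem isLift_fst (a : ℝ) : IsLift a a Prod.fst := ⟨contDiff_fst, fun _ _ => rfl⟩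

theorem convex_strip (r : ℝ) : Convex ℝ {p : ℝ × ℝ | |p.2| < r} := by
  simpa [Metric.ball, preimage] using
    (convex_ball (0 : ℝ) r).linear_preimage (LinearMap.snd ℝ ℝ ℝ)

theorem isOpen_strip (r : ℝ) : IsOpen {p : ℝ × ℝ | |p.2| < r} :=
  isOpen_lt (by fun_prop) continuous_const

namespace IsLift

section Vector

variable {E : Type*} [NormedAddCommGroup E] [NormedSpace ℝ E] {a : ℝ} {b : E} {f : ℝ × ℝ → E}

theorem differentiable (hf : IsLift a b f) : Differentiable ℝ f :=
  hf.smooth.differentiable (by simp)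

theorem map_add_zsmul (hf : IsLift a b f) (n : ℤ) (s y : ℝ) :
    f (s + n • a, y) = f (s, y) + n • b :=
  AddConstMapClass.map_add_zsmul (⟨(f ⟨·, y⟩), (hf.map_add · y)⟩ : AddConstMap ℝ E a b) s n

theorem periodic (hf : IsLift a (0 : E) f) (s y : ℝ) : f (s + a, y) = f (s, y) := by
  rw [hf.map_add, add_zero]

theorem isLift_fderiv (hf : IsLift a b f) : IsLift a 0 (fderiv ℝ f) := by
  refine ⟨hf.smooth.fderiv_right (by simp), fun s y => ?_⟩
  have hshift : (fun p : ℝ × ℝ => f (p + (a, 0))) = fun p => f p + b := by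
    funext p
    rw [← hf.map_add]
    congr 1
    ext <;> simp
  have hfderiv := fderiv_comp_add_right (𝕜 := ℝ) (f := f) (x := (s, y)) ((a, 0) : ℝ × ℝ)
  rw [hshift, fderiv_add_const] at hfderiv
  simpa using hfderiv.symm

theorem isLift_derivFst (hf : IsLift a b f) : IsLift a 0 (derivFst f) :=
  ⟨contDiff_derivFst hf.smooth, fun s y => by simp [derivFst, hf.isLift_fderiv.map_add]⟩

theorem isLift_derivSnd (hf : IsLift a b f) : IsLift a 0 (derivSnd f) :=
  ⟨contDiff_derivSnd hf.smooth, fun s y => by simp [derivSnd, hf.isLift_fderiv.map_add]⟩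

theorem isLift_hadamardQuotient (hf : IsLift a b f) : IsLift a 0 (hadamardQuotient f) :=
  ⟨contDiff_hadamardQuotient hf.smooth, fun s y => by
    simp [hadamardQuotient, hf.isLift_derivSnd.map_add]⟩

theorem isLift_shift_sub (hf : IsLift a b f) :
    IsLift a 0 (fun q => f (q.1 + q.2, q.2) - f q) := by
  refine ⟨?_, fun s y => ?_⟩
  · have := hf.smooth
    fun_prop
  · simp only [add_right_comm s a y, hf.map_add]
    abel

theorem eq_smul_hadamardQuotient [CompleteSpace E] (hf : IsLift a b f)
    (hzero : ∀ s, f (s, 0) = 0) (p : ℝ × ℝ) : f p = p.2 • hadamardQuotient f p := by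
  rw [eq_add_smul_hadamardQuotient (hf.smooth.of_le (by simp)) p, hzero, zero_add]

variable (ha : 0 < a)
include ha

theorem isBigO_one (hf : IsLift a (0 : E) f) : f =O[stripNhds] (fun _ => (1 : ℝ)) :=
  isBigO_one_of_periodic ha hf.smooth.continuous hf.periodic

theorem isBigO_snd [CompleteSpace E] (hf : IsLift a b f) (hzero : ∀ s, f (s, 0) = 0) :
    f =O[stripNhds] (Prod.snd : ℝ × ℝ → ℝ) := by
  have h := (isBigO_refl (Prod.snd : ℝ × ℝ → ℝ) stripNhds).smul
    (hf.isLift_hadamardQuotient.isBigO_one ha)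
  simpa only [← hf.eq_smul_hadamardQuotient hzero, smul_eq_mul, mul_one] using h

theorem tendsto_zero [CompleteSpace E] (hf : IsLift a b f) (hzero : ∀ s, f (s, 0) = 0) :
    Tendsto f stripNhds (𝓝 0) :=
  (hf.isBigO_snd ha hzero).trans_tendsto tendsto_snd_stripNhds

theorem exists_lipschitz (hf : IsLift a b f) :
    ∃ K, ∃ r > 0, ∀ p q : ℝ × ℝ, |p.2| < r → |q.2| < r → ‖f p - f q‖ ≤ K * ‖p - q‖ := by
  obtain ⟨K, hK⟩ := (hf.isLift_fderiv.isBigO_one ha).bound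
  obtain ⟨r, hr, h⟩ := eventually_stripNhds_iff.1 hK
  exact ⟨K, r, hr, fun p q hp hq => (convex_strip r).norm_image_sub_le_of_norm_fderiv_le (𝕜 := ℝ)
    (fun x _ => hf.differentiable x) (fun x hx => by simpa using h x.1 x.2 hx) hq hp⟩

theorem sub_isBigO (hf : IsLift a b f) {α : Type*} {l : Filter α} {u v : α → ℝ × ℝ} {e : α → ℝ}
    (hu : Tendsto u l stripNhds) (hv : Tendsto v l stripNhds)
    (hfst : (fun x => (u x).1 - (v x).1) =O[l] e) (hsnd : (fun x => (u x).2 - (v x).2) =O[l] e) :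
    (fun x => f (u x) - f (v x)) =O[l] e := by
  obtain ⟨K, r, hr, h⟩ := hf.exists_lipschitz ha
  refine IsBigO.trans (g := fun x => u x - v x) (IsBigO.of_bound K ?_) (hfst.prod_left hsnd)
  have hstrip := hasBasis_stripNhds.mem_of_mem hr
  filter_upwards [hu hstrip, hv hstrip] with x hux hvx
  exact h _ _ hux hvx

end Vector

theorem surjective {a b : ℝ} {f : ℝ × ℝ → ℝ} (hf : IsLift a b f) (hb : 0 < b) (y : ℝ) :
    Function.Surjective fun s => f (s, y) := by
  intro x
  have hcont : Continuous fun s => f (s, y) := by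
    have := hf.smooth.continuous
    fun_prop
  obtain ⟨m, hm⟩ := exists_int_lt ((x - f (0, y)) / b)
  obtain ⟨n, hn⟩ := exists_int_gt ((x - f (0, y)) / b)
  rw [lt_div_iff₀ hb] at hm
  rw [div_lt_iff₀ hb] at hn
  refine mem_range_of_exists_le_of_exists_ge hcont ⟨0 + m • a, ?_⟩ ⟨0 + n • a, ?_⟩ <;>
  · rw [hf.map_add_zsmul, zsmul_eq_mul]
    linarith

end IsLift

theorem exists_isLift_eventuallyEq {E : Type*} [NormedAddCommGroup E] [NormedSpace ℝ E] {a : ℝ}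
    (ha : 0 < a) {b : E} {f : ℝ × ℝ → E} (hf : ∀ᶠ p in stripNhds, ContDiffAt ℝ ∞ f p)
    (hper : ∀ᶠ p in stripNhds, f (p.1 + a, p.2) = f p + b) :
    ∃ g, IsLift a b g ∧ g =ᶠ[stripNhds] f := by
  obtain ⟨r, hr, h⟩ := eventually_stripNhds_iff.1 (hf.and hper)
  let χ : ContDiffBump (0 : ℝ) := ⟨r / 3, r / 2, by linarith, by linarith⟩
  have hχ : ContDiff ℝ ∞ (fun q : ℝ × ℝ => χ q.2) := χ.contDiff.comp contDiff_snd
  have hχ_zero : ∀ {y}, r / 2 ≤ |y| → χ y = 0 := fun hy => χ.zero_of_le_dist (by simpa using hy)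
  let L : ℝ × ℝ → E := fun p => (p.1 / a) • b
  have hL : ContDiff ℝ ∞ L := by fun_prop
  have hL_add : ∀ s y, L (s + a, y) = L (s, y) + b := fun s y => by
    simp only [L, add_div, div_self ha.ne', add_smul, one_smul]
  refine ⟨fun p => χ p.2 • (f p - L p) + L p, ⟨?_, fun s y => ?_⟩, ?_⟩
  · refine contDiff_iff_contDiffAt.2 fun p => ContDiffAt.add ?_ hL.contDiffAt
    by_cases hpr : |p.2| < r
    · exact hχ.contDiffAt.smul ((h p.1 p.2 hpr).1.sub hL.contDiffAt)
    · have hfar : ∀ᶠ q : ℝ × ℝ in 𝓝 p, r / 2 < |q.2| :=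
        (continuous_abs.comp continuous_snd).tendsto p |>.eventually_const_lt
          (show r / 2 < |p.2| by linarith)
      refine contDiffAt_const (c := 0) |>.congr_of_eventuallyEq ?_
      filter_upwards [hfar] with q hq
      rw [hχ_zero hq.le, zero_smul]
  · by_cases hy : |y| < r
    · simp only [(h s y hy).2, hL_add]
      module
    · simp only [hχ_zero (show r / 2 ≤ |y| by linarith), zero_smul, zero_add, hL_add]
  · refine eventually_stripNhds_iff.2 ⟨r / 3, by linarith, fun s y hy => ?_⟩
    simp only [χ.one_of_mem_closedBall (show y ∈ Metric.closedBall 0 (r / 3) by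
      simpa using hy.le), one_smul, sub_add_cancel]

/-- `G` is smooth, descends to the cylinder `(ℝ / aℤ) × ℝ`, vanishes on the boundary circle
`y = 0` and has positive normal derivative there. -/
structure IsBoundaryDefining (a : ℝ) (G : ℝ × ℝ → ℝ) : Prop where
  isLift : IsLift a 0 G
  map_zero : ∀ s, G (s, 0) = 0
  derivSnd_pos : ∀ s, 0 < derivSnd G (s, 0)

/-- Near the boundary circle `y = 0`, the pair `(F, G)` lifts an orientation-preserving change of
coordinates from the cylinder `(ℝ / aℤ) × ℝ` to the cylinder `(ℝ / bℤ) × ℝ` that preserves the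
boundary circle and its sides. -/
structure IsStripCoord (a b : ℝ) (F G : ℝ × ℝ → ℝ) : Prop where
  fst : IsLift a b F
  snd : IsBoundaryDefining a G
  derivFst_pos : ∀ s, 0 < derivFst F (s, 0)

namespace IsBoundaryDefining

variable {a : ℝ} {G : ℝ × ℝ → ℝ}

theorem derivFst_eq_zero (h : IsBoundaryDefining a G) (s : ℝ) : derivFst G (s, 0) = 0 :=
  derivFst_eq_zero_of_map_zero h.isLift.differentiable h.map_zero s

theorem isStripCoord_fst (h : IsBoundaryDefining a G) : IsStripCoord a a Prod.fst G :=
  ⟨isLift_fst a, h, fun s => by simp [derivFst_fst]⟩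

section

variable (ha : 0 < a)
include ha

theorem tendsto_zero (h : IsBoundaryDefining a G) : Tendsto G stripNhds (𝓝 0) :=
  h.isLift.tendsto_zero ha h.map_zero

theorem isBigO_snd (h : IsBoundaryDefining a G) : G =O[stripNhds] (Prod.snd : ℝ × ℝ → ℝ) :=
  h.isLift.isBigO_snd ha h.map_zero

theorem exists_mul_le (h : IsBoundaryDefining a G) :
    ∃ m > 0, ∀ᶠ p in stripNhdsPos, m * p.2 ≤ G p := by
  obtain ⟨m, hm, hle⟩ := exists_pos_le_of_periodic ha
    h.isLift.isLift_hadamardQuotient.smooth.continuous h.isLift.isLift_hadamardQuotient.periodic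
    fun s => by simpa [hadamardQuotient_zero] using h.derivSnd_pos s
  refine ⟨m, hm, ?_⟩
  filter_upwards [stripNhdsPos_le hle, eventually_stripNhdsPos_pos] with p hp hpos
  rw [h.isLift.eq_smul_hadamardQuotient h.map_zero, smul_eq_mul, mul_comm]
  gcongr

theorem tendsto_prodMk (h : IsBoundaryDefining a G) (g : ℝ × ℝ → ℝ) :
    Tendsto (fun p => (g p, G p)) stripNhds stripNhds :=
  tendsto_stripNhds_iff.2 (h.tendsto_zero ha)

theorem tendsto_prodMk_pos (h : IsBoundaryDefining a G) (g : ℝ × ℝ → ℝ) :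
    Tendsto (fun p => (g p, G p)) stripNhdsPos stripNhdsPos := by
  refine tendsto_stripNhdsPos_iff.2 ⟨(h.tendsto_zero ha).mono_left stripNhdsPos_le, ?_⟩
  obtain ⟨m, hm, hle⟩ := h.exists_mul_le ha
  filter_upwards [hle, eventually_stripNhdsPos_pos] with p hp hpos
  exact (mul_pos hm hpos).trans_le hp

theorem eventually_nonneg (h : IsBoundaryDefining a G) : ∀ᶠ p in stripNhds, 0 ≤ p.2 → 0 ≤ G p := by
  have hpos := (tendsto_stripNhdsPos_iff.1 (h.tendsto_prodMk_pos ha Prod.fst)).2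
  obtain ⟨r, hr, hpos⟩ := eventually_stripNhdsPos_iff.1 hpos
  refine eventually_stripNhds_iff.2 ⟨r, hr, fun s y hy hnonneg => ?_⟩
  rcases hnonneg.eq_or_lt with hzero | hlt
  · rw [← show 0 = y from hzero, h.map_zero]
  · exact (hpos s y hlt ((le_abs_self y).trans_lt hy)).le

theorem snd_isBigO (h : IsBoundaryDefining a G) : (Prod.snd : ℝ × ℝ → ℝ) =O[stripNhdsPos] G := by
  obtain ⟨m, hm, hle⟩ := h.exists_mul_le ha
  refine IsBigO.of_bound m⁻¹ ?_
  filter_upwards [hle, eventually_stripNhdsPos_pos] with p hp hpos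
  rw [Real.norm_of_nonneg hpos.le, inv_mul_eq_div, le_div_iff₀' hm]
  exact hp.trans (le_abs_self _)

theorem pow_isBigO (h : IsBoundaryDefining a G) (N : ℕ) :
    (fun p => G p ^ N) =O[stripNhdsPos] fun p => p.2 ^ N :=
  ((h.isBigO_snd ha).mono stripNhdsPos_le).pow N

end

end IsBoundaryDefining

namespace IsStripCoord

variable {a b : ℝ} {F G : ℝ × ℝ → ℝ}

theorem exists_mixedJacobian_pos (ha : 0 < a) (h : IsStripCoord a b F G) :
    ∃ r > 0, ∀ p q : ℝ × ℝ, |p.2| < r → |q.2| < r → 0 < mixedJacobian F G p q := by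
  obtain ⟨m, hm, hFm⟩ := exists_pos_le_of_periodic ha h.fst.isLift_derivFst.smooth.continuous
    h.fst.isLift_derivFst.periodic h.derivFst_pos
  obtain ⟨n, hn, hGn⟩ := exists_pos_le_of_periodic ha
    h.snd.isLift.isLift_derivSnd.smooth.continuous h.snd.isLift.isLift_derivSnd.periodic
    h.snd.derivSnd_pos
  have hcross : Tendsto (fun x : (ℝ × ℝ) × ℝ × ℝ => derivSnd F x.1 * derivFst G x.2)
      (stripNhds ×ˢ stripNhds) (𝓝 0) := by
    have hG := (h.snd.isLift.isLift_derivFst.tendsto_zero ha h.snd.derivFst_eq_zero).comp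
      (tendsto_snd (f := stripNhds) (g := stripNhds))
    exact (((h.fst.isLift_derivSnd.isBigO_one ha).comp_tendsto
      (tendsto_fst (f := stripNhds) (g := stripNhds))).mul (isBigO_refl _ _)).trans_tendsto
        (by simpa [Function.comp_def] using hG)
  have hJ : ∀ᶠ x in stripNhds ×ˢ stripNhds, 0 < mixedJacobian F G x.1 x.2 := by
    filter_upwards [tendsto_fst.eventually hFm, tendsto_snd.eventually hGn,
      hcross.eventually_lt_const (mul_pos hm hn)] with x hF hG hlt
    have hdiag : m * n ≤ derivFst F x.1 * derivSnd G x.2 :=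
      mul_le_mul hF hG hn.le (hm.le.trans hF)
    exact sub_pos.2 (hlt.trans_le hdiag)
  obtain ⟨r, hr, hJr⟩ := hasBasis_stripNhds.prod_self.eventually_iff.1 hJ
  exact ⟨r, hr, fun p q hp hq => hJr (x := (p, q)) ⟨hp, hq⟩⟩

theorem exists_openPartialHomeomorph (ha : 0 < a) (h : IsStripCoord a b F G) :
    ∃ Φ : OpenPartialHomeomorph (ℝ × ℝ) (ℝ × ℝ), (∃ r > 0, Φ.source = {p | |p.2| < r}) ∧
      (⇑Φ = fun p => (F p, G p)) ∧ ∀ q ∈ Φ.target, ContDiffAt ℝ ∞ Φ.symm q := by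
  obtain ⟨r, hr, hJ⟩ := h.exists_mixedJacobian_pos ha
  obtain ⟨Φ, hsource, hΦ, hsymm⟩ := exists_openPartialHomeomorph_of_injOn (isOpen_strip r)
    (h.fst.smooth.prodMk h.snd.isLift.smooth)
    (injOn_of_mixedJacobian_ne_zero (convex_strip r) h.fst.differentiable
      h.snd.isLift.differentiable fun p hp q hq => (hJ p q hp hq).ne')
    fun p hp => exists_equiv_hasFDerivAt_of_mixedJacobian_ne_zero (h.fst.differentiable p)
      (h.snd.isLift.differentiable p) (hJ p p hp hp).ne'
  exact ⟨Φ, ⟨r, hr, hsource⟩, hΦ, hsymm⟩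

section Inverse

variable {Φ : OpenPartialHomeomorph (ℝ × ℝ) (ℝ × ℝ)} {r : ℝ} (h : IsStripCoord a b F G)
  (hsource : Φ.source = {p | |p.2| < r}) (hΦ : ⇑Φ = fun p => (F p, G p))
include h hsource hΦ

theorem map_mem_target_add_iff (s y : ℝ) : (s + b, y) ∈ Φ.target ↔ (s, y) ∈ Φ.target := by
  simp only [← Φ.image_source_eq_target, hsource, hΦ, mem_image, mem_ofPred_eq, Prod.exists,
    Prod.mk.injEq]
  constructor
  · rintro ⟨t, z, hz, hF, hG⟩
    have hF' := h.fst.map_add (t - a) z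
    have hG' := h.snd.isLift.map_add (t - a) z
    rw [sub_add_cancel] at hF' hG'
    exact ⟨t - a, z, hz, by linarith, by linarith⟩
  · rintro ⟨t, z, hz, hF, hG⟩
    exact ⟨t + a, z, hz, by rw [h.fst.map_add, hF], by rw [h.snd.isLift.periodic, hG]⟩

theorem eventually_mem_target (hb : 0 < b) (hr : 0 < r) : ∀ᶠ q in stripNhds, q ∈ Φ.target := by
  refine eventually_stripNhds_of_periodic hb (h.map_mem_target_add_iff hsource hΦ) fun x => ?_
  obtain ⟨s, rfl⟩ := h.fst.surjective hb 0 x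
  have hs : Φ (s, 0) ∈ Φ.target := Φ.map_source (by simpa [hsource] using hr)
  rw [hΦ] at hs
  simp only [h.snd.map_zero] at hs
  exact Φ.open_target.mem_nhds hs

theorem symm_add {q : ℝ × ℝ} (hq : q ∈ Φ.target) :
    Φ.symm (q.1 + b, q.2) = ((Φ.symm q).1 + a, (Φ.symm q).2) := by
  have hmem : Φ.symm q ∈ {p : ℝ × ℝ | |p.2| < r} := hsource ▸ Φ.map_target hq
  have hshift : Φ ((Φ.symm q).1 + a, (Φ.symm q).2) = (q.1 + b, q.2) := by
    have hinv := Φ.right_inv hq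
    rw [hΦ] at hinv ⊢
    obtain ⟨hF, hG⟩ := Prod.ext_iff.1 hinv
    exact Prod.ext ((h.fst.map_add _ _).trans (congrArg (· + b) hF))
      ((h.snd.isLift.periodic _ _).trans hG)
  rw [← hshift, Φ.left_inv (by rwa [hsource])]

end Inverse

theorem of_eventually_inverse {P Q : ℝ × ℝ → ℝ} (hb : 0 < b) (h : IsStripCoord a b F G)
    (hP : IsLift b a P) (hQ : IsLift b 0 Q)
    (hright : ∀ᶠ q in stripNhds, F (P q, Q q) = q.1 ∧ G (P q, Q q) = q.2)
    (hleft : ∀ᶠ p in stripNhds, P (F p, G p) = p.1 ∧ Q (F p, G p) = p.2) :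
    IsStripCoord b a P Q := by
  have hQ_zero : ∀ x, Q (x, 0) = 0 := fun x => by
    obtain ⟨s, rfl⟩ := h.fst.surjective hb 0 x
    have hs := (hleft.filter_mono (nhds_le_stripNhds s)).self_of_nhds.2
    rwa [h.snd.map_zero] at hs
  refine ⟨hP, ⟨hQ, hQ_zero, fun x => ?_⟩, fun x => ?_⟩
  · have hid : (fun t => G (P (x, t), Q (x, t))) =ᶠ[𝓝 0] fun t => t :=
      ((tendsto_prodMk_nhds_zero_stripNhds x).eventually hright).mono fun t ht => ht.2
    have hchain := (hasDerivAt_comp_prodMk (h.snd.isLift.differentiable _)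
      (hasDerivAt_derivSnd (hP.differentiable (x, 0)))
      (hasDerivAt_derivSnd (hQ.differentiable (x, 0)))).unique
        ((hasDerivAt_id (0 : ℝ)).congr_of_eventuallyEq hid)
    rw [hQ_zero, h.snd.derivFst_eq_zero, smul_zero, zero_add, smul_eq_mul] at hchain
    exact pos_of_mul_pos_left (hchain ▸ one_pos) (h.snd.derivSnd_pos _).le
  · have hid : (fun t => F (P (t, 0), 0)) = fun t => t := by
      funext t
      have ht := (hright.filter_mono (nhds_le_stripNhds t)).self_of_nhds.1
      rwa [hQ_zero] at ht
    have hchain := hasDerivAt_comp_prodMk (h.fst.differentiable _)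
      (hasDerivAt_derivFst (hP.differentiable (x, 0))) (hasDerivAt_const x (0 : ℝ))
    rw [hid] at hchain
    have hone := hchain.unique (hasDerivAt_id x)
    rw [zero_smul, add_zero, smul_eq_mul] at hone
    exact pos_of_mul_pos_left (hone ▸ one_pos) (h.derivFst_pos _).le

theorem exists_inverse (ha : 0 < a) (hb : 0 < b) (h : IsStripCoord a b F G) :
    ∃ P Q : ℝ × ℝ → ℝ, IsStripCoord b a P Q ∧
      (∀ᶠ q in stripNhds, F (P q, Q q) = q.1 ∧ G (P q, Q q) = q.2) ∧
      ∀ᶠ p in stripNhds, P (F p, G p) = p.1 ∧ Q (F p, G p) = p.2 := by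
  obtain ⟨Φ, ⟨r, hr, hsource⟩, hΦ, hsymm⟩ := h.exists_openPartialHomeomorph ha
  have htarget := h.eventually_mem_target hsource hΦ hb hr
  obtain ⟨P, hP, hPΦ⟩ := exists_isLift_eventuallyEq (b := a) (f := fun q => (Φ.symm q).1) hb
    (htarget.mono fun q hq => (hsymm q hq).fst)
    (htarget.mono fun q hq => by rw [h.symm_add hsource hΦ hq])
  obtain ⟨Q, hQ, hQΦ⟩ := exists_isLift_eventuallyEq (b := (0 : ℝ)) (f := fun q => (Φ.symm q).2) hb
    (htarget.mono fun q hq => (hsymm q hq).snd)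
    (htarget.mono fun q hq => by rw [h.symm_add hsource hΦ hq, add_zero])
  have hright : ∀ᶠ q in stripNhds, F (P q, Q q) = q.1 ∧ G (P q, Q q) = q.2 := by
    filter_upwards [htarget, hPΦ, hQΦ] with q hq hPq hQq
    have hinv := Φ.right_inv hq
    rw [hΦ] at hinv
    rw [hPq, hQq]
    exact Prod.ext_iff.1 hinv
  have hleft : ∀ᶠ p in stripNhds, P (F p, G p) = p.1 ∧ Q (F p, G p) = p.2 := by
    have htendsto := h.snd.tendsto_prodMk ha F
    filter_upwards [hasBasis_stripNhds.mem_of_mem hr, htendsto.eventually hPΦ,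
      htendsto.eventually hQΦ] with p hp hPp hQp
    have hinv := Φ.left_inv (hsource ▸ hp : p ∈ Φ.source)
    rw [hΦ] at hinv
    rw [hPp, hQp]
    exact Prod.ext_iff.1 hinv
  exact ⟨P, Q, h.of_eventually_inverse hb hP hQ hright hleft, hright, hleft⟩

end IsStripCoord

theorem IsBoundaryDefining.exists_inverse {a : ℝ} {G : ℝ × ℝ → ℝ} (ha : 0 < a)
    (h : IsBoundaryDefining a G) :
    ∃ D, IsBoundaryDefining a D ∧ (∀ᶠ q in stripNhds, G (q.1, D q) = q.2) ∧
      ∀ᶠ p in stripNhds, D (p.1, G p) = p.2 := by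
  obtain ⟨P, D, hPD, hright, hleft⟩ := h.isStripCoord_fst.exists_inverse ha ha
  refine ⟨D, hPD.snd, ?_, hleft.mono fun p hp => hp.2⟩
  filter_upwards [hright] with q ⟨hfst, hsnd⟩
  rwa [show P q = q.1 from hfst] at hsnd

/-- The collision following the one at `p.1` along the chord from `p.1` to `p.1 + p.2`, in terms of
the arc-length parameter and the angle. Here `A (s, d)` stands for the angle between the tangent at
`s` and the chord from `s` to `s + d`, so that the incoming angle at `s + d` is
`-A (s + d, -d)`. -/
def nextPoint (A : ℝ × ℝ → ℝ) (p : ℝ × ℝ) : ℝ × ℝ := (p.1 + p.2, -A (p.1 + p.2, -p.2))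

/-- In the coordinates `(X, Y)` the collision map with chord angle `A` is the shear
`(x, y) ↦ (x + y, y)`, up to an error of order `N`. -/
structure IsShearUpTo (N : ℕ) (A X Y : ℝ × ℝ → ℝ) : Prop where
  fst : (fun p => X (nextPoint A p) - X (p.1, A p) - Y (p.1, A p)) =O[stripNhdsPos]
    fun p => p.2 ^ N
  snd : (fun p => Y (nextPoint A p) - Y (p.1, A p)) =O[stripNhdsPos] fun p => p.2 ^ N

/-- The angle at `S q` between the tangent and the chord to `S (q.1 + q.2, q.2)`. -/
def forwardAngle (A S : ℝ × ℝ → ℝ) (q : ℝ × ℝ) : ℝ := A (S q, S (q.1 + q.2, q.2) - S q)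

/-- The defect in the reflection law of the triple
`S (ξ - η, η)`, `S (ξ, η)`, `S (ξ + η, η)`, where `q = (ξ, η)`. -/
def reflectionDefect (A S : ℝ × ℝ → ℝ) (q : ℝ × ℝ) : ℝ :=
  forwardAngle A S q + A (S q, S (q.1 - q.2, q.2) - S q)

/-- `S` is the lift of an angular function with defect of order `N`, without the normalization of
the base point. -/
structure IsAngularLift (ℓ : ℝ) (N : ℕ) (A S : ℝ × ℝ → ℝ) : Prop where
  isLift : IsLift 1 ℓ S
  derivFst_pos : ∀ ξ, 0 < derivFst S (ξ, 0)
  even : ∀ᶠ q in stripNhds, S (q.1, -q.2) = S q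
  defect : reflectionDefect A S =O[stripNhdsPos] fun q => q.2 ^ N

theorem derivSnd_eq_of_hasDerivAt {f : ℝ × ℝ → ℝ} {s y c : ℝ} (hf : DifferentiableAt ℝ f (s, y))
    (h : HasDerivAt (fun t => f (s, t)) c y) : derivSnd f (s, y) = c :=
  (hasDerivAt_derivSnd hf).unique h

theorem isBoundaryDefining_snd (a : ℝ) : IsBoundaryDefining a Prod.snd :=
  ⟨⟨contDiff_snd, fun s y => by simp⟩, fun _ => rfl, fun s => by simp [derivSnd_snd]⟩

theorem IsBoundaryDefining.comp_lift {a b : ℝ} {A S J : ℝ × ℝ → ℝ} (hA : IsBoundaryDefining b A)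
    (hS : IsLift a b S) (hJ : IsBoundaryDefining a J) :
    IsBoundaryDefining a (fun q => A (S q, J q)) := by
  have hsmooth : ContDiff ℝ ∞ fun q => A (S q, J q) :=
    hA.isLift.smooth.comp (hS.smooth.prodMk hJ.isLift.smooth)
  refine ⟨⟨hsmooth, fun s y => ?_⟩, fun s => by rw [hJ.map_zero, hA.map_zero], fun s => ?_⟩
  · rw [hS.map_add, hJ.isLift.periodic, hA.isLift.map_add]
  · have hderiv := hasDerivAt_comp_prodMk (hA.isLift.differentiable (S (s, 0), J (s, 0)))
      (hasDerivAt_derivSnd (hS.differentiable (s, 0)))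
      (hasDerivAt_derivSnd (hJ.isLift.differentiable (s, 0)))
    rw [derivSnd_eq_of_hasDerivAt (hsmooth.differentiable (by simp) _) hderiv, hJ.map_zero,
      hA.derivFst_eq_zero]
    simpa using mul_pos (hJ.derivSnd_pos s) (hA.derivSnd_pos _)

section NextPoint

variable {ℓ : ℝ} {A : ℝ × ℝ → ℝ}

theorem IsBoundaryDefining.nextPoint_snd (hA : IsBoundaryDefining ℓ A) :
    IsBoundaryDefining ℓ (fun p => (nextPoint A p).2) := by
  have hsmooth : ContDiff ℝ ∞ fun p => (nextPoint A p).2 := by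
    have := hA.isLift.smooth
    simp only [nextPoint]
    fun_prop
  refine ⟨⟨hsmooth, fun s y => ?_⟩, fun s => by simp [nextPoint, hA.map_zero], fun s => ?_⟩
  · simp only [nextPoint, add_right_comm s ℓ y, hA.isLift.map_add, add_zero]
  · have hderiv := (hasDerivAt_comp_prodMk (hA.isLift.differentiable (s + 0, -0))
      ((hasDerivAt_id (0 : ℝ)).const_add s) (hasDerivAt_id (0 : ℝ)).neg).neg
    rw [derivSnd_eq_of_hasDerivAt (hsmooth.differentiable (by simp) _) hderiv]
    simpa [hA.derivFst_eq_zero] using hA.derivSnd_pos s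

theorem tendsto_nextPoint (hℓ : 0 < ℓ) (hA : IsBoundaryDefining ℓ A) :
    Tendsto (nextPoint A) stripNhds stripNhds :=
  hA.nextPoint_snd.tendsto_prodMk hℓ fun p => p.1 + p.2

theorem tendsto_nextPoint_pos (hℓ : 0 < ℓ) (hA : IsBoundaryDefining ℓ A) :
    Tendsto (nextPoint A) stripNhdsPos stripNhdsPos :=
  hA.nextPoint_snd.tendsto_prodMk_pos hℓ fun p => p.1 + p.2

end NextPoint

theorem isStripCoord_shift_sub {a b : ℝ} {S : ℝ × ℝ → ℝ} (hS : IsLift a b S)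
    (hS' : ∀ ξ, 0 < derivFst S (ξ, 0)) :
    IsStripCoord a b S (fun q => S (q.1 + q.2, q.2) - S q) := by
  refine ⟨hS, ⟨hS.isLift_shift_sub, fun s => by simp, fun s => ?_⟩, hS'⟩
  have hderiv := (hasDerivAt_comp_prodMk (hS.differentiable (s + 0, 0))
    ((hasDerivAt_id (0 : ℝ)).const_add s) (hasDerivAt_id (0 : ℝ))).sub
      (hasDerivAt_derivSnd (hS.differentiable (s, 0)))
  rw [derivSnd_eq_of_hasDerivAt (hS.isLift_shift_sub.differentiable _) hderiv]
  simpa using hS' s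

theorem isStripCoord_forwardAngle {a b : ℝ} {A S : ℝ × ℝ → ℝ} (hA : IsBoundaryDefining b A)
    (hS : IsLift a b S) (hS' : ∀ ξ, 0 < derivFst S (ξ, 0)) :
    IsStripCoord a b S (forwardAngle A S) :=
  ⟨hS, hA.comp_lift hS (isStripCoord_shift_sub hS hS').snd, hS'⟩

section ShearToAngular

variable {ℓ : ℝ} {N : ℕ} {A X Y S Φ d : ℝ × ℝ → ℝ} (hℓ : 0 < ℓ)
  (hA : IsBoundaryDefining ℓ A) (hXY : IsStripCoord ℓ 1 X Y) (h : IsShearUpTo N A X Y)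
include hℓ hA hXY h

theorem IsShearUpTo.sub_isBigO {c : ℝ} {R : ℝ × ℝ → ℝ} (hR : IsLift 1 c R) :
    (fun p => R (X (nextPoint A p), Y (nextPoint A p)) -
      R (X (p.1, A p) + Y (p.1, A p), Y (p.1, A p))) =O[stripNhdsPos] fun p => p.2 ^ N :=
  hR.sub_isBigO one_pos
    (((hXY.snd.tendsto_prodMk hℓ X).comp (tendsto_nextPoint hℓ hA)).mono_left stripNhdsPos_le)
    (((hXY.snd.tendsto_prodMk hℓ fun p => X p + Y p).comp
      (hA.tendsto_prodMk hℓ Prod.fst)).mono_left stripNhdsPos_le)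
    (h.fst.congr_left fun p => by ring) h.snd

variable (hS : IsStripCoord 1 ℓ S Φ)
  (hright : ∀ᶠ q in stripNhds, X (S q, Φ q) = q.1 ∧ Y (S q, Φ q) = q.2)
  (hleft : ∀ᶠ p in stripNhds, S (X p, Y p) = p.1 ∧ Φ (X p, Y p) = p.2)
  (hd : IsBoundaryDefining 1 d) (hAd : ∀ᶠ q in stripNhds, A (S q, d q) = Φ q)
include hS hright hleft hd hAd

theorem IsShearUpTo.nextPoint_sub_isBigO :
    (fun q => S q + d q - S (q.1 + q.2, q.2)) =O[stripNhdsPos] (fun q => q.2 ^ N) ∧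
    (fun q => -A (S q + d q, -d q) - Φ (q.1 + q.2, q.2)) =O[stripNhdsPos] fun q => q.2 ^ N := by
  have hu := hd.tendsto_prodMk_pos one_pos S
  have hcoord : ∀ᶠ q in stripNhdsPos, X (S q, A (S q, d q)) = q.1 ∧
      Y (S q, A (S q, d q)) = q.2 := by
    filter_upwards [stripNhdsPos_le hright, stripNhdsPos_le hAd] with q hq hΦ
    rwa [hΦ]
  have hnext := ((tendsto_nextPoint hℓ hA).comp (hu.mono_right stripNhdsPos_le)).eventually hleft
  constructor
  · refine ((h.sub_isBigO hℓ hA hXY hS.fst).comp_tendsto hu).trans (hd.pow_isBigO one_pos N)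
      |>.congr' ?_ EventuallyEq.rfl
    filter_upwards [hcoord, hnext] with q hq hn
    simp only [Function.comp_apply] at hn ⊢
    rw [hn.1, hq.1, hq.2, nextPoint]
  · refine ((h.sub_isBigO hℓ hA hXY hS.snd.isLift).comp_tendsto hu).trans
      (hd.pow_isBigO one_pos N) |>.congr' ?_ EventuallyEq.rfl
    filter_upwards [hcoord, hnext] with q hq hn
    simp only [Function.comp_apply] at hn ⊢
    rw [hn.2, hq.1, hq.2, nextPoint]

theorem IsShearUpTo.forwardAngle_sub_isBigO :
    (fun q => forwardAngle A S q - Φ q) =O[stripNhdsPos] fun q => q.2 ^ N := by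
  have hchord := (h.nextPoint_sub_isBigO hℓ hA hXY hS hright hleft hd hAd).1
  have hJ := (isStripCoord_shift_sub hS.fst hS.derivFst_pos).snd
  have hsub := hA.isLift.sub_isBigO hℓ (e := fun q => q.2 ^ N)
    ((hJ.tendsto_prodMk one_pos S).mono_left stripNhdsPos_le)
    ((hd.tendsto_prodMk one_pos S).mono_left stripNhdsPos_le)
    (by simpa using isBigO_zero _ _) (hchord.neg_left.congr_left fun q => by ring)
  refine hsub.congr' ?_ EventuallyEq.rfl
  filter_upwards [stripNhdsPos_le hAd] with q hq
  rw [forwardAngle, hq]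

theorem IsShearUpTo.backwardAngle_add_isBigO :
    (fun q => A (S (q.1 + q.2, q.2), S q - S (q.1 + q.2, q.2)) + Φ (q.1 + q.2, q.2))
      =O[stripNhdsPos] fun q => q.2 ^ N := by
  obtain ⟨hchord, hangle⟩ := h.nextPoint_sub_isBigO hℓ hA hXY hS hright hleft hd hAd
  have hJ := (isStripCoord_shift_sub hS.fst hS.derivFst_pos).snd.tendsto_zero one_pos
  have hsub := hA.isLift.sub_isBigO hℓ (e := fun q => q.2 ^ N) (l := stripNhdsPos)
    (u := fun q => (S (q.1 + q.2, q.2), S q - S (q.1 + q.2, q.2)))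
    (v := fun q => (S q + d q, -d q))
    (tendsto_stripNhds_iff.2 (by simpa using (hJ.mono_left stripNhdsPos_le).neg))
    (tendsto_stripNhds_iff.2
      (by simpa using ((hd.tendsto_zero one_pos).mono_left stripNhdsPos_le).neg))
    (hchord.neg_left.congr_left fun q => by ring) (hchord.congr_left fun q => by ring)
  exact (hsub.sub hangle).congr_left fun q => by ring

theorem IsShearUpTo.reflectionDefect_isBigO :
    reflectionDefect A S =O[stripNhdsPos] fun q => q.2 ^ N := by
  have hforward := h.forwardAngle_sub_isBigO hℓ hA hXY hS hright hleft hd hAd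
  have hbackward := (h.backwardAngle_add_isBigO hℓ hA hXY hS hright hleft hd hAd).comp_tendsto
    (tendsto_prodMk_snd_stripNhdsPos fun q => q.1 - q.2)
  refine (hforward.add hbackward).congr_left fun q => ?_
  simp only [Function.comp_apply, sub_add_cancel, reflectionDefect]
  ring

omit hS hright hleft hd hAd in
/-- The angular function is the first component of the inverse of the coordinate change. -/
theorem IsShearUpTo.exists_isAngularLift (hX : ∀ s y, X (s, -y) = X (s, y))
    (hY : ∀ s y, Y (s, -y) = -Y (s, y)) : ∃ S, IsAngularLift ℓ N A S := by
  obtain ⟨S, Φ, hS, hright, hleft⟩ := hXY.exists_inverse hℓ one_pos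
  obtain ⟨D, hD, hAD, -⟩ := hA.exists_inverse hℓ
  refine ⟨S, hS.fst, hS.derivFst_pos, ?_, h.reflectionDefect_isBigO hℓ hA hXY hS hright hleft
    (hD.comp_lift hS.fst hS.snd) ((hS.snd.tendsto_prodMk one_pos S).eventually hAD)⟩
  have hneg := (tendsto_prodMk_neg_stripNhds Prod.fst).comp (hS.snd.tendsto_prodMk one_pos S)
  filter_upwards [hright, hneg.eventually hleft] with q hq hq'
  simp only [Function.comp_apply] at hq'
  rw [hX, hY, hq.1, hq.2] at hq'
  exact hq'.1

end ShearToAngular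

theorem exists_implicit_fst {a b : ℝ} {S : ℝ × ℝ → ℝ} (ha : 0 < a) (hb : 0 < b)
    (hS : IsLift a b S) (hS' : ∀ ξ, 0 < derivFst S (ξ, 0)) :
    ∃ R, IsLift b a R ∧ ∀ᶠ q in stripNhds, S (R q, q.2) = q.1 ∧ R (S q, q.2) = q.1 := by
  have hcoord : IsStripCoord a b S Prod.snd := ⟨hS, isBoundaryDefining_snd a, hS'⟩
  obtain ⟨R, Q, hR, hright, hleft⟩ := hcoord.exists_inverse ha hb
  refine ⟨R, hR.fst, ?_⟩
  filter_upwards [hright, hleft] with q hq hq'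
  have hQ : Q q = q.2 := hq.2
  exact ⟨hQ ▸ hq.1, hq'.1⟩

namespace IsAngularLift

variable {ℓ : ℝ} {N : ℕ} {A S : ℝ × ℝ → ℝ}

theorem translate (h : IsAngularLift ℓ N A S) {α : ℝ → ℝ} (hα : ContDiff ℝ ∞ α)
    (heven : ∀ᶠ y in 𝓝 0, α (-y) = α y) :
    IsAngularLift ℓ N A (fun q => S (q.1 + α q.2, q.2)) := by
  have hlift : IsLift 1 ℓ fun q => S (q.1 + α q.2, q.2) := by
    refine ⟨?_, fun s y => ?_⟩
    · have := h.isLift.smooth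
      fun_prop
    · simp only [add_right_comm s 1, h.isLift.map_add]
  refine ⟨hlift, fun ξ => ?_, ?_, ?_⟩
  · have hderiv := (hasDerivAt_derivFst (h.isLift.differentiable (ξ + α 0, 0))).comp_add_const ξ
      (α 0)
    rw [(hasDerivAt_derivFst (hlift.differentiable (ξ, 0))).unique hderiv]
    exact h.derivFst_pos _
  · filter_upwards [tendsto_snd_stripNhds.eventually heven,
      (tendsto_prodMk_snd_stripNhds fun q => q.1 + α q.2).eventually h.even] with q hα_even hS_even
    rw [hα_even]
    exact hS_even
  · refine (h.defect.comp_tendsto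
      (tendsto_prodMk_snd_stripNhdsPos fun q => q.1 + α q.2)).congr_left fun q => ?_
    simp only [Function.comp_apply, reflectionDefect, forwardAngle, add_right_comm,
      sub_add_eq_add_sub]

theorem exists_even_level_curve (hℓ : 0 < ℓ) (h : IsAngularLift ℓ N A S) :
    ∃ α : ℝ → ℝ, ContDiff ℝ ∞ α ∧ (∀ᶠ y in 𝓝 0, α (-y) = α y) ∧
      ∀ᶠ y in 𝓝 0, S (α y, y) = S (0, 0) := by
  obtain ⟨R, hR, hinv⟩ := exists_implicit_fst one_pos hℓ h.isLift h.derivFst_pos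
  let α : ℝ → ℝ := fun y => R (S (0, 0), y)
  have hgraph : ∀ f : ℝ → ℝ, Tendsto (fun y => (f y, y)) (𝓝 0) stripNhds := fun f =>
    tendsto_stripNhds_iff.2 tendsto_id
  have hlevel : ∀ᶠ y in 𝓝 0, S (α y, y) = S (0, 0) :=
    ((hgraph fun _ => S (0, 0)).eventually hinv).mono fun y hy => hy.1
  have hneg : Tendsto (fun y : ℝ => -y) (𝓝 0) (𝓝 0) := by
    simpa using (continuous_neg (G := ℝ)).tendsto 0
  refine ⟨α, by have := hR.smooth; fun_prop, ?_, hlevel⟩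
  filter_upwards [hneg.eventually hlevel, (hgraph fun y => α (-y)).eventually h.even,
    (hgraph fun y => α (-y)).eventually hinv] with y hy heven hleft
  calc α (-y) = R (S (α (-y), y), y) := hleft.2.symm
    _ = R (S (α (-y), -y), y) := by rw [heven]
    _ = α y := by rw [hy]

theorem exists_fixed_base (hℓ : 0 < ℓ) (h : IsAngularLift ℓ N A S) :
    ∃ S, IsAngularLift ℓ N A S ∧ ∀ᶠ q in stripNhds, S (0, q.2) = S (0, 0) := by
  obtain ⟨α, hα, heven, hlevel⟩ := h.exists_even_level_curve hℓ
  refine ⟨_, h.translate hα heven, ?_⟩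
  filter_upwards [tendsto_snd_stripNhds.eventually hlevel] with q hq
  simp only [zero_add, hq, hlevel.self_of_nhds]

theorem isStripCoord (hA : IsBoundaryDefining ℓ A) (h : IsAngularLift ℓ N A S) :
    IsStripCoord 1 ℓ S (forwardAngle A S) :=
  isStripCoord_forwardAngle hA h.isLift h.derivFst_pos

theorem forwardAngle_add_isBigO (h : IsAngularLift ℓ N A S) :
    (fun q => forwardAngle A S q + forwardAngle A S (q.1, -q.2)) =O[stripNhdsPos]
      fun q => q.2 ^ N := by
  refine h.defect.congr' ?_ EventuallyEq.rfl
  have hback := (tendsto_prodMk_snd_stripNhds fun q => q.1 - q.2).eventually h.even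
  filter_upwards [stripNhdsPos_le h.even, stripNhdsPos_le hback] with q hq hq'
  rw [reflectionDefect, forwardAngle, forwardAngle, hq, ← hq', ← sub_eq_add_neg]

variable (hℓ : 0 < ℓ) (hA : IsBoundaryDefining ℓ A) (h : IsAngularLift ℓ N A S)
include hℓ hA h

/-- The two arguments differ by the reflection defect, since `S` is even. -/
theorem lift_neg_forwardAngle_sub_isBigO {c : ℝ} {R : ℝ × ℝ → ℝ} (hR : IsLift ℓ c R) :
    (fun q => R (S q, -forwardAngle A S (q.1, -q.2)) - R (S q, forwardAngle A S q))
      =O[stripNhdsPos] fun q => q.2 ^ N := by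
  have hB := (h.isStripCoord hA).snd.tendsto_zero one_pos
  have hBneg := hB.comp (tendsto_prodMk_neg_stripNhds Prod.fst)
  exact hR.sub_isBigO hℓ
    (tendsto_stripNhds_iff.2 (by simpa using (hBneg.mono_left stripNhdsPos_le).neg))
    (tendsto_stripNhds_iff.2 (hB.mono_left stripNhdsPos_le))
    (by simpa using isBigO_zero _ _)
    (h.forwardAngle_add_isBigO.neg_left.congr_left fun q => by ring)

theorem lift_forwardAngle_neg_sub_isBigO {c : ℝ} {R : ℝ × ℝ → ℝ} (hR : IsLift ℓ c R) :
    (fun q => R (S q, -forwardAngle A S q) - R (S q, forwardAngle A S (q.1, -q.2)))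
      =O[stripNhdsPos] fun q => q.2 ^ N := by
  have hRneg : IsLift ℓ c fun p => R (p.1, -p.2) :=
    ⟨by have := hR.smooth; fun_prop, fun s y => hR.map_add s (-y)⟩
  simpa using (h.lift_neg_forwardAngle_sub_isBigO hℓ hA hRneg).neg_left

variable {P Q : ℝ × ℝ → ℝ} (hPQ : IsStripCoord ℓ 1 P Q)
  (hright : ∀ᶠ p in stripNhds, S (P p, Q p) = p.1 ∧ forwardAngle A S (P p, Q p) = p.2)
  (hleft : ∀ᶠ q in stripNhds, P (S q, forwardAngle A S q) = q.1 ∧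
    Q (S q, forwardAngle A S q) = q.2)
include hPQ hright

theorem eventually_shift_eq_add : ∀ᶠ p in stripNhdsPos,
    S (P (p.1, A p) + Q (p.1, A p), Q (p.1, A p)) = p.1 + p.2 := by
  obtain ⟨D, -, -, hD⟩ := hA.exists_inverse hℓ
  have hApos := hA.tendsto_prodMk_pos hℓ Prod.fst
  have hz := ((hPQ.snd.tendsto_prodMk_pos hℓ P).comp hApos).mono_right stripNhdsPos_le
  have hchord := (isStripCoord_shift_sub h.isLift h.derivFst_pos).snd.tendsto_prodMk one_pos S
  filter_upwards [hApos.eventually (stripNhdsPos_le hright), stripNhdsPos_le hD,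
    (hchord.comp hz).eventually hD] with p hinv hDp hDz
  simp only [Function.comp_apply] at hDz
  change D (S _, forwardAngle A S _) = _ at hDz
  rw [hinv.1, hinv.2, hDp] at hDz
  linarith

theorem eventually_nextPoint_eq : ∀ᶠ p in stripNhdsPos,
    nextPoint A p = (S (P (p.1, A p) + Q (p.1, A p), Q (p.1, A p)),
      -forwardAngle A S (P (p.1, A p) + Q (p.1, A p), -Q (p.1, A p))) := by
  have hz := ((hPQ.snd.tendsto_prodMk_pos hℓ P).comp
    (hA.tendsto_prodMk_pos hℓ Prod.fst)).mono_right stripNhdsPos_le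
  have hz' := (tendsto_prodMk_snd_stripNhds fun q => q.1 + q.2).comp hz
  filter_upwards [h.eventually_shift_eq_add hℓ hA hPQ hright,
    (hA.tendsto_prodMk_pos hℓ Prod.fst).eventually (stripNhdsPos_le hright),
    hz.eventually h.even, hz'.eventually h.even] with p hshift hinv heven heven'
  simp only [Function.comp_apply] at heven heven'
  rw [forwardAngle, heven', add_neg_cancel_right, heven, hinv.1, hshift, sub_add_cancel_left,
    nextPoint]

include hleft

theorem parity_isBigO :
    (fun p => P (p.1, -p.2) - P p) =O[stripNhdsPos] (fun p => p.2 ^ N) ∧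
    (fun p => Q (p.1, -p.2) + Q p) =O[stripNhdsPos] (fun p => p.2 ^ N) := by
  have hPQpos := hPQ.snd.tendsto_prodMk_pos hℓ P
  have hneg : ∀ᶠ q in stripNhdsPos, P (S q, forwardAngle A S (q.1, -q.2)) = q.1 ∧
      Q (S q, forwardAngle A S (q.1, -q.2)) = -q.2 := by
    filter_upwards [stripNhdsPos_le ((tendsto_prodMk_neg_stripNhds Prod.fst).eventually hleft),
      stripNhdsPos_le h.even] with q hq heven
    rwa [heven] at hq
  constructor
  · refine (((h.lift_forwardAngle_neg_sub_isBigO hℓ hA hPQ.fst).comp_tendsto hPQpos).trans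
      (hPQ.snd.pow_isBigO hℓ N)).congr' ?_ EventuallyEq.rfl
    filter_upwards [hPQpos.eventually hneg, stripNhdsPos_le hright] with p hp hinv
    simp only [Function.comp_apply]
    rw [hp.1, hinv.1, hinv.2]
  · refine (((h.lift_forwardAngle_neg_sub_isBigO hℓ hA hPQ.snd.isLift).comp_tendsto hPQpos).trans
      (hPQ.snd.pow_isBigO hℓ N)).congr' ?_ EventuallyEq.rfl
    filter_upwards [hPQpos.eventually hneg, stripNhdsPos_le hright] with p hp hinv
    simp only [Function.comp_apply]
    rw [hp.2, hinv.1, hinv.2, sub_neg_eq_add]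

theorem isShearUpTo_inverse : IsShearUpTo N A P Q := by
  have hzpos : Tendsto (fun p => (P (p.1, A p) + Q (p.1, A p), Q (p.1, A p)))
      stripNhdsPos stripNhdsPos :=
    (hPQ.snd.tendsto_prodMk_pos hℓ fun p => P p + Q p).comp (hA.tendsto_prodMk_pos hℓ Prod.fst)
  have hpow : (fun p => Q (p.1, A p) ^ N) =O[stripNhdsPos] fun p => p.2 ^ N :=
    ((hPQ.snd.pow_isBigO hℓ N).comp_tendsto (hA.tendsto_prodMk_pos hℓ Prod.fst)).trans
      (hA.pow_isBigO hℓ N)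
  have hnext := h.eventually_nextPoint_eq hℓ hA hPQ hright
  have hinv := hzpos.eventually (stripNhdsPos_le hleft)
  constructor
  · refine (((h.lift_neg_forwardAngle_sub_isBigO hℓ hA hPQ.fst).comp_tendsto hzpos).trans
      hpow).congr' ?_ EventuallyEq.rfl
    filter_upwards [hnext, hinv] with p hp hz
    simp only [Function.comp_apply, hp, hz.1, sub_sub]
  · refine (((h.lift_neg_forwardAngle_sub_isBigO hℓ hA hPQ.snd.isLift).comp_tendsto hzpos).trans
      hpow).congr' ?_ EventuallyEq.rfl
    filter_upwards [hnext, hinv] with p hp hz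
    simp only [Function.comp_apply, hp, hz.2]

omit hPQ hright hleft in
/-- The coordinate change inverts the map `q ↦ (S q, φ q)`, where `φ q` is the forward angle. -/
theorem exists_isShearUpTo :
    ∃ P Q, IsStripCoord ℓ 1 P Q ∧
      (fun p => P (p.1, -p.2) - P p) =O[stripNhdsPos] (fun p => p.2 ^ N) ∧
      (fun p => Q (p.1, -p.2) + Q p) =O[stripNhdsPos] (fun p => p.2 ^ N) ∧
      IsShearUpTo N A P Q := by
  obtain ⟨P, Q, hPQ, hright, hleft⟩ := (h.isStripCoord hA).exists_inverse one_pos hℓ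
  obtain ⟨heven, hodd⟩ := h.parity_isBigO hℓ hA hPQ hright hleft
  exact ⟨P, Q, hPQ, heven, hodd, h.isShearUpTo_inverse hℓ hA hPQ hright hleft⟩

end IsAngularLift

/-- The `i`-th Taylor coefficient of `f (s, y)` at `y = 0`, as a function of `s`. -/
def taylorCoeff (f : ℝ × ℝ → ℝ) (i : ℕ) (s : ℝ) : ℝ := (hadamardQuotient^[i] f) (s, 0)

section Taylor

variable {a b : ℝ} {f : ℝ × ℝ → ℝ}

theorem contDiff_iterate_hadamardQuotient (hf : ContDiff ℝ ∞ f) (i : ℕ) :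
    ContDiff ℝ ∞ (hadamardQuotient^[i] f) := by
  induction i with
  | zero => exact hf
  | succ i ih =>
    rw [Function.iterate_succ_apply']
    exact contDiff_hadamardQuotient ih

theorem IsLift.iterate_hadamardQuotient (hf : IsLift a b f) {i : ℕ} (hi : i ≠ 0) :
    IsLift a 0 (hadamardQuotient^[i] f) := by
  induction i with
  | zero => exact absurd rfl hi
  | succ i ih =>
    rw [Function.iterate_succ_apply']
    rcases eq_or_ne i 0 with rfl | h
    · exact hf.isLift_hadamardQuotient
    · exact (ih h).isLift_hadamardQuotient

theorem contDiff_taylorCoeff (hf : ContDiff ℝ ∞ f) (i : ℕ) : ContDiff ℝ ∞ (taylorCoeff f i) :=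
  (contDiff_iterate_hadamardQuotient hf i).comp
    (by fun_prop : ContDiff ℝ ∞ fun s : ℝ => (s, (0 : ℝ)))

theorem taylorCoeff_periodic (hf : IsLift a b f) {i : ℕ} (hi : i ≠ 0) :
    Function.Periodic (taylorCoeff f i) a := fun s =>
  (hf.iterate_hadamardQuotient hi).periodic s 0

theorem eq_sum_taylorCoeff (hf : ContDiff ℝ ∞ f) (n : ℕ) (p : ℝ × ℝ) :
    f p = ∑ i ∈ Finset.range n, taylorCoeff f i p.1 * p.2 ^ i +
      p.2 ^ n * (hadamardQuotient^[n] f) p := by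
  induction n with
  | zero => simp
  | succ n ih =>
    rw [Finset.sum_range_succ, Function.iterate_succ_apply']
    conv_lhs => rw [ih, eq_add_smul_hadamardQuotient
      ((contDiff_iterate_hadamardQuotient hf n).of_le (by simp)) p]
    simp only [taylorCoeff, smul_eq_mul]
    ring

theorem sum_range_two_mul {M : Type*} [AddCommMonoid M] (g : ℕ → M) (n : ℕ) :
    ∑ i ∈ Finset.range (2 * n), g i =
      ∑ j ∈ Finset.range n, g (2 * j) + ∑ j ∈ Finset.range n, g (2 * j + 1) := by
  induction n with
  | zero => simp
  | succ n ih =>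
    rw [Nat.mul_succ, Finset.sum_range_succ, Finset.sum_range_succ, ih, Finset.sum_range_succ,
      Finset.sum_range_succ]
    abel

theorem sum_taylorCoeff_neg (f : ℝ × ℝ → ℝ) (n : ℕ) (s y : ℝ) :
    ∑ i ∈ Finset.range (2 * n), taylorCoeff f i s * (-y) ^ i =
      ∑ j ∈ Finset.range n, taylorCoeff f (2 * j) s * y ^ (2 * j) -
        ∑ j ∈ Finset.range n, taylorCoeff f (2 * j + 1) s * y ^ (2 * j + 1) := by
  simp only [sum_range_two_mul, (even_two_mul _).neg_pow, (odd_two_mul_add_one _).neg_pow,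
    mul_neg, Finset.sum_neg_distrib, sub_eq_add_neg]

section Expansion

variable (ha : 0 < a) (hf : IsLift a b f) {n : ℕ} (hn : n ≠ 0)
include ha hf hn

theorem sub_sum_taylorCoeff_isBigO :
    (fun p => f p - ∑ i ∈ Finset.range n, taylorCoeff f i p.1 * p.2 ^ i) =O[stripNhds]
      fun p => p.2 ^ n := by
  have h := (isBigO_refl (fun p : ℝ × ℝ => p.2 ^ n) stripNhds).mul
    ((hf.iterate_hadamardQuotient hn).isBigO_one ha)
  simp only [mul_one] at h
  refine h.congr_left fun p => ?_
  rw [eq_sum_taylorCoeff hf.smooth n p]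
  ring

theorem neg_sub_sum_taylorCoeff_isBigO :
    (fun p => f (p.1, -p.2) - ∑ i ∈ Finset.range n, taylorCoeff f i p.1 * (-p.2) ^ i)
      =O[stripNhds] fun p => p.2 ^ n :=
  ((sub_sum_taylorCoeff_isBigO ha hf hn).comp_tendsto
    (tendsto_prodMk_neg_stripNhds Prod.fst)).trans
      (IsBigO.of_bound 1 (Eventually.of_forall fun p => by simp))

theorem sub_sum_even_taylorCoeff_isBigO
    (h : (fun p => f (p.1, -p.2) - f p) =O[stripNhdsPos] fun p => p.2 ^ (2 * n)) :
    (fun p => f p - ∑ j ∈ Finset.range n, taylorCoeff f (2 * j) p.1 * p.2 ^ (2 * j))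
      =O[stripNhdsPos] fun p => p.2 ^ (2 * n) := by
  have hn' : 2 * n ≠ 0 := mul_ne_zero two_ne_zero hn
  have hpos := (sub_sum_taylorCoeff_isBigO ha hf hn').mono stripNhdsPos_le
  have hneg := (neg_sub_sum_taylorCoeff_isBigO ha hf hn').mono stripNhdsPos_le
  refine (((hpos.add hneg).sub h).const_mul_left (1 / 2)).congr_left fun p => ?_
  rw [sum_range_two_mul, sum_taylorCoeff_neg]
  ring

theorem sub_sum_odd_taylorCoeff_isBigO
    (h : (fun p => f (p.1, -p.2) + f p) =O[stripNhdsPos] fun p => p.2 ^ (2 * n)) :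
    (fun p => f p - ∑ j ∈ Finset.range n, taylorCoeff f (2 * j + 1) p.1 * p.2 ^ (2 * j + 1))
      =O[stripNhdsPos] fun p => p.2 ^ (2 * n) := by
  have hn' : 2 * n ≠ 0 := mul_ne_zero two_ne_zero hn
  have hpos := (sub_sum_taylorCoeff_isBigO ha hf hn').mono stripNhdsPos_le
  have hneg := (neg_sub_sum_taylorCoeff_isBigO ha hf hn').mono stripNhdsPos_le
  refine (((hpos.sub hneg).add h).const_mul_left (1 / 2)).congr_left fun p => ?_
  rw [sum_range_two_mul, sum_taylorCoeff_neg]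
  ring

end Expansion

end Taylor

section Monomials

variable {ℓ : ℝ} {A : ℝ × ℝ → ℝ} {w : ℝ → ℝ}

/-- The change of the monomial `w s * φ ^ m` under the collision map, divided by the `m`-th power
of the length of the boundary arc between the two collisions. -/
def monomialChange (A : ℝ × ℝ → ℝ) (w : ℝ → ℝ) (m : ℕ) (p : ℝ × ℝ) : ℝ :=
  w (p.1 + p.2) * hadamardQuotient A (p.1 + p.2, -p.2) ^ m - w p.1 * hadamardQuotient A p ^ m

theorem monomialChange_zero (A : ℝ × ℝ → ℝ) (w : ℝ → ℝ) (m : ℕ) (s : ℝ) :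
    monomialChange A w m (s, 0) = 0 := by
  simp [monomialChange]

variable (hA : IsBoundaryDefining ℓ A)
include hA

theorem hadamardQuotient_pos (s : ℝ) : 0 < hadamardQuotient A (s, 0) := by
  rw [hadamardQuotient_zero]
  exact hA.derivSnd_pos s

theorem monomial_nextPoint_sub (m : ℕ) (p : ℝ × ℝ) :
    w (nextPoint A p).1 * (nextPoint A p).2 ^ m - w p.1 * A p ^ m =
      p.2 ^ m * monomialChange A w m p := by
  simp only [nextPoint, monomialChange]
  rw [hA.isLift.eq_smul_hadamardQuotient hA.map_zero p,
    hA.isLift.eq_smul_hadamardQuotient hA.map_zero (p.1 + p.2, -p.2)]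
  simp only [smul_eq_mul, mul_pow, neg_mul, neg_neg]
  ring

variable (hw : ContDiff ℝ ∞ w) (hper : Function.Periodic w ℓ)
include hw hper

theorem isLift_monomialChange (m : ℕ) : IsLift ℓ 0 (monomialChange A w m) := by
  have hlift := hA.isLift.isLift_hadamardQuotient
  refine ⟨?_, fun s y => ?_⟩
  · have := hlift.smooth
    unfold monomialChange
    fun_prop
  · simp only [monomialChange, add_right_comm s ℓ y, hlift.periodic, hper _, add_zero]

theorem monomial_nextPoint_sub_isBigO (hℓ : 0 < ℓ) (m : ℕ) :
    (fun p => w (nextPoint A p).1 * (nextPoint A p).2 ^ m - w p.1 * A p ^ m) =O[stripNhds]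
      fun p => p.2 ^ (m + 1) := by
  simp only [monomial_nextPoint_sub hA, pow_succ]
  exact (isBigO_refl _ _).mul
    ((isLift_monomialChange hA hw hper m).isBigO_snd hℓ (monomialChange_zero A w m))

theorem exists_monomial_nextPoint_sub_isBigO (hℓ : 0 < ℓ) (m : ℕ) :
    ∃ W : ℝ → ℝ, ContDiff ℝ ∞ W ∧ Function.Periodic W ℓ ∧
      (fun p => w (nextPoint A p).1 * (nextPoint A p).2 ^ m - w p.1 * A p ^ m -
        W p.1 * A p ^ (m + 1)) =O[stripNhds] fun p => p.2 ^ (m + 2) := by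
  have hE := isLift_monomialChange hA hw hper m
  have hE' := hE.isLift_hadamardQuotient
  have hA' := hA.isLift.isLift_hadamardQuotient
  have hA_ne : ∀ s, hadamardQuotient A (s, 0) ^ (m + 1) ≠ 0 := fun s =>
    pow_ne_zero _ (hadamardQuotient_pos hA s).ne'
  have hE_smooth := hE'.smooth
  have hA_smooth := hA'.smooth
  let W : ℝ → ℝ := fun s =>
    hadamardQuotient (monomialChange A w m) (s, 0) / hadamardQuotient A (s, 0) ^ (m + 1)
  have hW : ContDiff ℝ ∞ W := ContDiff.div (by fun_prop) (by fun_prop) hA_ne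
  have hW_per : Function.Periodic W ℓ := fun s => by
    simp only [W, hE'.periodic, hA'.periodic]
  have hrem : IsLift ℓ 0 fun p =>
      hadamardQuotient (monomialChange A w m) p - W p.1 * hadamardQuotient A p ^ (m + 1) :=
    ⟨by fun_prop, fun s y => by simp only [hW_per _, hE'.periodic, hA'.periodic, add_zero]⟩
  have hrem_isBigO := hrem.isBigO_snd hℓ fun s => by
    simp only [W, div_mul_cancel₀ _ (hA_ne s), sub_self]
  refine ⟨W, hW, hW_per, ((isBigO_refl (fun p : ℝ × ℝ => p.2 ^ (m + 1)) stripNhds).mul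
    hrem_isBigO).congr (fun p => ?_) fun p => by ring⟩
  rw [monomial_nextPoint_sub hA, hE.eq_smul_hadamardQuotient (monomialChange_zero A w m) p,
    hA.isLift.eq_smul_hadamardQuotient hA.map_zero p, smul_eq_mul, smul_eq_mul]
  ring

end Monomials

namespace IsShearUpTo

variable {ℓ : ℝ} {A X Y X' Y' : ℝ × ℝ → ℝ}

theorem congr_isBigO (hℓ : 0 < ℓ) (hA : IsBoundaryDefining ℓ A) {N : ℕ}
    (h : IsShearUpTo N A X Y) (hX : (fun p => X p - X' p) =O[stripNhdsPos] fun p => p.2 ^ N)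
    (hY : (fun p => Y p - Y' p) =O[stripNhdsPos] fun p => p.2 ^ N) : IsShearUpTo N A X' Y' := by
  have hangle := hA.tendsto_prodMk_pos hℓ Prod.fst
  have hnext := tendsto_nextPoint_pos hℓ hA
  have hangle_pow := hA.pow_isBigO hℓ N
  have hnext_pow := hA.nextPoint_snd.pow_isBigO hℓ N
  have hX_angle := (hX.comp_tendsto hangle).trans hangle_pow
  have hX_next := (hX.comp_tendsto hnext).trans hnext_pow
  have hY_angle := (hY.comp_tendsto hangle).trans hangle_pow
  have hY_next := (hY.comp_tendsto hnext).trans hnext_pow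
  constructor
  · refine (((h.fst.sub hX_next).add hX_angle).add hY_angle).congr_left fun p => ?_
    simp only [Function.comp_apply]
    ring
  · refine ((h.snd.sub hY_next).add hY_angle).congr_left fun p => ?_
    simp only [Function.comp_apply]
    ring

theorem exists_sub_monomial (hℓ : 0 < ℓ) (hA : IsBoundaryDefining ℓ A) {m : ℕ}
    (h : IsShearUpTo (m + 2) A X Y) {w : ℝ → ℝ} (hw : ContDiff ℝ ∞ w)
    (hper : Function.Periodic w ℓ) :
    ∃ W : ℝ → ℝ, ContDiff ℝ ∞ W ∧ Function.Periodic W ℓ ∧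
      IsShearUpTo (m + 2) A (fun p => X p - w p.1 * p.2 ^ m)
        (fun p => Y p - W p.1 * p.2 ^ (m + 1)) := by
  obtain ⟨W, hW, hW_per, hWO⟩ := exists_monomial_nextPoint_sub_isBigO hA hw hper hℓ m
  have hW_next := monomial_nextPoint_sub_isBigO hA hW hW_per hℓ (m + 1)
  exact ⟨W, hW, hW_per,
    (h.fst.sub (hWO.mono stripNhdsPos_le)).congr_left fun p => by ring,
    (h.snd.sub (hW_next.mono stripNhdsPos_le)).congr_left fun p => by ring⟩

end IsShearUpTo

/-- The first component of a change of coordinates in Lazutkin form, lifted to the plane. -/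
def lazutkinFst (k : ℕ) (x₀ : ℝ → ℝ) (X : ℕ → ℝ → ℝ) (p : ℝ × ℝ) : ℝ :=
  x₀ p.1 + ∑ j ∈ Finset.Ico 1 k, X j p.1 * p.2 ^ (2 * j)

/-- The second component of a change of coordinates in Lazutkin form, lifted to the plane. -/
def lazutkinSnd (k : ℕ) (Y : ℕ → ℝ → ℝ) (p : ℝ × ℝ) : ℝ :=
  ∑ j ∈ Finset.range (k + 1), Y j p.1 * p.2 ^ (2 * j + 1)

/-- The functions `x₀`, `X j`, `Y j` are lifts of smooth functions on the circle `ℝ / ℓℤ`, the first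
one taking values in the circle `ℝ / bℤ`. -/
structure IsLazutkinCoeff (ℓ b : ℝ) (x₀ : ℝ → ℝ) (X Y : ℕ → ℝ → ℝ) : Prop where
  contDiff_base : ContDiff ℝ ∞ x₀
  contDiff_fst : ∀ j, ContDiff ℝ ∞ (X j)
  contDiff_snd : ∀ j, ContDiff ℝ ∞ (Y j)
  map_add_base : ∀ s, x₀ (s + ℓ) = x₀ s + b
  periodic_fst : ∀ j, Function.Periodic (X j) ℓ
  periodic_snd : ∀ j, Function.Periodic (Y j) ℓ

section LazutkinForm

variable {k : ℕ} {x₀ : ℝ → ℝ} {X Y : ℕ → ℝ → ℝ}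

theorem lazutkinFst_zero (s : ℝ) : lazutkinFst k x₀ X (s, 0) = x₀ s := by
  simp only [lazutkinFst, add_eq_left]
  refine Finset.sum_eq_zero fun j hj => ?_
  have := (Finset.mem_Ico.1 hj).1
  rw [zero_pow (by omega), mul_zero]

theorem lazutkinSnd_zero (s : ℝ) : lazutkinSnd k Y (s, 0) = 0 := by
  simp [lazutkinSnd]

theorem lazutkinFst_neg (s y : ℝ) : lazutkinFst k x₀ X (s, -y) = lazutkinFst k x₀ X (s, y) := by
  simp [lazutkinFst, pow_mul]

theorem lazutkinSnd_neg (s y : ℝ) : lazutkinSnd k Y (s, -y) = -lazutkinSnd k Y (s, y) := by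
  simp only [lazutkinSnd, (odd_two_mul_add_one _).neg_pow, mul_neg, Finset.sum_neg_distrib]

theorem lazutkinFst_succ (hk : 0 < k) (p : ℝ × ℝ) :
    lazutkinFst (k + 1) x₀ X p = lazutkinFst k x₀ X p + X k p.1 * p.2 ^ (2 * k) := by
  rw [lazutkinFst, Finset.sum_Ico_succ_top hk, lazutkinFst, add_assoc]

theorem lazutkinSnd_sub_top (W : ℝ → ℝ) (p : ℝ × ℝ) :
    lazutkinSnd k (fun j s => Y j s - if j = k then W s else 0) p =
      lazutkinSnd k Y p - W p.1 * p.2 ^ (2 * k + 1) := by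
  simp only [lazutkinSnd, sub_mul, Finset.sum_sub_distrib, ite_mul, zero_mul,
    Finset.sum_ite_eq', Finset.mem_range, Nat.lt_succ_self, if_true]

theorem derivFst_lazutkinFst (h : Differentiable ℝ (lazutkinFst k x₀ X)) (s : ℝ) :
    derivFst (lazutkinFst k x₀ X) (s, 0) = deriv x₀ s := by
  have hderiv := (hasDerivAt_derivFst (h (s, 0))).deriv
  simp only [lazutkinFst_zero] at hderiv
  exact hderiv.symm

theorem derivSnd_lazutkinFst (h : Differentiable ℝ (lazutkinFst k x₀ X)) (s : ℝ) :
    derivSnd (lazutkinFst k x₀ X) (s, 0) = 0 := by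
  have hneg := (hasDerivAt_derivSnd (h (s, -0))).scomp (0 : ℝ) (hasDerivAt_neg (0 : ℝ))
  simp only [Function.comp_def, lazutkinFst_neg, neg_zero, neg_smul, one_smul] at hneg
  exact self_eq_neg.1 ((hasDerivAt_derivSnd (h (s, 0))).unique hneg)

theorem derivSnd_lazutkinSnd (h : Differentiable ℝ (lazutkinSnd k Y)) (s : ℝ) :
    derivSnd (lazutkinSnd k Y) (s, 0) = Y 0 s := by
  refine derivSnd_eq_of_hasDerivAt (h _) ?_
  have hfactor : (fun t => lazutkinSnd k Y (s, t)) =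
      fun t => t * ∑ j ∈ Finset.range (k + 1), Y j s * t ^ (2 * j) := by
    funext t
    simp only [lazutkinSnd, Finset.mul_sum]
    exact Finset.sum_congr rfl fun j _ => by ring
  have hdiff : DifferentiableAt ℝ
      (fun t : ℝ => ∑ j ∈ Finset.range (k + 1), Y j s * t ^ (2 * j)) 0 := by fun_prop
  have hprod := (hasDerivAt_id' (0 : ℝ)).mul hdiff.hasDerivAt
  rw [one_mul, zero_mul, add_zero, Finset.sum_range_succ', Finset.sum_eq_zero fun j _ => by
    rw [zero_pow (by omega), mul_zero], mul_zero, pow_zero, mul_one, zero_add] at hprod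
  rwa [hfactor]

namespace IsLazutkinCoeff

variable {ℓ b : ℝ} (h : IsLazutkinCoeff ℓ b x₀ X Y)
include h

theorem isLift_lazutkinFst (k : ℕ) : IsLift ℓ b (lazutkinFst k x₀ X) := by
  have hx₀ := h.contDiff_base
  have hX := h.contDiff_fst
  refine ⟨?_, fun s y => ?_⟩
  · unfold lazutkinFst
    fun_prop
  · simp only [lazutkinFst, h.map_add_base, h.periodic_fst _ _, add_right_comm]

theorem isLift_lazutkinSnd (k : ℕ) : IsLift ℓ 0 (lazutkinSnd k Y) := by
  have hY := h.contDiff_snd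
  refine ⟨?_, fun s y => ?_⟩
  · unfold lazutkinSnd
    fun_prop
  · simp only [lazutkinSnd, h.periodic_snd _ _, add_zero]

theorem isStripCoord (k : ℕ) (hx₀ : ∀ s, 0 < deriv x₀ s) (hY : ∀ s, 0 < Y 0 s) :
    IsStripCoord ℓ b (lazutkinFst k x₀ X) (lazutkinSnd k Y) where
  fst := h.isLift_lazutkinFst k
  snd := ⟨h.isLift_lazutkinSnd k, lazutkinSnd_zero, fun s => by
    rw [derivSnd_lazutkinSnd (h.isLift_lazutkinSnd k).differentiable]
    exact hY s⟩
  derivFst_pos s := by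
    rw [derivFst_lazutkinFst (h.isLift_lazutkinFst k).differentiable]
    exact hx₀ s

end IsLazutkinCoeff

end LazutkinForm

/-- The coefficient of `y ^ (2 * j)` in the Taylor expansion of `f (s, y)` for `j ≠ 0`. The value
`0` at the index `j = 0`, which plays no role in a Lazutkin form, makes these coefficients periodic
also when `f` only has a circle-valued quotient. -/
def evenTaylorCoeff (f : ℝ × ℝ → ℝ) (j : ℕ) : ℝ → ℝ := if j = 0 then 0 else taylorCoeff f (2 * j)

section EvenTaylorCoeff

variable {a b : ℝ} {f : ℝ × ℝ → ℝ}

theorem evenTaylorCoeff_of_ne_zero {j : ℕ} (hj : j ≠ 0) :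
    evenTaylorCoeff f j = taylorCoeff f (2 * j) := if_neg hj

theorem contDiff_evenTaylorCoeff (hf : ContDiff ℝ ∞ f) (j : ℕ) :
    ContDiff ℝ ∞ (evenTaylorCoeff f j) := by
  unfold evenTaylorCoeff
  split_ifs
  · exact contDiff_const
  · exact contDiff_taylorCoeff hf _

theorem evenTaylorCoeff_periodic (hf : IsLift a b f) (j : ℕ) :
    Function.Periodic (evenTaylorCoeff f j) a := by
  unfold evenTaylorCoeff
  split_ifs with hj
  · exact fun _ => rfl
  · exact taylorCoeff_periodic hf (mul_ne_zero two_ne_zero hj)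

theorem lazutkinFst_evenTaylorCoeff (f : ℝ × ℝ → ℝ) (k : ℕ) (p : ℝ × ℝ) :
    lazutkinFst (k + 1) (taylorCoeff f 0) (evenTaylorCoeff f) p =
      ∑ j ∈ Finset.range (k + 1), taylorCoeff f (2 * j) p.1 * p.2 ^ (2 * j) := by
  rw [lazutkinFst, Finset.range_eq_Ico, Finset.sum_eq_sum_Ico_succ_bot k.succ_pos, mul_zero,
    pow_zero, mul_one]
  congr 1
  refine Finset.sum_congr rfl fun j hj => ?_
  rw [evenTaylorCoeff_of_ne_zero (Nat.pos_iff_ne_zero.1 (Finset.mem_Ico.1 hj).1)]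

end EvenTaylorCoeff

theorem isLazutkinCoeff_taylorCoeff {ℓ b : ℝ} {P Q : ℝ × ℝ → ℝ} (hP : IsLift ℓ b P)
    (hQ : IsLift ℓ 0 Q) (k : ℕ) {W : ℝ → ℝ} (hW : ContDiff ℝ ∞ W)
    (hW_per : Function.Periodic W ℓ) :
    IsLazutkinCoeff ℓ b (taylorCoeff P 0) (evenTaylorCoeff P)
      fun j s => taylorCoeff Q (2 * j + 1) s - if j = k then W s else 0 where
  contDiff_base := contDiff_taylorCoeff hP.smooth 0
  contDiff_fst := contDiff_evenTaylorCoeff hP.smooth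
  contDiff_snd j := by
    refine (contDiff_taylorCoeff hQ.smooth _).sub ?_
    split_ifs
    · exact hW
    · exact contDiff_const
  map_add_base s := hP.map_add s 0
  periodic_fst := evenTaylorCoeff_periodic hP
  periodic_snd j s := by
    simp only [hW_per s, taylorCoeff_periodic hQ (Nat.succ_ne_zero (2 * j)) s]

section LazutkinOfShear

variable {ℓ b : ℝ} {A P Q : ℝ × ℝ → ℝ} {k : ℕ} (hk : 0 < k) (hℓ : 0 < ℓ)
  (hPQ : IsStripCoord ℓ b P Q)
include hk hℓ hPQ

/-- The coefficient `X k` of order `2 * k` is not allowed in a Lazutkin form. It is removed at the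
expense of the top coefficient `Y k` of the second component. -/
theorem IsShearUpTo.exists_lazutkin (hA : IsBoundaryDefining ℓ A)
    (heven : (fun p => P (p.1, -p.2) - P p) =O[stripNhdsPos] (fun p => p.2 ^ (2 * k + 2)))
    (hodd : (fun p => Q (p.1, -p.2) + Q p) =O[stripNhdsPos] (fun p => p.2 ^ (2 * k + 2)))
    (h : IsShearUpTo (2 * k + 2) A P Q) :
    ∃ (x₀ : ℝ → ℝ) (X Y : ℕ → ℝ → ℝ), IsLazutkinCoeff ℓ b x₀ X Y ∧
      IsStripCoord ℓ b (lazutkinFst k x₀ X) (lazutkinSnd k Y) ∧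
      IsShearUpTo (2 * k + 2) A (lazutkinFst k x₀ X) (lazutkinSnd k Y) := by
  obtain ⟨W, hW, hW_per, hshear⟩ := h.exists_sub_monomial hℓ hA
    (contDiff_evenTaylorCoeff hPQ.fst.smooth k) (evenTaylorCoeff_periodic hPQ.fst k)
  have hcoeff := isLazutkinCoeff_taylorCoeff hPQ.fst hPQ.snd.isLift k hW hW_per
  have hx₀ : ∀ s, 0 < deriv (taylorCoeff P 0) s := fun s => by
    have hderiv : HasDerivAt (taylorCoeff P 0) _ s :=
      hasDerivAt_derivFst (hPQ.fst.differentiable (s, 0))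
    rw [hderiv.deriv]
    exact hPQ.derivFst_pos s
  have hY₀ : ∀ s, 0 < taylorCoeff Q (2 * 0 + 1) s - if 0 = k then W s else 0 := fun s => by
    rw [if_neg hk.ne, sub_zero]
    exact hadamardQuotient_pos hPQ.snd s
  refine ⟨_, _, _, hcoeff, hcoeff.isStripCoord k hx₀ hY₀, hshear.congr_isBigO hℓ hA ?_ ?_⟩
  · refine (sub_sum_even_taylorCoeff_isBigO hℓ hPQ.fst k.succ_ne_zero heven).congr_left fun p => ?_
    rw [← lazutkinFst_evenTaylorCoeff, lazutkinFst_succ hk]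
    ring
  · refine (sub_sum_odd_taylorCoeff_isBigO hℓ hPQ.snd.isLift k.succ_ne_zero hodd).congr_left
      fun p => ?_
    rw [lazutkinSnd_sub_top, lazutkinSnd]
    ring

end LazutkinOfShear

theorem circleDeriv_coe {a : ℝ} (g : AddCircle a → ℂ) (t : ℝ) :
    circleDeriv g (t : AddCircle a) = deriv (fun u : ℝ => g (u : AddCircle a)) t := by
  have := deriv_comp_const_add (fun u : ℝ => g (u : AddCircle a)) t 0
  simpa [circleDeriv] using this

theorem angle_mul_of_re_pos {τ h : ℂ} (hτ : τ ≠ 0) (hh : 0 < h.re) {d : ℝ} (hd : 0 < d) :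
    InnerProductGeometry.angle τ (d * h * τ) = |h.arg| := by
  have hne : h ≠ 0 := by rintro rfl; simp at hh
  have hmul := Complex.angle_mul_right hτ 1 (d • h)
  rw [one_mul] at hmul
  rw [← Complex.real_smul, hmul, InnerProductGeometry.angle_smul_right_of_pos _ _ hd,
    Complex.angle_one_left hne]

namespace BilliardTable

variable (B : BilliardTable)

/-- The boundary parametrization, lifted to the line. -/
def curve (t : ℝ) : ℂ := B.γ (t : AddCircle B.ℓ)

/-- The unit tangent, lifted to the line. -/
def unitTangent (t : ℝ) : ℂ := deriv B.curve t

theorem contDiff_curve : ContDiff ℝ ∞ B.curve := B.smooth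

theorem contDiff_unitTangent : ContDiff ℝ ∞ B.unitTangent :=
  (contDiff_infty_iff_deriv.1 B.contDiff_curve).2

theorem hasDerivAt_curve (t : ℝ) : HasDerivAt B.curve (B.unitTangent t) t :=
  (B.contDiff_curve.differentiable (by simp) t).hasDerivAt

theorem curve_add (t : ℝ) : B.curve (t + B.ℓ) = B.curve t := by
  simp [curve]

theorem tangent_coe (t : ℝ) : B.tangent (t : AddCircle B.ℓ) = B.unitTangent t :=
  circleDeriv_coe _ _

theorem unitTangent_add (t : ℝ) : B.unitTangent (t + B.ℓ) = B.unitTangent t := by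
  simp [← tangent_coe]

theorem norm_unitTangent (t : ℝ) : ‖B.unitTangent t‖ = 1 := by
  rw [← tangent_coe]
  exact B.unit_speed _

theorem unitTangent_ne_zero (t : ℝ) : B.unitTangent t ≠ 0 := by
  rw [← norm_pos_iff, norm_unitTangent]
  exact one_pos

theorem unitTangent_mul_conj (t : ℝ) :
    B.unitTangent t * (starRingEnd ℂ) (B.unitTangent t) = 1 := by
  rw [Complex.mul_conj, Complex.normSq_eq_norm_sq, norm_unitTangent]
  simp

theorem im_conj_unitTangent_mul_deriv_pos (t : ℝ) :
    0 < ((starRingEnd ℂ) (B.unitTangent t) * deriv B.unitTangent t).im := by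
  have hcurv := B.curvature_pos (t : AddCircle B.ℓ)
  have hlift : (fun u : ℝ => circleDeriv B.γ (u : AddCircle B.ℓ)) = B.unitTangent :=
    funext B.tangent_coe
  rw [circleDeriv_coe (circleDeriv B.γ) t, hlift] at hcurv
  rwa [← tangent_coe]

section ChordRatio

/-- The chord `γ(s + d) - γ(s)` divided by `d` and by the tangent at `s`, as a smooth function
of `(s, d)` up to `d = 0`. Its argument is the angle from the tangent to the chord. -/
def chordRatio (p : ℝ × ℝ) : ℂ :=
  hadamardQuotient (fun p : ℝ × ℝ => B.curve (p.1 + p.2)) p * (starRingEnd ℂ) (B.unitTangent p.1)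

theorem isLift_curve_add : IsLift B.ℓ (0 : ℂ) fun p : ℝ × ℝ => B.curve (p.1 + p.2) where
  smooth := B.contDiff_curve.comp (contDiff_fst.add contDiff_snd)
  map_add s y := by simp only [add_right_comm s, curve_add, add_zero]

theorem isLift_chordRatio : IsLift B.ℓ (0 : ℂ) B.chordRatio where
  smooth := B.isLift_curve_add.isLift_hadamardQuotient.smooth.mul
    (Complex.conjCLE.contDiff.comp (B.contDiff_unitTangent.comp contDiff_fst))
  map_add s y := by
    simp only [chordRatio, B.isLift_curve_add.isLift_hadamardQuotient.periodic, unitTangent_add,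
      add_zero]

theorem curve_sub_curve (s d : ℝ) :
    B.curve (s + d) - B.curve s = d * B.chordRatio (s, d) * B.unitTangent s := by
  have hfactor := eq_add_smul_hadamardQuotient (B.isLift_curve_add.smooth.of_le (by simp)) (s, d)
  simp only [add_zero, Complex.real_smul] at hfactor
  rw [hfactor, chordRatio]
  linear_combination
    (-(d : ℂ) * hadamardQuotient (fun p : ℝ × ℝ => B.curve (p.1 + p.2)) (s, d)) *
      B.unitTangent_mul_conj s

theorem derivSnd_curve_add (p : ℝ × ℝ) :
    derivSnd (fun p : ℝ × ℝ => B.curve (p.1 + p.2)) p = B.unitTangent (p.1 + p.2) :=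
  (hasDerivAt_derivSnd (B.isLift_curve_add.differentiable p)).unique
    ((B.hasDerivAt_curve (p.1 + p.2)).comp_const_add p.1 p.2)

theorem chordRatio_zero (s : ℝ) : B.chordRatio (s, 0) = 1 := by
  rw [chordRatio, hadamardQuotient_zero, derivSnd_curve_add, add_zero]
  exact B.unitTangent_mul_conj s

theorem hasDerivAt_chordRatio (s : ℝ) :
    HasDerivAt (fun d => B.chordRatio (s, d))
      (deriv B.unitTangent s / 2 * (starRingEnd ℂ) (B.unitTangent s)) 0 := by
  have hsecond : derivSnd (derivSnd fun p : ℝ × ℝ => B.curve (p.1 + p.2)) (s, 0) =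
      deriv B.unitTangent s := by
    refine (hasDerivAt_derivSnd (B.isLift_curve_add.isLift_derivSnd.differentiable _)).unique ?_
    simp only [derivSnd_curve_add]
    simpa using
      (B.contDiff_unitTangent.differentiable (by simp) (s + 0)).hasDerivAt.comp_const_add s 0
  have hquot := hasDerivAt_derivSnd
    (B.isLift_curve_add.isLift_hadamardQuotient.differentiable (s, 0))
  have hhalf : deriv B.unitTangent s / 2 =
      derivSnd (hadamardQuotient fun p : ℝ × ℝ => B.curve (p.1 + p.2)) (s, 0) := by
    rw [← hsecond, derivSnd_derivSnd_zero B.isLift_curve_add.smooth, Complex.real_smul]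
    push_cast
    ring
  rw [hhalf]
  exact hquot.mul_const ((starRingEnd ℂ) (B.unitTangent s))

theorem eventually_re_chordRatio_pos : ∀ᶠ p in stripNhds, 0 < (B.chordRatio p).re := by
  obtain ⟨m, hm, hle⟩ := exists_pos_le_of_periodic B.length_pos
    (Complex.continuous_re.comp B.isLift_chordRatio.smooth.continuous)
    (fun s y => by simp [B.isLift_chordRatio.periodic]) (fun s => by simp [chordRatio_zero])
  exact hle.mono fun p hp => hm.trans_le hp

theorem contDiffAt_arg_chordRatio {p : ℝ × ℝ} (hp : 0 < (B.chordRatio p).re) :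
    ContDiffAt ℝ ∞ (fun p => (B.chordRatio p).arg) p := by
  have hlog : ContDiffAt ℝ ∞ Complex.log (B.chordRatio p) :=
    (Complex.contDiffAt_log (n := ∞) (Or.inl hp)).restrict_scalars ℝ
  simpa only [Function.comp_def, Complex.imCLM_apply, Complex.log_im] using
    Complex.imCLM.contDiff.contDiffAt.comp p
    (hlog.comp p B.isLift_chordRatio.smooth.contDiffAt)

theorem hasDerivAt_arg_chordRatio (s : ℝ) :
    HasDerivAt (fun d => (B.chordRatio (s, d)).arg)
      (((starRingEnd ℂ) (B.unitTangent s) * deriv B.unitTangent s).im / 2) 0 := by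
  have hlog := (B.hasDerivAt_chordRatio s).clog_real (by rw [chordRatio_zero]; exact Or.inl one_pos)
  have him := Complex.imCLM.hasFDerivAt.comp_hasDerivAt (0 : ℝ) hlog
  simp only [Function.comp_def, Complex.imCLM_apply, Complex.log_im] at him
  have hhalf : deriv B.unitTangent s / 2 * (starRingEnd ℂ) (B.unitTangent s) =
      ((1 / 2 : ℝ) : ℂ) * ((starRingEnd ℂ) (B.unitTangent s) * deriv B.unitTangent s) := by
    push_cast
    ring
  rw [chordRatio_zero, div_one, hhalf, Complex.im_ofReal_mul,
    one_div_mul_eq_div] at him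
  exact him

theorem exists_chordAngle : ∃ A, IsBoundaryDefining B.ℓ A ∧
    ∀ᶠ p in stripNhds, A p = (B.chordRatio p).arg := by
  obtain ⟨A, hA, heq⟩ := exists_isLift_eventuallyEq (b := 0) B.length_pos
    (B.eventually_re_chordRatio_pos.mono fun _ hp => B.contDiffAt_arg_chordRatio hp)
    (Eventually.of_forall fun p => by rw [B.isLift_chordRatio.periodic, add_zero])
  have hzero (s) : A (s, 0) = 0 := by
    simpa [chordRatio_zero] using (heq.filter_mono (nhds_le_stripNhds s)).self_of_nhds
  refine ⟨A, ⟨hA, hzero, fun s => ?_⟩, heq⟩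
  have hderiv := (B.hasDerivAt_arg_chordRatio s).congr_of_eventuallyEq (f₁ := fun t => A (s, t))
    ((tendsto_prodMk_nhds_zero_stripNhds s).eventually heq)
  rw [derivSnd_eq_of_hasDerivAt (hA.differentiable _) hderiv]
  exact half_pos (B.im_conj_unitTangent_mul_deriv_pos s)

end ChordRatio

section NextCollision

theorem curve_mem_frontier (t : ℝ) : B.curve t ∈ frontier B.Ω :=
  B.range_eq ▸ mem_range_self _

theorem exists_curve_eq {z : ℂ} (hz : z ∈ frontier B.Ω) : ∃ t, B.curve t = z := by
  obtain ⟨q, hq⟩ := B.range_eq ▸ hz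
  obtain ⟨t, rfl⟩ := QuotientAddGroup.mk_surjective q
  exact ⟨t, hq⟩

theorem nonempty : B.Ω.Nonempty := by
  rw [nonempty_iff_ne_empty]
  intro hempty
  have := B.curve_mem_frontier 0
  simp [hempty] at this

theorem exists_supporting {z : ℂ} (hz : z ∈ frontier B.Ω) :
    ∃ f : ℂ →L[ℝ] ℝ, f ≠ 0 ∧ ∀ t, f (B.curve t) ≤ f z := by
  have hz' : z ∉ B.Ω := by
    rw [B.isOpen.frontier_eq] at hz
    exact hz.2
  obtain ⟨f, hf⟩ := geometric_hahn_banach_open_point B.convex B.isOpen hz'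
  refine ⟨f, ?_, fun t => ?_⟩
  · rintro rfl
    obtain ⟨w, hw⟩ := B.nonempty
    simpa using hf w hw
  · exact closure_minimal (fun w hw => (hf w hw).le)
      (isClosed_le f.continuous continuous_const)
      (frontier_subset_closure (B.curve_mem_frontier t))

theorem eq_zero_of_supporting {f : ℂ →L[ℝ] ℝ} {s φ : ℝ} (hφ : φ ∈ Ioo 0 Real.pi)
    (hmax : ∀ t, f (B.curve t) ≤ f (B.curve s))
    (hw : f (Complex.exp (φ * Complex.I) * B.unitTangent s) = 0) : f = 0 := by
  have htangent : f (B.unitTangent s) = 0 :=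
    IsLocalMax.hasDerivAt_eq_zero (f := fun t => f (B.curve t)) (Eventually.of_forall hmax)
      (f.hasFDerivAt.comp_hasDerivAt s (B.hasDerivAt_curve s))
  have hnormal : f (Complex.I * B.unitTangent s) = 0 := by
    have hdecomp : Complex.exp (φ * Complex.I) * B.unitTangent s =
        Real.cos φ • B.unitTangent s + Real.sin φ • (Complex.I * B.unitTangent s) := by
      rw [Complex.exp_mul_I, Complex.real_smul, Complex.real_smul]
      push_cast
      ring
    rw [hdecomp, map_add, map_smul, map_smul, htangent, smul_zero, zero_add, smul_eq_mul] at hw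
    exact (mul_eq_zero.1 hw).resolve_left (Real.sin_pos_of_mem_Ioo hφ).ne'
  ext z
  have hdecomp : z = (z / B.unitTangent s).re • B.unitTangent s +
      (z / B.unitTangent s).im • (Complex.I * B.unitTangent s) := by
    rw [Complex.real_smul, Complex.real_smul, ← mul_assoc, ← add_mul, Complex.re_add_im,
      div_mul_cancel₀ _ (B.unitTangent_ne_zero s)]
  rw [hdecomp, map_add, map_smul, map_smul, htangent, hnormal]
  simp

theorem not_lt_of_ray_mem_frontier {s φ r₁ r₂ : ℝ} (hφ : φ ∈ Ioo 0 Real.pi) (hr₁ : 0 < r₁)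
    (h₁ : B.curve s + r₁ * (Complex.exp (φ * Complex.I) * B.unitTangent s) ∈ frontier B.Ω)
    (h₂ : B.curve s + r₂ * (Complex.exp (φ * Complex.I) * B.unitTangent s) ∈ frontier B.Ω) :
    ¬ r₁ < r₂ := by
  -- A supporting line at the middle point of three aligned boundary points contains them all,
  -- so it would also be tangent to the boundary at `γ(s)`.
  intro hlt
  set w := Complex.exp (φ * Complex.I) * B.unitTangent s
  obtain ⟨f, hf_ne, hf⟩ := B.exists_supporting h₁
  have hray (r : ℝ) : f (B.curve s + r * w) = f (B.curve s) + r * f w := by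
    rw [map_add, ← Complex.real_smul, map_smul, smul_eq_mul]
  obtain ⟨t, ht⟩ := B.exists_curve_eq h₂
  have hstart := hf s
  have hfar := hf t
  rw [ht, hray, hray] at hfar
  rw [hray] at hstart
  have hw : f w = 0 := by
    have hnonneg : 0 ≤ f w := nonneg_of_mul_nonneg_right (by linarith) hr₁
    have hnonpos : f w ≤ 0 := nonpos_of_mul_nonpos_right (by linarith) (sub_pos.2 hlt)
    exact le_antisymm hnonpos hnonneg
  refine hf_ne (B.eq_zero_of_supporting hφ (fun t => ?_) hw)
  simpa only [hray, hw, mul_zero, add_zero] using hf t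

variable {B} in
theorem IsNextCollision.eq {p q₁ q₂ : AddCircle B.ℓ × ℝ} (hp : p.2 ∈ Ioo 0 Real.pi)
    (h₁ : B.IsNextCollision p q₁) (h₂ : B.IsNextCollision p q₂) : q₁ = q₂ := by
  obtain ⟨s, hs⟩ := QuotientAddGroup.mk_surjective p.1
  have hray : ∀ q, B.IsNextCollision p q → (∃ r : ℝ, 0 < r ∧
      B.γ q.1 = B.curve s + r * (Complex.exp (p.2 * Complex.I) * B.unitTangent s)) ∧
      q.2 = InnerProductGeometry.angle (B.tangent q.1) (B.γ q.1 - B.γ p.1) := by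
    rintro q (⟨h | h, -⟩ | ⟨-, ⟨r, hr, hq⟩, hangle⟩)
    · exact absurd h hp.1.ne'
    · exact absurd h hp.2.ne
    · refine ⟨⟨r, hr, ?_⟩, hangle⟩
      rw [hq, ← tangent_coe, mul_assoc, ← hs]
      rfl
  obtain ⟨⟨r₁, hr₁, hq₁⟩, hangle₁⟩ := hray _ h₁
  obtain ⟨⟨r₂, hr₂, hq₂⟩, hangle₂⟩ := hray _ h₂
  have hmem (x) : B.γ x ∈ frontier B.Ω := B.range_eq ▸ mem_range_self _
  have hr : r₁ = r₂ := le_antisymm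
    (not_lt.1 (B.not_lt_of_ray_mem_frontier hp hr₂ (hq₂ ▸ hmem _) (hq₁ ▸ hmem _)))
    (not_lt.1 (B.not_lt_of_ray_mem_frontier hp hr₁ (hq₁ ▸ hmem _) (hq₂ ▸ hmem _)))
  have hfst : q₁.1 = q₂.1 := B.injective (by rw [hq₁, hq₂, hr])
  exact Prod.ext hfst (by rw [hangle₁, hangle₂, hfst])

variable {B} in
theorem IsNextCollision.billiardMap_eq {p q : AddCircle B.ℓ × ℝ} (hp : p.2 ∈ Ioo 0 Real.pi)
    (h : B.IsNextCollision p q) : B.billiardMap p = q :=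
  IsNextCollision.eq hp (Classical.epsilon_spec (p := B.IsNextCollision p) ⟨q, h⟩) h

theorem billiardMap_zero (x : AddCircle B.ℓ) : B.billiardMap (x, 0) = (x, 0) := by
  have hnext : B.IsNextCollision (x, 0) (B.billiardMap (x, 0)) :=
    Classical.epsilon_spec (p := B.IsNextCollision (x, 0)) ⟨(x, 0), Or.inl ⟨Or.inl rfl, rfl⟩⟩
  rcases hnext with ⟨-, heq⟩ | ⟨hmem, -⟩
  · exact heq
  · exact absurd hmem.1 (lt_irrefl _)

end NextCollision

section HasChordAngle

/-- `A(s, d)` is, for small `d`, the signed angle from the tangent at `γ(s)` to the chord from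
`γ(s)` to `γ(s + d)`, and it generates the billiard map near the boundary of the phase space. -/
structure HasChordAngle (A : ℝ × ℝ → ℝ) : Prop where
  isBoundaryDefining : IsBoundaryDefining B.ℓ A
  curve_ne : ∀ᶠ p in stripNhds, p.2 ≠ 0 → B.curve (p.1 + p.2) ≠ B.curve p.1
  angle_pos : ∀ᶠ p in stripNhds, 0 < p.2 → InnerProductGeometry.angle (B.unitTangent p.1)
      (B.curve (p.1 + p.2) - B.curve p.1) = A p
  angle_neg : ∀ᶠ p in stripNhds, p.2 < 0 → InnerProductGeometry.angle (-B.unitTangent p.1)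
      (B.curve (p.1 + p.2) - B.curve p.1) = -A p
  billiardMap_eq : ∀ᶠ p in stripNhdsPos, B.billiardMap (cylinderCover B.ℓ (p.1, A p)) =
      cylinderCover B.ℓ (nextPoint A p)

theorem eventually_curve_ne :
    ∀ᶠ p in stripNhds, p.2 ≠ 0 → B.curve (p.1 + p.2) ≠ B.curve p.1 := by
  filter_upwards [B.eventually_re_chordRatio_pos] with p hre hp
  have hratio : B.chordRatio p ≠ 0 := fun h => by simp [h] at hre
  rw [← sub_ne_zero, curve_sub_curve]
  exact mul_ne_zero (mul_ne_zero (mod_cast hp) hratio) (B.unitTangent_ne_zero _)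

theorem angle_unitTangent_chord {p : ℝ × ℝ} (hre : 0 < (B.chordRatio p).re) (hp : 0 < p.2) :
    InnerProductGeometry.angle (B.unitTangent p.1) (B.curve (p.1 + p.2) - B.curve p.1) =
      |(B.chordRatio p).arg| := by
  rw [curve_sub_curve, angle_mul_of_re_pos (B.unitTangent_ne_zero _) hre hp]

theorem angle_neg_unitTangent_chord {p : ℝ × ℝ} (hre : 0 < (B.chordRatio p).re) (hp : p.2 < 0) :
    InnerProductGeometry.angle (-B.unitTangent p.1) (B.curve (p.1 + p.2) - B.curve p.1) =
      |(B.chordRatio p).arg| := by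
  have hchord : B.curve (p.1 + p.2) - B.curve p.1 =
      ((-p.2 : ℝ) : ℂ) * B.chordRatio p * (-B.unitTangent p.1) := by
    rw [curve_sub_curve]
    push_cast
    ring
  rw [hchord, angle_mul_of_re_pos (neg_ne_zero.2 (B.unitTangent_ne_zero _)) hre (neg_pos.2 hp)]

theorem isNextCollision_chord {s d : ℝ} (hd : 0 < d) (hratio : B.chordRatio (s, d) ≠ 0)
    (harg : (B.chordRatio (s, d)).arg ∈ Ioo 0 Real.pi) :
    B.IsNextCollision (cylinderCover B.ℓ (s, (B.chordRatio (s, d)).arg))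
      (cylinderCover B.ℓ (s + d, InnerProductGeometry.angle (-B.unitTangent (s + d))
        (B.curve s - B.curve (s + d)))) := by
  refine Or.inr ⟨harg, ⟨d * ‖B.chordRatio (s, d)‖, by positivity, ?_⟩, ?_⟩
  · change B.curve (s + d) = B.curve s + _
    rw [← sub_eq_iff_eq_add', curve_sub_curve]
    simp only [cylinderCover, tangent_coe]
    conv_lhs => rw [← Complex.norm_mul_exp_arg_mul_I (B.chordRatio (s, d))]
    push_cast
    ring
  · simp only [cylinderCover, tangent_coe]
    change _ = InnerProductGeometry.angle _ (B.curve (s + d) - B.curve s)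
    rw [← InnerProductGeometry.angle_neg_neg, neg_neg, neg_sub]

theorem exists_hasChordAngle : ∃ A, B.HasChordAngle A := by
  obtain ⟨A, hA, harg⟩ := B.exists_chordAngle
  have hquot : ∀ᶠ p in stripNhds, 0 < hadamardQuotient A p := by
    obtain ⟨m, hm, hle⟩ := exists_pos_le_of_periodic B.length_pos
      hA.isLift.isLift_hadamardQuotient.smooth.continuous
      hA.isLift.isLift_hadamardQuotient.periodic (hadamardQuotient_pos hA)
    exact hle.mono fun p hp => hm.trans_le hp
  have hneg : ∀ᶠ p in stripNhds, p.2 < 0 → InnerProductGeometry.angle (-B.unitTangent p.1)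
      (B.curve (p.1 + p.2) - B.curve p.1) = -A p := by
    filter_upwards [B.eventually_re_chordRatio_pos, harg, hquot] with p hre harg hquot hp
    rw [B.angle_neg_unitTangent_chord hre hp, ← harg, abs_of_nonpos]
    rw [hA.isLift.eq_smul_hadamardQuotient hA.map_zero]
    exact (mul_neg_of_neg_of_pos hp hquot).le
  refine ⟨A, hA, B.eventually_curve_ne, ?_, hneg, ?_⟩
  · filter_upwards [B.eventually_re_chordRatio_pos, harg, hquot] with p hre harg hquot hp
    rw [B.angle_unitTangent_chord hre hp, ← harg, abs_of_nonneg]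
    rw [hA.isLift.eq_smul_hadamardQuotient hA.map_zero]
    exact (mul_pos hp hquot).le
  · have hlim := tendsto_stripNhdsPos_iff.1 (hA.tendsto_prodMk_pos B.length_pos Prod.fst)
    have hback := (tendsto_prodMk_neg_stripNhds fun p => p.1 + p.2).eventually hneg
    filter_upwards [stripNhdsPos_le harg, stripNhdsPos_le B.eventually_re_chordRatio_pos, hlim.2,
      hlim.1.eventually_lt_const Real.pi_pos, stripNhdsPos_le hback, eventually_stripNhdsPos_pos]
      with p harg hre hApos hAlt hback hp
    have hratio : B.chordRatio p ≠ 0 := fun h => by simp [h] at hre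
    have hnext := B.isNextCollision_chord hp hratio (harg ▸ ⟨hApos, hAlt⟩)
    have hangle := hback (neg_lt_zero.2 hp)
    rw [add_neg_cancel_right] at hangle
    rw [hangle, show (p.1, p.2) = p from rfl, ← harg] at hnext
    exact hnext.billiardMap_eq ⟨hApos, hAlt⟩

end HasChordAngle

end BilliardTable

section CircleLift

theorem contDiffAt_of_comp_curve {E F : Type*} [NormedAddCommGroup E] [NormedSpace ℝ E]
    [NormedAddCommGroup F] [NormedSpace ℝ F] {σ : E → ℝ} {c : ℝ → F} {x : E}
    (hσ : ContinuousAt σ x) (hc : ContDiffAt ℝ ∞ c (σ x)) (hc' : deriv c (σ x) ≠ 0)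
    (h : ContDiffAt ℝ ∞ (fun y => c (σ y)) x) : ContDiffAt ℝ ∞ σ x := by
  obtain ⟨L, hL⟩ := SeparatingDual.exists_ne_zero (R := ℝ) hc'
  have hLc : ContDiffAt ℝ ∞ (fun t => L (c t)) (σ x) := L.contDiff.contDiffAt.comp _ hc
  have hderiv : HasDerivAt (fun t => L (c t)) (L (deriv c (σ x))) (σ x) :=
    L.hasFDerivAt.comp_hasDerivAt _ (hc.differentiableAt (by simp)).hasDerivAt
  have hequiv := hderiv.hasFDerivAt_equiv hL
  have hleft := (hLc.hasStrictFDerivAt' hequiv (by simp)).eventually_left_inverse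
  have hcomp : ContDiffAt ℝ ∞ (fun y => L (c (σ y))) x := L.contDiff.contDiffAt.comp x h
  refine ((hLc.to_localInverse hequiv (by simp)).comp x hcomp).congr_of_eventuallyEq ?_
  filter_upwards [hσ.eventually hleft] with y hy
  exact hy.symm

theorem exists_continuous_lift {E : Type*} [TopologicalSpace E] [SimplyConnectedSpace E]
    [LocallyPathConnectedSpace E] {a : ℝ} {F : E → AddCircle a} (hF : Continuous F) :
    ∃ f : E → ℝ, Continuous f ∧ ∀ x, (f x : AddCircle a) = F x := by
  obtain ⟨x₀⟩ : Nonempty E := inferInstance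
  obtain ⟨t, ht⟩ := QuotientAddGroup.mk_surjective (F x₀)
  obtain ⟨f, ⟨-, hf⟩, -⟩ := (AddCircle.isCoveringMap_coe a).existsUnique_continuousMap_lifts
    ⟨F, hF⟩ x₀ t ht
  exact ⟨f, f.continuous, congrFun hf⟩

theorem exists_int_mul_of_coe_eq {E : Type*} [TopologicalSpace E] [PreconnectedSpace E]
    [Nonempty E] {b : ℝ} {f g : E → ℝ} (hf : Continuous f) (hg : Continuous g)
    (h : ∀ x, (g x : AddCircle b) = (f x : AddCircle b)) : ∃ n : ℤ, ∀ x, g x = f x + n * b := by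
  obtain ⟨x₀⟩ := ‹Nonempty E›
  have hsub : ∀ x, ((g x - f x : ℝ) : AddCircle b) = 0 := fun x => by
    rw [AddCircle.coe_sub, h, sub_self]
  obtain ⟨n, hn⟩ := (AddCircle.coe_eq_zero_iff b).1 (hsub x₀)
  refine ⟨n, fun x => ?_⟩
  have hconst := (AddCircle.isCoveringMap_coe b).const_of_comp (hg.sub hf)
    (fun x y => (hsub x).trans (hsub y).symm) x x₀
  simp only [Pi.sub_apply] at hconst
  rw [← sub_eq_iff_eq_add', hconst, ← hn, zsmul_eq_mul]

theorem eq_one_of_injective_quotient {a b : ℝ} (ha : 0 < a) (hb : 0 < b) {f : ℝ → ℝ}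
    (hf : Continuous f) (hmono : StrictMono f) {n : ℤ} (hn : ∀ t, f (t + a) = f t + n * b)
    (hinj : ∀ s t : ℝ, (f s : AddCircle b) = (f t : AddCircle b) →
      (s : AddCircle a) = (t : AddCircle a)) : n = 1 := by
  have hn₀ := hn 0
  rw [zero_add] at hn₀
  have hn_pos : (0 : ℝ) < n := by
    have := hmono ha
    exact pos_of_mul_pos_left (by linarith) hb.le
  by_contra hne
  have hn_two : (2 : ℝ) ≤ n := by
    have : 0 < n := by exact_mod_cast hn_pos
    exact_mod_cast (by omega : 2 ≤ n)
  obtain ⟨t, ht, htb⟩ : f 0 + b ∈ f '' Ioo 0 a :=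
    intermediate_value_Ioo ha.le hf.continuousOn ⟨by linarith, by nlinarith⟩
  have : Fact (0 < a) := ⟨ha⟩
  refine ht.1.ne' ((AddCircle.coe_eq_coe_iff_of_mem_Ico (a := 0) ?_ ?_).1 (hinj t 0 ?_))
  · rw [zero_add]
    exact Ioo_subset_Ico_self ht
  · rw [zero_add]
    exact left_mem_Ico.2 ha
  · rw [htb, AddCircle.coe_add_period]

theorem toCircle_coe (a t : ℝ) :
    ((AddCircle.toCircle (t : AddCircle a) : Circle) : ℂ) =
      Complex.exp ((2 * Real.pi / a * t : ℝ) * Complex.I) := by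
  rw [AddCircle.toCircle_apply_mk, Circle.coe_exp]

theorem deriv_exp_mul_I_ne_zero {c : ℝ} (hc : c ≠ 0) (t : ℝ) :
    deriv (fun u : ℝ => Complex.exp ((c * u : ℝ) * Complex.I)) t ≠ 0 := by
  have hlin : HasDerivAt (fun u : ℝ => c * u) c t := by
    simpa using (hasDerivAt_id t).const_mul c
  rw [(hlin.ofReal_comp.mul_const Complex.I).cexp.deriv]
  refine mul_ne_zero (Complex.exp_ne_zero _) (mul_ne_zero ?_ Complex.I_ne_zero)
  exact Complex.ofReal_ne_zero.2 hc

theorem contDiff_exp_mul_I (c : ℝ) :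
    ContDiff ℝ ∞ fun u : ℝ => Complex.exp ((c * u : ℝ) * Complex.I) :=
  ((Complex.ofRealCLM.contDiff.comp (contDiff_const.mul contDiff_id)).mul contDiff_const).cexp

section SmoothToCircle

variable {E : Type*} [NormedAddCommGroup E] [NormedSpace ℝ E] {a : ℝ}

theorem SmoothToCircleOn.continuousOn (ha : a ≠ 0) {F : E → AddCircle a} {S : Set E}
    (hF : SmoothToCircleOn F S) : ContinuousOn F S := by
  have hcircle : ContinuousOn (fun x => AddCircle.toCircle (F x)) S :=
    Topology.IsInducing.subtypeVal.continuousOn_iff.2 (ContDiffOn.continuousOn hF)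
  refine ((AddCircle.homeomorphCircle ha).symm.continuous.comp_continuousOn
    hcircle).congr fun x _ => ?_
  rw [Function.comp, eq_comm, Homeomorph.symm_apply_eq, AddCircle.homeomorphCircle_apply]

theorem smoothToCircleOn_coe (a : ℝ) {f : E → ℝ} {S : Set E} (hf : ContDiffOn ℝ ∞ f S) :
    SmoothToCircleOn (fun x => (f x : AddCircle a)) S := by
  simp only [SmoothToCircleOn, toCircle_coe]
  exact (contDiff_exp_mul_I _).comp_contDiffOn hf

end SmoothToCircle

theorem SmoothToCircleOn.exists_contDiff_lift {a : ℝ} (ha : a ≠ 0) {F : ℝ → AddCircle a}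
    (hF : SmoothToCircleOn F univ) :
    ∃ f : ℝ → ℝ, ContDiff ℝ ∞ f ∧ ∀ t, (f t : AddCircle a) = F t := by
  obtain ⟨f, hf, hfF⟩ := exists_continuous_lift (continuousOn_univ.1 (hF.continuousOn ha))
  refine ⟨f, contDiff_iff_contDiffAt.2 fun t => ?_, hfF⟩
  refine contDiffAt_of_comp_curve hf.continuousAt (contDiff_exp_mul_I _).contDiffAt
    (deriv_exp_mul_I_ne_zero (div_ne_zero Real.two_pi_pos.ne' ha) _) ?_
  simp only [← toCircle_coe, hfF]
  exact (contDiffOn_univ.1 hF).contDiffAt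

end CircleLift

section Cylinder

theorem continuous_cylinderCover (a : ℝ) : Continuous (cylinderCover a) :=
  ((AddCircle.continuous_mk' a).comp continuous_fst).prodMk continuous_snd

theorem cylinderCover_add (a s y : ℝ) : cylinderCover a (s + a, y) = cylinderCover a (s, y) := by
  rw [cylinderCover, cylinderCover, AddCircle.coe_add_period]

theorem IsBoundaryNhd.eventually_mem {a : ℝ} (ha : 0 < a) {I : Set ℝ}
    {U : Set (AddCircle a × ℝ)} (hU : IsBoundaryNhd I U) :
    ∀ᶠ p in stripNhds, p.2 ∈ I → cylinderCover a p ∈ U := by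
  obtain ⟨⟨W, hW, rfl⟩, hzero⟩ := hU
  have hmem : ∀ᶠ p in stripNhds, cylinderCover a p ∈ W := by
    refine eventually_stripNhds_of_periodic ha (fun s y => by rw [cylinderCover_add]) fun s => ?_
    exact (hW.preimage (continuous_cylinderCover a)).mem_nhds (hzero s).1
  filter_upwards [hmem] with p hp hI
  exact ⟨hp, mem_univ _, hI⟩

theorem IsBoundaryNhd.eventually_mem_pos {a : ℝ} (ha : 0 < a) {I : Set ℝ} (hI : I ∈ 𝓝[>] (0 : ℝ))
    {U : Set (AddCircle a × ℝ)} (hU : IsBoundaryNhd I U) :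
    ∀ᶠ p in stripNhdsPos, cylinderCover a p ∈ U := by
  filter_upwards [stripNhdsPos_le (hU.eventually_mem ha), preimage_mem_comap hI] with p hp hpI
  exact hp hpI

theorem IsBoundaryNhd.snd_mem {a : ℝ} {I : Set ℝ} {U : Set (AddCircle a × ℝ)}
    (hU : IsBoundaryNhd I U) {p : AddCircle a × ℝ} (hp : p ∈ U) : p.2 ∈ I := by
  obtain ⟨⟨W, -, rfl⟩, -⟩ := hU
  exact hp.2.2

end Cylinder

section BoundaryDerivative

variable {F H : ℝ × ℝ → ℝ} {s : ℝ}

theorem derivSnd_nonneg_of_nonneg (hH : DifferentiableAt ℝ H (s, 0)) (hzero : H (s, 0) = 0)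
    (h : ∀ᶠ t in 𝓝[>] 0, 0 ≤ H (s, t)) : 0 ≤ derivSnd H (s, 0) := by
  have hslope := (hasDerivAt_derivSnd hH).hasDerivWithinAt (s := Ioi 0)
  rw [hasDerivWithinAt_iff_tendsto_slope' self_notMem_Ioi] at hslope
  refine ge_of_tendsto hslope ?_
  filter_upwards [h, self_mem_nhdsWithin] with t ht (htpos : 0 < t)
  rw [slope_def_field, hzero, sub_zero, sub_zero]
  positivity

theorem derivSnd_ne_zero_of_leftInverse {g : ℝ × ℝ → ℝ} {V : Set (ℝ × ℝ)} {r : ℝ} (hr : 0 < r)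
    (hF : DifferentiableAt ℝ F (s, 0)) (hH : DifferentiableAt ℝ H (s, 0))
    (hF' : derivSnd F (s, 0) = 0) (hg : DifferentiableOn ℝ g V)
    (hV : ∀ t ∈ Ico 0 r, (F (s, t), H (s, t)) ∈ V)
    (hleft : ∀ t ∈ Ico 0 r, g (F (s, t), H (s, t)) = t) : derivSnd H (s, 0) ≠ 0 := by
  intro hH'
  have hcurve := (hasDerivAt_derivSnd hF).prodMk (hasDerivAt_derivSnd hH)
  rw [hF', hH'] at hcurve
  have hzero : (0 : ℝ) ∈ Ico 0 r := left_mem_Ico.2 hr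
  have hcomp := ((hg _ (hV 0 hzero)).hasFDerivWithinAt.comp_hasDerivWithinAt (0 : ℝ)
    hcurve.hasDerivWithinAt hV).congr (fun t ht => (hleft t ht).symm) (hleft 0 hzero).symm
  have heq := (uniqueDiffOn_Ico 0 r 0 hzero).eq_deriv _ hcomp (hasDerivWithinAt_id 0 _)
  rw [Prod.mk_zero_zero, _root_.map_zero] at heq
  exact zero_ne_one heq

theorem IsCylinderDiffeo.derivSnd_pos {a b c ε : ℝ} (ha : 0 < a) (hc : 0 < c)
    (hF : ∀ p, DifferentiableAt ℝ F p) (hH : ∀ p, DifferentiableAt ℝ H p)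
    (hzero : ∀ s, H (s, 0) = 0) (hF' : ∀ s, derivSnd F (s, 0) = 0)
    {Ψ : AddCircle a × ℝ → AddCircle b × ℝ}
    (hΨ : ∀ p, Ψ (cylinderCover a p) = cylinderCover b (F p, H p))
    {U : Set (AddCircle a × ℝ)} {V : Set (AddCircle b × ℝ)}
    (hU : IsBoundaryNhd (Icc 0 c) U) (hV : IsBoundaryNhd (Ico 0 ε) V)
    (h : IsCylinderDiffeo Ψ U V) (s : ℝ) : 0 < derivSnd H (s, 0) := by
  obtain ⟨hbij, -, G, hG, -, hGsmooth⟩ := h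
  obtain ⟨δ, hδ, hδU⟩ := eventually_stripNhds_iff.1 (hU.eventually_mem ha)
  have hmem : ∀ t ∈ Ico 0 (min δ c), cylinderCover a (s, t) ∈ U := fun t ht => by
    obtain ⟨htδ, htc⟩ := lt_min_iff.1 ht.2
    exact hδU s t (by rwa [abs_of_nonneg ht.1]) ⟨ht.1, htc.le⟩
  have hmaps : ∀ t ∈ Ico 0 (min δ c), cylinderCover b (F (s, t), H (s, t)) ∈ V := fun t ht => by
    rw [← hΨ]
    exact hbij.1 (hmem t ht)
  have hr : 0 < min δ c := lt_min hδ hc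
  refine lt_of_le_of_ne ?_ (Ne.symm ?_)
  · refine derivSnd_nonneg_of_nonneg (hH _) (hzero s) ?_
    filter_upwards [Ioo_mem_nhdsGT hr] with t ht
    exact (hV.snd_mem (hmaps t (Ioo_subset_Ico_self ht))).1
  · refine derivSnd_ne_zero_of_leftInverse hr (hF _) (hH _) (hF' s)
      (hGsmooth.differentiableOn (by simp)) hmaps fun t ht => ?_
    rw [← hΨ, hG.1 (hmem t ht)]
    rfl

theorem eq_zero_of_hasDerivAt_of_isBigO_pow {r : ℝ → ℝ} {c : ℝ} (h : HasDerivAt r c 0)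
    (hzero : r 0 = 0) {N : ℕ} (hN : 1 < N) (hO : r =O[𝓝[>] 0] fun t => t ^ N) : c = 0 := by
  have hflat : HasDerivWithinAt r 0 (Ioi 0) 0 := by
    rw [hasDerivWithinAt_iff_isLittleO]
    simpa [hzero] using hO.trans_isLittleO ((isLittleO_pow_id hN).mono nhdsWithin_le_nhds)
  exact (uniqueDiffWithinAt_Ioi 0).eq_deriv _ h.hasDerivWithinAt hflat

theorem IsShearUpTo.derivFst_eq {ℓ : ℝ} {A : ℝ × ℝ → ℝ} {N : ℕ} (hN : 1 < N)
    (hA : IsBoundaryDefining ℓ A) (hF : Differentiable ℝ F) (hH : Differentiable ℝ H)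
    (hzero : ∀ s, H (s, 0) = 0) (hF' : ∀ s, derivSnd F (s, 0) = 0) (h : IsShearUpTo N A F H)
    (s : ℝ) :
    derivFst F (s, 0) = derivSnd A (s, 0) * derivSnd H (s, 0) := by
  have hbase : HasDerivAt (fun t : ℝ => s + t) 1 0 := (hasDerivAt_id (0 : ℝ)).const_add s
  have hnext := hasDerivAt_derivSnd (hA.nextPoint_snd.isLift.differentiable (s, 0))
  have hangle := hasDerivAt_derivSnd (hA.isLift.differentiable (s, 0))
  have hfiber : Tendsto (fun t : ℝ => (s, t)) (𝓝[>] 0) stripNhdsPos :=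
    tendsto_comap_iff.2 tendsto_id
  have hdefect := ((hasDerivAt_comp_prodMk (hF _) hbase hnext).sub
    (hasDerivAt_comp_prodMk (hF _) (hasDerivAt_const (0 : ℝ) s) hangle)).sub
    (hasDerivAt_comp_prodMk (hH _) (hasDerivAt_const (0 : ℝ) s) hangle)
  have hderiv := eq_zero_of_hasDerivAt_of_isBigO_pow hdefect
    (by simp [hA.map_zero, nextPoint, hzero]) hN
    (h.fst.comp_tendsto hfiber)
  simp only [add_zero, hA.map_zero, hA.nextPoint_snd.map_zero, hF', smul_eq_mul] at hderiv
  linarith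

end BoundaryDerivative

theorem isLift_sub_comp_nextPoint {ℓ b : ℝ} {A F G : ℝ × ℝ → ℝ} (hA : IsBoundaryDefining ℓ A)
    (hF : IsLift ℓ b F) (hG : IsLift ℓ 0 G) :
    IsLift ℓ 0 (fun p => F (nextPoint A p) - F (p.1, A p) - G (p.1, A p)) := by
  have hF_smooth := hF.smooth
  have hG_smooth := hG.smooth
  have hA_smooth := hA.isLift.smooth
  have hnext := hA.nextPoint_snd.isLift
  have hnext_smooth := hnext.smooth
  refine ⟨?_, fun s y => ?_⟩
  · simp only [nextPoint] at hnext_smooth ⊢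
    fun_prop
  · have hshift : nextPoint A (s + ℓ, y) = ((nextPoint A (s, y)).1 + ℓ, (nextPoint A (s, y)).2) :=
      Prod.ext (add_right_comm s ℓ y) (hnext.periodic s y)
    simp only [hshift, hA.isLift.periodic s y, hF.map_add, hG.periodic _ _]
    ring

namespace BilliardTable

variable {B : BilliardTable} {k : ℕ} {A F G : ℝ × ℝ → ℝ}

theorem lazutkinForm_cylinderCover {x₀ : ℝ → ℝ} {X₀ : AddCircle B.ℓ → UnitAddCircle}
    {X Y : ℕ → AddCircle B.ℓ → ℝ} (hx₀ : ∀ t : ℝ, (x₀ t : UnitAddCircle) = X₀ t) (p : ℝ × ℝ) :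
    B.lazutkinForm k X₀ X Y (cylinderCover B.ℓ p) =
      cylinderCover 1 (lazutkinFst k x₀ (fun j t => X j t) p,
        lazutkinSnd k (fun j t => Y j t) p) := by
  simp only [lazutkinForm, cylinderCover, lazutkinFst, lazutkinSnd, AddCircle.coe_add, hx₀]

section Conjugation

variable {b : ℝ} {Ψ : AddCircle B.ℓ × ℝ → UnitAddCircle × ℝ} {U : Set (AddCircle B.ℓ × ℝ)}
  (hA : IsBoundaryDefining B.ℓ A)
  (hbill : ∀ᶠ p in stripNhdsPos, B.billiardMap (cylinderCover B.ℓ (p.1, A p)) =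
    cylinderCover B.ℓ (nextPoint A p))
  (hF : IsLift B.ℓ b F) (hG : IsBoundaryDefining B.ℓ G)
  (hΨ : ∀ p, Ψ (cylinderCover B.ℓ p) = cylinderCover 1 (F p, G p))
  (hU : IsBoundaryNhd (Icc 0 Real.pi) U)
include hA hbill hF hG hΨ hU

theorem ConjugatesToNormalForm.exists_eventually_abs_le (h : B.ConjugatesToNormalForm k Ψ U) :
    ∃ C > 0, ∀ᶠ p in stripNhdsPos,
      |F (nextPoint A p) - F (p.1, A p) - G (p.1, A p)| ≤ C * G (p.1, A p) ^ (2 * k + 2) ∧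
      |G (nextPoint A p) - G (p.1, A p)| ≤ C * G (p.1, A p) ^ (2 * k + 2) := by
  obtain ⟨C, hC, δ, hδ, hconj⟩ := h
  have hℓ := B.length_pos
  have hangle := hA.tendsto_prodMk_pos hℓ Prod.fst
  have hmem := hU.eventually_mem_pos hℓ (Icc_mem_nhdsGT Real.pi_pos)
  have hsmall := (hangle.mono_right stripNhdsPos_le).eventually
    ((hG.tendsto_zero hℓ).eventually_lt_const hδ)
  have hdefect := ((isLift_sub_comp_nextPoint hA hF hG.isLift).tendsto_zero hℓ fun s => by
    simp [hA.map_zero, nextPoint, hG.map_zero]).abs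
  rw [abs_zero] at hdefect
  refine ⟨C, hC, ?_⟩
  filter_upwards [hbill, hangle.eventually hmem, (tendsto_nextPoint_pos hℓ hA).eventually hmem,
    hsmall, stripNhdsPos_le (hdefect.eventually_le_const one_half_pos)]
    with p hnext hpU hnextU hpδ hphalf
  have hp := hconj _ hpU (by rwa [hnext]) (by rwa [hΨ])
  rw [hnext, hΨ, hΨ] at hp
  refine ⟨?_, hp.2⟩
  -- A real number of absolute value at most `1 / 2` has the same norm in the circle `ℝ / ℤ`.
  have hfst := hp.1
  simp only [cylinderCover] at hfst
  rwa [← AddCircle.coe_add, ← AddCircle.coe_sub, ← sub_sub,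
    (AddCircle.norm_coe_eq_abs_iff 1 one_ne_zero).2 (by simpa using hphalf)] at hfst

theorem ConjugatesToNormalForm.isShearUpTo (h : B.ConjugatesToNormalForm k Ψ U) :
    IsShearUpTo (2 * k + 2) A F G := by
  obtain ⟨C, hC, hbound⟩ := h.exists_eventually_abs_le hA hbill hF hG hΨ hU
  have hℓ := B.length_pos
  have hpow : (fun p => G (p.1, A p) ^ (2 * k + 2)) =O[stripNhdsPos]
      fun p => p.2 ^ (2 * k + 2) :=
    ((hG.pow_isBigO hℓ _).comp_tendsto (hA.tendsto_prodMk_pos hℓ Prod.fst)).trans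
      (hA.pow_isBigO hℓ _)
  have hnorm : ∀ {x y : ℝ}, |x| ≤ C * y → ‖x‖ ≤ C * ‖y‖ := fun hxy =>
    hxy.trans (mul_le_mul_of_nonneg_left (le_abs_self _) hC.le)
  exact ⟨(IsBigO.of_bound C (hbound.mono fun p hp => hnorm hp.1)).trans hpow,
    (IsBigO.of_bound C (hbound.mono fun p hp => hnorm hp.2)).trans hpow⟩

end Conjugation

theorem exists_isLazutkinCoeff {X₀ : AddCircle B.ℓ → UnitAddCircle}
    {X Y : ℕ → AddCircle B.ℓ → ℝ}
    (hX₀ : SmoothToCircleOn (fun t : ℝ => X₀ (t : AddCircle B.ℓ)) univ)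
    (hX : ∀ j, ContDiff ℝ ∞ fun t : ℝ => X j (t : AddCircle B.ℓ))
    (hY : ∀ j, ContDiff ℝ ∞ fun t : ℝ => Y j (t : AddCircle B.ℓ)) :
    ∃ (x₀ : ℝ → ℝ) (n : ℤ), (∀ t : ℝ, (x₀ t : UnitAddCircle) = X₀ t) ∧
      IsLazutkinCoeff B.ℓ n x₀ (fun j t => X j t) fun j t => Y j t := by
  obtain ⟨x₀, hx₀, hx₀X⟩ := hX₀.exists_contDiff_lift one_ne_zero
  have hshift : ∀ t, (x₀ (t + B.ℓ) : UnitAddCircle) = x₀ t := fun t => by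
    rw [hx₀X, hx₀X, AddCircle.coe_add_period]
  obtain ⟨n, hn⟩ := exists_int_mul_of_coe_eq hx₀.continuous
    (hx₀.continuous.comp (continuous_add_const B.ℓ)) hshift
  refine ⟨x₀, n, hx₀X, hx₀, hX, hY, fun s => ?_, fun j s => ?_, fun j s => ?_⟩
  · exact (hn s).trans (by rw [mul_one])
  · rw [AddCircle.coe_add_period]
  · rw [AddCircle.coe_add_period]

theorem IsLazutkinChange.exists_isStripCoord (hA : IsBoundaryDefining B.ℓ A)
    (hbill : ∀ᶠ p in stripNhdsPos, B.billiardMap (cylinderCover B.ℓ (p.1, A p)) =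
      cylinderCover B.ℓ (nextPoint A p)) {Ψ : AddCircle B.ℓ × ℝ → UnitAddCircle × ℝ}
    (h : B.IsLazutkinChange k Ψ) :
    ∃ (x₀ : ℝ → ℝ) (X Y : ℕ → ℝ → ℝ),
      IsStripCoord B.ℓ 1 (lazutkinFst k x₀ X) (lazutkinSnd k Y) ∧
      IsShearUpTo (2 * k + 2) A (lazutkinFst k x₀ X) (lazutkinSnd k Y) := by
  obtain ⟨⟨X₀, X, Y, hX₀, hX, hY, rfl⟩, U, ε, V, -, hU, hV, hdiffeo, hconj⟩ := h
  obtain ⟨x₀, n, hx₀X, hcoeff⟩ := exists_isLazutkinCoeff hX₀ hX hY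
  have hF := hcoeff.isLift_lazutkinFst k
  have hG := hcoeff.isLift_lazutkinSnd k
  have hΨ := lazutkinForm_cylinderCover (B := B) (k := k) (X := X) (Y := Y) hx₀X
  have hF' := derivSnd_lazutkinFst hF.differentiable
  have hG' := hdiffeo.derivSnd_pos B.length_pos Real.pi_pos hF.differentiable hG.differentiable
    lazutkinSnd_zero hF' hΨ hU hV
  have hshear := hconj.isShearUpTo hA hbill hF ⟨hG, lazutkinSnd_zero, hG'⟩ hΨ hU
  have hx₀_deriv : ∀ s, 0 < deriv x₀ s := fun s => by
    rw [← derivFst_lazutkinFst hF.differentiable, hshear.derivFst_eq (by omega) hA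
      hF.differentiable hG.differentiable lazutkinSnd_zero hF']
    exact mul_pos (hA.derivSnd_pos s) (hG' s)
  have hinj : ∀ s t : ℝ, (x₀ s : UnitAddCircle) = x₀ t →
      (s : AddCircle B.ℓ) = (t : AddCircle B.ℓ) := fun s t hst => by
    refine congrArg Prod.fst (hdiffeo.1.injOn (hU.2 s) (hU.2 t) ?_)
    refine (hΨ (s, 0)).trans (Eq.trans ?_ (hΨ (t, 0)).symm)
    simp only [cylinderCover, lazutkinFst_zero, lazutkinSnd_zero, hst]
  obtain rfl : n = 1 := eq_one_of_injective_quotient B.length_pos one_pos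
    hcoeff.contDiff_base.continuous (strictMono_of_deriv_pos hx₀_deriv)
    (fun t => by rw [hcoeff.map_add_base, mul_one]) hinj
  rw [Int.cast_one] at hcoeff
  refine ⟨x₀, _, _, hcoeff.isStripCoord k hx₀_deriv fun s => ?_, hshear⟩
  rw [← derivSnd_lazutkinSnd hG.differentiable]
  exact hG' s

end BilliardTable

theorem exists_eq_add_zsmul_of_coe_eq {a s t : ℝ} (h : (s : AddCircle a) = (t : AddCircle a)) :
    ∃ n : ℤ, s = t + n • a := by
  obtain ⟨n, hn⟩ := (AddCircle.coe_eq_zero_iff a).1 (show ((s - t : ℝ) : AddCircle a) = 0 by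
    rw [AddCircle.coe_sub, h, sub_self])
  exact ⟨n, by rw [hn, add_sub_cancel]⟩

namespace BilliardTable

theorem IsPseudocollision.symm {B : BilliardTable} {ε : ℝ} {zm z₀ zp : ℂ}
    (h : B.IsPseudocollision ε zm z₀ zp) : B.IsPseudocollision ε zp z₀ zm := by
  obtain ⟨hzm, hzp, hm, hp, s, hs, hangle⟩ := h
  refine ⟨hzp, hzm, hp, hm, s, hs, ?_⟩
  rw [InnerProductGeometry.angle_neg_left] at hangle ⊢
  convert hangle using 2
  ring

variable {B : BilliardTable} {k : ℕ} {A S : ℝ × ℝ → ℝ}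

theorem HasChordAngle.eventually_reflectionDefect_eq (hA : B.HasChordAngle A)
    (hS : IsLift 1 B.ℓ S) (hS' : ∀ ξ, 0 < derivFst S (ξ, 0)) :
    ∀ᶠ q in stripNhdsPos,
      B.curve (S (q.1 + q.2, q.2)) ≠ B.curve (S q) ∧
      B.curve (S (q.1 - q.2, q.2)) ≠ B.curve (S q) ∧
      InnerProductGeometry.angle (B.unitTangent (S q))
          (B.curve (S (q.1 + q.2, q.2)) - B.curve (S q)) -
        InnerProductGeometry.angle (-B.unitTangent (S q))
          (B.curve (S (q.1 - q.2, q.2)) - B.curve (S q)) = reflectionDefect A S q := by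
  have hfwd := (isStripCoord_shift_sub hS hS').snd.tendsto_prodMk_pos one_pos S
  have hback := hfwd.comp (tendsto_prodMk_snd_stripNhdsPos fun q => q.1 - q.2)
  have hpos := (tendsto_stripNhdsPos_iff.1 hfwd).2
  have hpos' := (tendsto_stripNhdsPos_iff.1 hback).2
  have hback_neg : Tendsto (fun q => (S q, S (q.1 - q.2, q.2) - S q)) stripNhdsPos stripNhds := by
    refine tendsto_stripNhds_iff.2 ?_
    simpa [Function.comp_def] using (tendsto_stripNhdsPos_iff.1 hback).1.neg
  have hfwd₀ := hfwd.mono_right stripNhdsPos_le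
  filter_upwards [hpos, hpos', hfwd₀.eventually hA.curve_ne, hback_neg.eventually hA.curve_ne,
    hfwd₀.eventually hA.angle_pos, hback_neg.eventually hA.angle_neg]
    with q hq hq' hne hne' hangle hangle'
  simp only [Function.comp, sub_add_cancel] at hq'
  simp only [add_sub_cancel] at hne hne' hangle hangle'
  have hneg : S (q.1 - q.2, q.2) - S q < 0 := sub_neg.2 (sub_pos.1 hq')
  refine ⟨hne hq.ne', hne' hneg.ne, ?_⟩
  rw [hangle hq, hangle' hneg, sub_neg_eq_add]
  rfl

/-- The family of closed curves `ξ ↦ γ (S (ξ, η))` on the circle `ℝ / ℤ`. -/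
def boundaryFamily (hS : IsLift 1 B.ℓ S) (x : UnitAddCircle) (η : ℝ) : ℂ :=
  Function.Periodic.lift (f := fun ξ => B.curve (S (ξ, η)))
    (fun ξ => by simp only [hS.map_add, curve_add]) x

section BoundaryFamily

variable (hS : IsLift 1 B.ℓ S)

theorem boundaryFamily_coe (ξ η : ℝ) :
    boundaryFamily hS (ξ : UnitAddCircle) η = B.curve (S (ξ, η)) :=
  Function.Periodic.lift_coe _ ξ

theorem boundaryFamily_neg {η : ℝ} (heven : ∀ ξ, S (ξ, -η) = S (ξ, η)) (x : UnitAddCircle) :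
    boundaryFamily hS x (-η) = boundaryFamily hS x η := by
  obtain ⟨ξ, rfl⟩ := QuotientAddGroup.mk_surjective x
  exact (boundaryFamily_coe hS ξ (-η)).trans
    ((congrArg B.curve (heven ξ)).trans (boundaryFamily_coe hS ξ η).symm)

theorem bijOn_boundaryFamily {η : ℝ} (hmono : StrictMono fun ξ => S (ξ, η)) :
    BijOn (fun x => boundaryFamily hS x η) univ (frontier B.Ω) := by
  refine ⟨fun x _ => ?_, fun x _ y _ hxy => ?_, fun z hz => ?_⟩
  · obtain ⟨ξ, rfl⟩ := QuotientAddGroup.mk_surjective x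
    exact (congrArg (· ∈ frontier B.Ω) (boundaryFamily_coe hS ξ η)).mpr (B.curve_mem_frontier _)
  · obtain ⟨ξ, rfl⟩ := QuotientAddGroup.mk_surjective x
    obtain ⟨ξ', rfl⟩ := QuotientAddGroup.mk_surjective y
    have hcurve : B.curve (S (ξ, η)) = B.curve (S (ξ', η)) :=
      (boundaryFamily_coe hS ξ η).symm.trans (hxy.trans (boundaryFamily_coe hS ξ' η))
    obtain ⟨n, hn⟩ := exists_eq_add_zsmul_of_coe_eq (B.injective hcurve)
    rw [← hS.map_add_zsmul] at hn
    change (ξ : UnitAddCircle) = (ξ' : UnitAddCircle)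
    rw [hmono.injective hn, AddCircle.coe_add, AddCircle.coe_zsmul, AddCircle.coe_period,
      smul_zero, add_zero]
  · obtain ⟨t, rfl⟩ := B.exists_curve_eq hz
    obtain ⟨ξ, rfl⟩ := hS.surjective B.length_pos η t
    exact ⟨(ξ : UnitAddCircle), mem_univ _, boundaryFamily_coe hS ξ η⟩

theorem circleDeriv_boundaryFamily (ξ η : ℝ) :
    circleDeriv (fun x => boundaryFamily hS x η) (ξ : UnitAddCircle) =
      derivFst S (ξ, η) * B.unitTangent (S (ξ, η)) := by
  rw [circleDeriv_coe]
  simp only [boundaryFamily_coe]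
  rw [← Complex.real_smul]
  exact ((B.hasDerivAt_curve _).scomp ξ (hasDerivAt_derivFst (hS.differentiable (ξ, η)))).deriv

theorem HasChordAngle.exists_isPseudocollision (hA : B.HasChordAngle A)
    (hS' : ∀ ξ, 0 < derivFst S (ξ, 0)) {N : ℕ}
    (hdefect : reflectionDefect A S =O[stripNhdsPos] fun q => q.2 ^ N) :
    ∃ C > (0 : ℝ), ∃ δ > (0 : ℝ), ∀ (x : UnitAddCircle) (η : ℝ), 0 < η → η < δ →
      B.IsPseudocollision (C * η ^ N) (boundaryFamily hS (x - (η : UnitAddCircle)) η)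
        (boundaryFamily hS x η) (boundaryFamily hS (x + (η : UnitAddCircle)) η) := by
  obtain ⟨C, hC, hbound⟩ := hdefect.exists_pos
  obtain ⟨δ, hδ, hcollision⟩ := eventually_stripNhdsPos_iff.1
    ((hA.eventually_reflectionDefect_eq hS hS').and hbound.bound)
  refine ⟨C + 1, by linarith, δ, hδ, fun x η hη hηδ => ?_⟩
  obtain ⟨ξ, rfl⟩ := QuotientAddGroup.mk_surjective x
  obtain ⟨⟨hne, hne', hangle⟩, hle⟩ := hcollision ξ η hη hηδ
  change B.IsPseudocollision _ (boundaryFamily hS ((ξ : UnitAddCircle) - (η : UnitAddCircle)) η)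
    (boundaryFamily hS (ξ : UnitAddCircle) η)
    (boundaryFamily hS ((ξ : UnitAddCircle) + (η : UnitAddCircle)) η)
  rw [← AddCircle.coe_sub, ← AddCircle.coe_add, boundaryFamily_coe, boundaryFamily_coe,
    boundaryFamily_coe]
  refine ⟨B.curve_mem_frontier _, B.curve_mem_frontier _, hne', hne, S (ξ, η), rfl, ?_⟩
  rw [tangent_coe, hangle]
  rw [Real.norm_eq_abs, Real.norm_of_nonneg (by positivity)] at hle
  have : 0 < η ^ N := by positivity
  linarith

end BoundaryFamily

theorem HasChordAngle.exists_isAngularFunction (hA : B.HasChordAngle A)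
    (h : IsAngularLift B.ℓ (2 * k + 2) A S)
    (hbase : ∀ᶠ q in stripNhds, S (0, q.2) = S (0, 0)) :
    ∃ ε > (0 : ℝ), ∃ Z : UnitAddCircle → ℝ → ℂ, B.IsAngularFunction k ε Z := by
  have hS := h.isLift
  obtain ⟨m, hm, hderiv⟩ := exists_pos_le_of_periodic one_pos
    hS.isLift_derivFst.smooth.continuous hS.isLift_derivFst.periodic h.derivFst_pos
  obtain ⟨ε, hε, hall⟩ := eventually_stripNhds_iff.1 ((hderiv.and h.even).and hbase)
  have hderiv_pos : ∀ η ∈ Ioo (-ε) ε, ∀ ξ, 0 < derivFst S (ξ, η) := fun η hη ξ =>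
    hm.trans_le (hall ξ η (abs_lt.2 hη)).1.1
  have heven : ∀ η ∈ Ioo (-ε) ε, ∀ x, boundaryFamily hS x (-η) = boundaryFamily hS x η :=
    fun η hη => boundaryFamily_neg hS fun ξ => (hall ξ η (abs_lt.2 hη)).1.2
  refine ⟨ε, hε, boundaryFamily hS, ?_, fun x η hη => heven η hη x, fun η hη => ?_,
    fun η hη x s hs => ?_, fun η hη => ?_, ?_⟩
  · simp only [boundaryFamily_coe]
    exact (B.contDiff_curve.comp hS.smooth).contDiffOn
  · refine bijOn_boundaryFamily hS (strictMono_of_deriv_pos fun ξ => ?_)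
    rw [(hasDerivAt_derivFst (hS.differentiable (ξ, η))).deriv]
    exact hderiv_pos η hη ξ
  · obtain ⟨ξ, rfl⟩ := QuotientAddGroup.mk_surjective x
    obtain rfl : s = (S (ξ, η) : AddCircle B.ℓ) :=
      B.injective (hs.trans (boundaryFamily_coe hS ξ η))
    rw [tangent_coe]
    exact ⟨_, hderiv_pos η hη ξ, circleDeriv_boundaryFamily hS ξ η⟩
  · rw [← AddCircle.coe_zero, boundaryFamily_coe, boundaryFamily_coe,
      (hall 0 η (abs_lt.2 hη)).2]
  · obtain ⟨C, hC, δ, hδ, hcollision⟩ := hA.exists_isPseudocollision hS h.derivFst_pos h.defect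
    refine ⟨C, hC, δ, hδ, fun x η hη hη₀ hηδ => ?_⟩
    rcases lt_or_gt_of_ne hη₀ with hneg | hpos
    · have hflip := (hcollision x (-η) (neg_pos.2 hneg) (by rwa [← abs_of_neg hneg])).symm
      rwa [AddCircle.coe_neg, sub_neg_eq_add, ← sub_eq_add_neg, heven η hη, heven η hη,
        heven η hη, (show Even (2 * k + 2) from ⟨k + 1, by ring⟩).neg_pow] at hflip
    · exact hcollision x η hpos (by rwa [← abs_of_pos hpos])

end BilliardTable

theorem continuous_of_continuous_coe {a : ℝ} {α : Type*} [TopologicalSpace α]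
    {f : AddCircle a → α} (hf : Continuous fun t : ℝ => f (t : AddCircle a)) : Continuous f :=
  QuotientAddGroup.isOpenQuotientMap_mk.isQuotientMap.continuous_iff.2 hf

/-- The retraction of the line onto `[-r, r]`, for `0 ≤ r`. -/
def clamp (r y : ℝ) : ℝ := max (-r) (min y r)

theorem continuous_clamp (r : ℝ) : Continuous (clamp r) := by
  unfold clamp
  fun_prop

theorem abs_clamp_le {r : ℝ} (hr : 0 ≤ r) (y : ℝ) : |clamp r y| ≤ r :=
  abs_le.2 ⟨le_max_left _ _, max_le (by linarith) (min_le_right _ _)⟩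

theorem clamp_eq_self {r y : ℝ} (hy : |y| ≤ r) : clamp r y = y := by
  rw [abs_le] at hy
  rw [clamp, min_eq_left hy.2, max_eq_right hy.1]

theorem clamp_neg {r : ℝ} (hr : 0 ≤ r) (y : ℝ) : clamp r (-y) = -clamp r y := by
  rw [clamp, clamp, ← min_neg_neg, neg_neg, ← max_neg_neg, max_min_distrib_left,
    max_eq_right (by linarith : -r ≤ r), max_comm, min_comm]

namespace BilliardTable

variable {B : BilliardTable} {k : ℕ} {A S : ℝ × ℝ → ℝ} {ε : ℝ} {Z : UnitAddCircle → ℝ → ℂ}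

theorem exists_curve_lift {E : Type*} [TopologicalSpace E] [SimplyConnectedSpace E]
    [LocallyPathConnectedSpace E] {F : E → ℂ} (hF : Continuous F) (h : ∀ x, F x ∈ frontier B.Ω) :
    ∃ f : E → ℝ, Continuous f ∧ ∀ x, B.curve (f x) = F x := by
  have : Fact (0 < B.ℓ) := ⟨B.length_pos⟩
  have hγ : Topology.IsEmbedding B.γ := (Continuous.isClosedEmbedding
    (continuous_of_continuous_coe B.smooth.continuous) B.injective).isEmbedding
  rw [← B.range_eq] at h
  choose G hG using h
  have hGc : Continuous G := hγ.continuous_iff.2 (hF.congr fun x => (hG x).symm)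
  obtain ⟨f, hf, hfG⟩ := exists_continuous_lift hGc
  exact ⟨f, hf, fun x => by rw [curve, hfG, hG]⟩

theorem IsAngularFunction.exists_continuous_lift (hε : 0 < ε) (hZ : B.IsAngularFunction k ε Z) :
    ∃ (T : ℝ × ℝ → ℝ) (n : ℤ), Continuous T ∧ (∀ q, T (q.1 + 1, q.2) = T q + n * B.ℓ) ∧
      (∀ q, T (q.1, -q.2) = T q) ∧
      ∀ q, B.curve (T q) = Z (q.1 : UnitAddCircle) (clamp (ε / 2) q.2) := by
  have hmem : ∀ η, clamp (ε / 2) η ∈ Ioo (-ε) ε := fun η =>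
    abs_lt.1 ((abs_clamp_le (half_pos hε).le η).trans_lt (half_lt_self hε))
  have hcont : Continuous fun q : ℝ × ℝ => Z (q.1 : UnitAddCircle) (clamp (ε / 2) q.2) :=
    hZ.smooth.continuousOn.comp_continuous
      (continuous_fst.prodMk ((continuous_clamp _).comp continuous_snd))
      fun q => ⟨mem_univ _, hmem _⟩
  obtain ⟨T, hT, hTZ⟩ := exists_curve_lift hcont fun q => (hZ.bijOn _ (hmem q.2)).1 (mem_univ _)
  obtain ⟨n, hn⟩ := exists_int_mul_of_coe_eq (b := B.ℓ) hT (g := fun q => T (q.1 + 1, q.2))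
    (by fun_prop) fun q => B.injective <| (hTZ _).trans <| Eq.trans (by
      rw [AddCircle.coe_add, AddCircle.coe_period, add_zero]) (hTZ q).symm
  obtain ⟨m, hm⟩ := exists_int_mul_of_coe_eq (b := B.ℓ) hT (g := fun q => T (q.1, -q.2))
    (by fun_prop) fun q => B.injective <| (hTZ _).trans <| Eq.trans (by
      rw [clamp_neg (half_pos hε).le, hZ.even _ _ (hmem _)]) (hTZ q).symm
  have hm_zero : (m : ℝ) * B.ℓ = 0 := by simpa using hm (0, 0)
  exact ⟨T, n, hT, hn, fun q => by rw [hm, hm_zero, add_zero], hTZ⟩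

theorem IsAngularFunction.exists_isLift (hε : 0 < ε) (hZ : B.IsAngularFunction k ε Z) :
    ∃ (S : ℝ × ℝ → ℝ) (n : ℤ), IsLift 1 (n * B.ℓ) S ∧
      (∀ᶠ q in stripNhds, S (q.1, -q.2) = S q) ∧
      ∀ᶠ q in stripNhds, B.curve (S q) = Z (q.1 : UnitAddCircle) q.2 := by
  obtain ⟨T, n, hT, hn, heven, hTZ⟩ := hZ.exists_continuous_lift hε
  have hTZ' : ∀ q ∈ (univ ×ˢ Ioo (-(ε / 2)) (ε / 2) : Set (ℝ × ℝ)),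
      B.curve (T q) = Z (q.1 : UnitAddCircle) q.2 := fun q hq => by
    rw [hTZ, clamp_eq_self (abs_lt.2 hq.2).le]
  have hnear : ∀ᶠ q in stripNhds, q ∈ (univ ×ˢ Ioo (-(ε / 2)) (ε / 2) : Set (ℝ × ℝ)) :=
    eventually_stripNhds_iff.2 ⟨ε / 2, half_pos hε, fun s y h => ⟨mem_univ _, abs_lt.1 h⟩⟩
  have hsmooth : ∀ᶠ q in stripNhds, ContDiffAt ℝ ∞ T q := by
    filter_upwards [hnear] with q hq
    have hnhds := (isOpen_univ.prod isOpen_Ioo).mem_nhds hq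
    refine contDiffAt_of_comp_curve hT.continuousAt B.contDiff_curve.contDiffAt
      (B.unitTangent_ne_zero _) ?_
    refine ContDiffAt.congr_of_eventuallyEq ?_ (eventually_of_mem hnhds hTZ')
    refine hZ.smooth.contDiffAt (mem_of_superset hnhds (prod_mono_right ?_))
    exact Ioo_subset_Ioo (by linarith) (by linarith)
  obtain ⟨S, hS, hST⟩ := exists_isLift_eventuallyEq one_pos hsmooth (Eventually.of_forall hn)
  refine ⟨S, n, hS, ?_, ?_⟩
  · filter_upwards [hST, (tendsto_prodMk_neg_stripNhds Prod.fst).eventually hST] with q hq hq'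
    rw [hq, hq', heven]
  · filter_upwards [hST, hnear] with q hq hq'
    rw [hq, hTZ' q hq']

section Lift

variable (hε : 0 < ε) (hZ : B.IsAngularFunction k ε Z)

include hε hZ

theorem IsAngularFunction.derivFst_lift_pos (hS : Differentiable ℝ S)
    (hSZ : ∀ ξ : ℝ, B.curve (S (ξ, 0)) = Z (ξ : UnitAddCircle) 0) (ξ : ℝ) :
    0 < derivFst S (ξ, 0) := by
  obtain ⟨c, hc, heq⟩ := hZ.orientation 0 ⟨neg_neg_of_pos hε, hε⟩ (ξ : UnitAddCircle)
    (S (ξ, 0)) (hSZ ξ)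
  have hderiv := (B.hasDerivAt_curve (S (ξ, 0))).scomp ξ (hasDerivAt_derivFst (hS (ξ, 0)))
  rw [circleDeriv_coe, tangent_coe] at heq
  simp only [← hSZ] at heq
  have hmul := hderiv.deriv.symm.trans heq
  rw [Complex.real_smul] at hmul
  have hderiv_eq := mul_right_cancel₀ (B.unitTangent_ne_zero _) hmul
  rwa [Complex.ofReal_inj.1 hderiv_eq]

theorem IsAngularFunction.gain_lift_eq_one {n : ℤ} (hS : IsLift 1 (n * B.ℓ) S)
    (hSZ : ∀ ξ : ℝ, B.curve (S (ξ, 0)) = Z (ξ : UnitAddCircle) 0) : n = 1 := by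
  have hderiv : ∀ ξ, HasDerivAt (fun ξ => S (ξ, 0)) (derivFst S (ξ, 0)) ξ := fun ξ =>
    hasDerivAt_derivFst (hS.differentiable (ξ, 0))
  refine eq_one_of_injective_quotient one_pos B.length_pos
    (continuous_iff_continuousAt.2 fun ξ => (hderiv ξ).continuousAt)
    (strictMono_of_deriv_pos fun ξ => ?_) (fun ξ => hS.map_add ξ 0) fun ξ ξ' h => ?_
  · rw [(hderiv ξ).deriv]
    exact hZ.derivFst_lift_pos hε hS.differentiable hSZ ξ
  · refine (hZ.bijOn 0 ⟨neg_neg_of_pos hε, hε⟩).2.1 (mem_univ _) (mem_univ _) ?_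
    simp only [← hSZ, curve, h]

theorem IsAngularFunction.reflectionDefect_lift_isBigO (hA : B.HasChordAngle A)
    (hS : IsLift 1 B.ℓ S) (hS' : ∀ ξ, 0 < derivFst S (ξ, 0))
    (hSZ : ∀ᶠ q in stripNhds, B.curve (S q) = Z (q.1 : UnitAddCircle) q.2) :
    reflectionDefect A S =O[stripNhdsPos] fun q => q.2 ^ (2 * k + 2) := by
  obtain ⟨C, -, δ, hδ, hcollision⟩ := hZ.pseudocollision
  have hsmall : ∀ᶠ q in stripNhdsPos, q.2 < min δ ε :=
    stripNhdsPos_le (tendsto_snd_stripNhds.eventually_lt_const (lt_min hδ hε))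
  have hshift : ∀ f : ℝ × ℝ → ℝ, ∀ᶠ q in stripNhdsPos,
      B.curve (S (f q, q.2)) = Z (f q : UnitAddCircle) q.2 := fun f =>
    stripNhdsPos_le ((tendsto_prodMk_snd_stripNhds f).eventually hSZ)
  refine IsBigO.of_bound C ?_
  filter_upwards [hA.eventually_reflectionDefect_eq hS hS', hsmall, eventually_stripNhdsPos_pos,
    hshift Prod.fst, hshift fun q => q.1 + q.2, hshift fun q => q.1 - q.2]
    with q hdefect hlt hpos hq hfwd hback
  have hcoll := hcollision (q.1 : UnitAddCircle) q.2
    ⟨by linarith, hlt.trans_le (min_le_right _ _)⟩ hpos.ne'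
    (by rw [abs_of_pos hpos]; exact hlt.trans_le (min_le_left _ _))
  rw [← AddCircle.coe_add, ← AddCircle.coe_sub, ← hq, ← hfwd, ← hback] at hcoll
  obtain ⟨-, -, -, -, s, hs, hangle⟩ := hcoll
  obtain rfl : s = (S q : AddCircle B.ℓ) := B.injective hs
  rw [tangent_coe, hdefect.2.2] at hangle
  rw [Real.norm_eq_abs, Real.norm_of_nonneg (by positivity)]
  exact hangle.le

theorem IsAngularFunction.exists_isAngularLift (hA : B.HasChordAngle A) :
    ∃ S, IsAngularLift B.ℓ (2 * k + 2) A S := by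
  obtain ⟨S, n, hS, heven, hSZ⟩ := hZ.exists_isLift hε
  have hSZ₀ : ∀ ξ : ℝ, B.curve (S (ξ, 0)) = Z (ξ : UnitAddCircle) 0 := fun ξ =>
    ((tendsto_prodMk_nhds_zero_stripNhds ξ).eventually hSZ).self_of_nhds
  obtain rfl : n = 1 := hZ.gain_lift_eq_one hε hS hSZ₀
  rw [Int.cast_one, one_mul] at hS
  have hpos := hZ.derivFst_lift_pos hε hS.differentiable hSZ₀
  exact ⟨S, hS, hpos, heven, hZ.reflectionDefect_lift_isBigO hε hA hS hpos hSZ⟩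

end Lift

end BilliardTable

theorem smoothOnCylinder_of_lift {a b : ℝ} {Ψ : AddCircle a × ℝ → AddCircle b × ℝ}
    {F G : ℝ × ℝ → ℝ} (hF : ContDiff ℝ ∞ F) (hG : ContDiff ℝ ∞ G)
    (h : ∀ p, Ψ (cylinderCover a p) = cylinderCover b (F p, G p)) (U : Set (AddCircle a × ℝ)) :
    SmoothOnCylinder Ψ U := by
  simp only [SmoothOnCylinder, h]
  exact ⟨smoothToCircleOn_coe b hF.contDiffOn, hG.contDiffOn⟩

theorem cylinderCover_surjective (a : ℝ) : Function.Surjective (cylinderCover a) := by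
  rintro ⟨x, y⟩
  obtain ⟨t, rfl⟩ := QuotientAddGroup.mk_surjective x
  exact ⟨(t, y), rfl⟩

theorem continuous_of_comp_cylinderCover {a : ℝ} {α : Type*} [TopologicalSpace α]
    {f : AddCircle a × ℝ → α} (hf : Continuous fun p => f (cylinderCover a p)) : Continuous f :=
  (QuotientAddGroup.isOpenQuotientMap_mk.prodMap
    IsOpenQuotientMap.id).isQuotientMap.continuous_iff.2 hf

theorem exists_cylinder_map {a b : ℝ} {F G : ℝ × ℝ → ℝ} (hF : IsLift a b F) (hG : IsLift a 0 G) :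
    ∃ Ψ : AddCircle a × ℝ → AddCircle b × ℝ,
      ∀ p, Ψ (cylinderCover a p) = cylinderCover b (F p, G p) := by
  have hF_per : ∀ y, Function.Periodic (fun s => (F (s, y) : AddCircle b)) a := fun y s => by
    simp only [hF.map_add, AddCircle.coe_add_period]
  have hG_per : ∀ y, Function.Periodic (fun s => G (s, y)) a := fun y s => hG.periodic s y
  exact ⟨fun p => ((hF_per p.2).lift p.1, (hG_per p.2).lift p.1), fun p => rfl⟩

theorem isBoundaryNhd_setOf_snd_mem_Ico {a ρ : ℝ} (hρ : 0 < ρ) :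
    IsBoundaryNhd (Ico 0 ρ) {v : AddCircle a × ℝ | v.2 ∈ Ico 0 ρ} :=
  ⟨⟨univ, isOpen_univ, by ext v; simp⟩, fun _ => ⟨le_rfl, hρ⟩⟩

theorem isBoundaryNhd_setOf_mem_Ico_and {a r ρ M : ℝ} (hr : 0 < r) (hrM : r ≤ M) (hρ : 0 < ρ)
    {g : AddCircle a × ℝ → ℝ} (hg : Continuous g) (hzero : ∀ x, g (x, 0) = 0)
    (hnonneg : ∀ u, u.2 ∈ Ico 0 r → 0 ≤ g u) :
    IsBoundaryNhd (Icc 0 M) {u | u.2 ∈ Ico 0 r ∧ g u ∈ Ico 0 ρ} := by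
  refine ⟨⟨{u | u.2 < r} ∩ {u | g u < ρ}, (isOpen_lt continuous_snd continuous_const).inter
    (isOpen_lt hg continuous_const), ?_⟩, fun x => ⟨⟨le_rfl, hr⟩, ?_⟩⟩
  · ext u
    constructor
    · rintro ⟨hu, hgu⟩
      exact ⟨⟨hu.2, hgu.2⟩, mem_univ _, hu.1, hu.2.le.trans hrM⟩
    · rintro ⟨⟨hlt, hglt⟩, -, hle, -⟩
      exact ⟨⟨hle, hlt⟩, hnonneg u ⟨hle, hlt⟩, hglt⟩
  · rw [hzero]
    exact ⟨le_rfl, hρ⟩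

section Diffeo

variable {a b : ℝ} {F G : ℝ × ℝ → ℝ} (ha : 0 < a) (hb : 0 < b) (h : IsStripCoord a b F G)
  {Ψ : AddCircle a × ℝ → AddCircle b × ℝ}
  (hΨ : ∀ p, Ψ (cylinderCover a p) = cylinderCover b (F p, G p)) {R : ℝ} (hR : 0 < R)

include ha hb h hΨ hR

theorem IsStripCoord.exists_cylinder_inverse :
    ∃ (Θ : AddCircle b × ℝ → AddCircle a × ℝ) (r ρ : ℝ), 0 < r ∧ r ≤ R ∧ 0 < ρ ∧
      (∀ V, SmoothOnCylinder Θ V) ∧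
      (∀ u, u.2 ∈ Ico 0 r → Θ (Ψ u) = u ∧ 0 ≤ (Ψ u).2) ∧
      ∀ v, v.2 ∈ Ico 0 ρ → Ψ (Θ v) = v ∧ (Θ v).2 ∈ Ico 0 r := by
  obtain ⟨P, Q, hPQ, hright, hleft⟩ := h.exists_inverse ha hb
  obtain ⟨Θ, hΘ⟩ := exists_cylinder_map hPQ.fst hPQ.snd.isLift
  obtain ⟨r₀, hr₀, hleft⟩ := eventually_stripNhds_iff.1 (hleft.and (h.snd.eventually_nonneg ha))
  obtain ⟨r, hr, hrr₀, hrR⟩ : ∃ r > 0, r ≤ r₀ ∧ r ≤ R :=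
    ⟨min r₀ R, lt_min hr₀ hR, min_le_left _ _, min_le_right _ _⟩
  obtain ⟨ρ, hρ, hright⟩ := eventually_stripNhds_iff.1 ((hright.and
    (hPQ.snd.eventually_nonneg hb)).and ((hPQ.snd.tendsto_zero hb).eventually_lt_const hr))
  refine ⟨Θ, r, ρ, hr, hrR, hρ, smoothOnCylinder_of_lift hPQ.fst.smooth hPQ.snd.isLift.smooth hΘ,
    fun u hu => ?_, fun v hv => ?_⟩
  · obtain ⟨⟨s, y⟩, rfl⟩ := cylinderCover_surjective a u
    change y ∈ Ico 0 r at hu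
    obtain ⟨⟨hP, hQ⟩, hG⟩ := hleft s y (by rw [abs_of_nonneg hu.1]; exact hu.2.trans_le hrr₀)
    rw [hΨ, hΘ, hP, hQ]
    exact ⟨rfl, hG hu.1⟩
  · obtain ⟨⟨s, y⟩, rfl⟩ := cylinderCover_surjective b v
    change y ∈ Ico 0 ρ at hv
    obtain ⟨⟨⟨hF, hG⟩, hQ⟩, hQr⟩ := hright s y (by rw [abs_of_nonneg hv.1]; exact hv.2)
    rw [hΘ, hΨ, hF, hG]
    exact ⟨rfl, hQ hv.1, hQr⟩

theorem IsStripCoord.exists_isCylinderDiffeo {M : ℝ} (hRM : R ≤ M) :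
    ∃ (U : Set (AddCircle a × ℝ)) (ε : ℝ) (V : Set (AddCircle b × ℝ)),
      0 < ε ∧ IsBoundaryNhd (Icc 0 M) U ∧ IsBoundaryNhd (Ico 0 ε) V ∧ IsCylinderDiffeo Ψ U V ∧
      ∀ p ∈ U, p.2 ∈ Ico 0 R := by
  obtain ⟨Θ, r, ρ, hr, hrR, hρ, hΘ, hΘΨ, hΨΘ⟩ := h.exists_cylinder_inverse ha hb hΨ hR
  have hcont : Continuous fun u => (Ψ u).2 := by
    refine continuous_of_comp_cylinderCover ?_
    simp only [hΨ]
    exact h.snd.isLift.smooth.continuous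
  have hzero : ∀ x, (Ψ (x, 0)).2 = 0 := fun x => by
    obtain ⟨t, rfl⟩ := QuotientAddGroup.mk_surjective x
    exact (congrArg Prod.snd (hΨ (t, 0))).trans (h.snd.map_zero t)
  have hinv : InvOn Θ Ψ {u | u.2 ∈ Ico 0 r ∧ (Ψ u).2 ∈ Ico 0 ρ} {v | v.2 ∈ Ico 0 ρ} :=
    ⟨fun u hu => (hΘΨ u hu.1).1, fun v hv => (hΨΘ v hv).1⟩
  have hbij := hinv.bijOn (fun u hu => hu.2) fun v hv => ⟨(hΨΘ v hv).2, by rwa [(hΨΘ v hv).1]⟩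
  have hΨ_smooth := smoothOnCylinder_of_lift h.fst.smooth h.snd.isLift.smooth hΨ
  exact ⟨_, ρ, _, hρ, isBoundaryNhd_setOf_mem_Ico_and hr (hrR.trans hRM) hρ hcont hzero
    fun u hu => (hΘΨ u hu).2, isBoundaryNhd_setOf_snd_mem_Ico hρ,
    ⟨hbij, hΨ_smooth _, Θ, hinv, hΘ _⟩, fun p hp => Ico_subset_Ico_right hrR hp.1⟩

end Diffeo

namespace BilliardTable

variable {B : BilliardTable} {k : ℕ} {A F G : ℝ × ℝ → ℝ}

theorem HasChordAngle.exists_eventually_abs_le {N : ℕ} (hA : B.HasChordAngle A) {b : ℝ}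
    (h : IsStripCoord B.ℓ b F G) (hshear : IsShearUpTo N A F G) :
    ∃ C > 0, ∀ᶠ q in stripNhdsPos, ∃ p, B.billiardMap (cylinderCover B.ℓ q) = cylinderCover B.ℓ p ∧
      |F p - (F q + G q)| ≤ C * G q ^ N ∧ |G p - G q| ≤ C * G q ^ N := by
  have hℓ := B.length_pos
  obtain ⟨D, hD, hAD, -⟩ := hA.isBoundaryDefining.exists_inverse hℓ
  have hDpos := hD.tendsto_prodMk_pos hℓ Prod.fst
  have hDG : (fun q => D q ^ N) =O[stripNhdsPos] fun q => G q ^ N :=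
    (hD.pow_isBigO hℓ N).trans ((h.snd.snd_isBigO hℓ).pow N)
  obtain ⟨C₁, hC₁, hfst⟩ := ((hshear.fst.comp_tendsto hDpos).trans hDG).exists_pos
  obtain ⟨C₂, -, hsnd⟩ := ((hshear.snd.comp_tendsto hDpos).trans hDG).exists_pos
  refine ⟨max C₁ C₂, lt_max_of_lt_left hC₁, ?_⟩
  filter_upwards [hfst.bound, hsnd.bound, stripNhdsPos_le hAD, hDpos.eventually hA.billiardMap_eq,
    (tendsto_stripNhdsPos_iff.1 (h.snd.tendsto_prodMk_pos hℓ Prod.fst)).2]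
    with q hfst_le hsnd_le hAq hbill hGq
  have hpow : 0 ≤ G q ^ N := pow_nonneg (le_of_lt hGq) N
  simp only [Function.comp, hAq, Real.norm_eq_abs, abs_of_nonneg hpow] at hfst_le hsnd_le hbill
  refine ⟨_, hbill, ?_, hsnd_le.trans (mul_le_mul_of_nonneg_right (le_max_right _ _) hpow)⟩
  rw [← sub_sub]
  exact hfst_le.trans (mul_le_mul_of_nonneg_right (le_max_left _ _) hpow)

theorem HasChordAngle.conjugatesToNormalForm (hA : B.HasChordAngle A)
    (h : IsStripCoord B.ℓ 1 F G) (hshear : IsShearUpTo (2 * k + 2) A F G)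
    {Ψ : AddCircle B.ℓ × ℝ → UnitAddCircle × ℝ}
    (hΨ : ∀ p, Ψ (cylinderCover B.ℓ p) = cylinderCover 1 (F p, G p)) :
    ∃ R > 0, ∀ U : Set (AddCircle B.ℓ × ℝ), (∀ u ∈ U, u.2 ∈ Ico 0 R) →
      B.ConjugatesToNormalForm k Ψ U := by
  obtain ⟨C, hC, hconj⟩ := hA.exists_eventually_abs_le h hshear
  obtain ⟨R, hR, hconj⟩ := eventually_stripNhdsPos_iff.1 hconj
  refine ⟨R, hR, fun U hU => ⟨C, hC, 1, one_pos, fun u hu _ _ => ?_⟩⟩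
  obtain ⟨hnonneg, hlt⟩ := hU u hu
  obtain ⟨⟨s, y⟩, rfl⟩ := cylinderCover_surjective B.ℓ u
  rcases hnonneg.eq_or_lt with hzero | hpos
  · obtain rfl : 0 = y := hzero
    have hfix : B.billiardMap (cylinderCover B.ℓ (s, 0)) = cylinderCover B.ℓ (s, 0) :=
      B.billiardMap_zero _
    rw [hfix, hΨ]
    simp [cylinderCover, h.snd.map_zero]
  · obtain ⟨p, hbill, hfst, hsnd⟩ := hconj s y hpos hlt
    rw [hbill, hΨ, hΨ]
    refine ⟨?_, hsnd⟩
    simp only [cylinderCover]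
    rw [← AddCircle.coe_add, ← AddCircle.coe_sub]
    exact QuotientAddGroup.norm_mk_le_norm.trans hfst

theorem HasChordAngle.exists_isLazutkinChange (hA : B.HasChordAngle A) {x₀ : ℝ → ℝ}
    {X Y : ℕ → ℝ → ℝ} (hcoeff : IsLazutkinCoeff B.ℓ 1 x₀ X Y)
    (h : IsStripCoord B.ℓ 1 (lazutkinFst k x₀ X) (lazutkinSnd k Y))
    (hshear : IsShearUpTo (2 * k + 2) A (lazutkinFst k x₀ X) (lazutkinSnd k Y)) :
    ∃ Ψ : AddCircle B.ℓ × ℝ → UnitAddCircle × ℝ, B.IsLazutkinChange k Ψ := by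
  have hx₀ : Function.Periodic (fun t => (x₀ t : UnitAddCircle)) B.ℓ := fun t => by
    simp only [hcoeff.map_add_base, AddCircle.coe_add_period]
  let X₀' := hx₀.lift
  let X' := fun j => (hcoeff.periodic_fst j).lift
  let Y' := fun j => (hcoeff.periodic_snd j).lift
  have hΨ : ∀ p, B.lazutkinForm k X₀' X' Y' (cylinderCover B.ℓ p) =
      cylinderCover 1 (lazutkinFst k x₀ X p, lazutkinSnd k Y p) :=
    lazutkinForm_cylinderCover fun t => rfl
  obtain ⟨R, hR, hconj⟩ := hA.conjugatesToNormalForm h hshear hΨ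
  obtain ⟨U, ε, V, hε, hU, hV, hdiffeo, hUR⟩ := h.exists_isCylinderDiffeo B.length_pos one_pos hΨ
    (lt_min hR Real.pi_pos) (min_le_right R Real.pi)
  refine ⟨_, ⟨X₀', X', Y', smoothToCircleOn_coe 1 hcoeff.contDiff_base.contDiffOn,
    hcoeff.contDiff_fst, hcoeff.contDiff_snd, rfl⟩, U, ε, V, hε, hU, hV, hdiffeo,
    hconj U fun u hu => ?_⟩
  exact Ico_subset_Ico_right (min_le_left _ _) (hUR u hu)

end BilliardTable

end

theorem mainTheorem4 (B : BilliardTable) (k : ℕ) (hk : 0 < k) :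
    (∃ Ψ : AddCircle B.ℓ × ℝ → UnitAddCircle × ℝ, B.IsLazutkinChange k Ψ) ↔
      ∃ ε > (0 : ℝ), ∃ Z : UnitAddCircle → ℝ → ℂ, B.IsAngularFunction k ε Z := by
  have hℓ := B.length_pos
  obtain ⟨A, hA⟩ := B.exists_hasChordAngle
  have hA' := hA.isBoundaryDefining
  constructor
  · rintro ⟨Ψ, hΨ⟩
    obtain ⟨x₀, X, Y, hXY, hshear⟩ := hΨ.exists_isStripCoord hA' hA.billiardMap_eq
    obtain ⟨S, hS⟩ := hshear.exists_isAngularLift hℓ hA' hXY lazutkinFst_neg lazutkinSnd_neg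
    obtain ⟨S, hS, hbase⟩ := hS.exists_fixed_base hℓ
    exact hA.exists_isAngularFunction hS hbase
  · rintro ⟨ε, hε, Z, hZ⟩
    obtain ⟨S, hS⟩ := hZ.exists_isAngularLift hε hA
    obtain ⟨P, Q, hPQ, hP, hQ, hshear⟩ := hS.exists_isShearUpTo hℓ hA'
    obtain ⟨x₀, X, Y, hcoeff, hcoord, hshear⟩ := hshear.exists_lazutkin hk hℓ hPQ hA' hP hQ
    exact hA.exists_isLazutkinChange hcoeff hcoord hshear
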